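/- **Lemma 2.1.** Let $d_L,d_R\in\mathbb C^\times$. For words $w,w'$ in two letters $X,X^*$, let $K_{w,w'}$ be the (finite) set of oriented Kauffman diagrams of type $(w,w')$: isotopy classes of systems of non-crossing oriented strings in a rectangle, without closed loops, joining in pairs the boundary points, which are labelled by the letters of $w$ (upper side, from left to right) and of $w'$ (lower side); an upper point is the start of its string if its letter is $X$ and the end if it is $X^*$, a lower point is the end of its string if its letter is $X$ and the start if it is $X^*$. Let $\mathcal O_{d_L,d_R}$ be the strict $\mathbb C$-linear monoidal category whose objects are the words $X^w$, with $\mathrm{Hom}(X^w,X^{w'})=\mathbb C[K_{w,w'}]$; composition is the bilinear extension of vertical concatenation (the first morphism on top), where each anticlockwise loop is replaced by $d_L$ and each clockwise loop by $d_R$; the tensor product is concatenation of words and horizontal juxtaposition of diagrams; the unit object $I$ is the empty word. Let $\epsilon_X:X\otimes X^*\to I$, $\epsilon_{X^*}:X^*\otimes X\to I$, $\delta_X:I\to X^*\otimes X$, $\delta_{X^*}:I\to X\otimes X^*$ be the four diagrams consisting of a single arc. Let $\mathcal T$ be a $\mathbb C$-linear monoidal category (with bilinear tensor product). A morphism $\epsilon:V\otimes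 W\to I$ in $\mathcal T$ is a *rigidity pairing* with *copairing* $\delta:I\to W\otimes V$ if $(\epsilon\otimes 1_V)(1_V\otimes\delta)=1_V$ and $(1_W\otimes\epsilon)(\delta\otimes 1_W)=1_W$ (associativity and unit constraints suppressed). All functors are $\mathbb C$-linear, monoidal functors have invertible structure morphisms, and for a monoidal functor $F$ the images $F(\epsilon_X):F(X)\otimes F(X^*)\to I$, etc., are formed with the structure morphisms of $F$. 1. For every monoidal functor $F:\mathcal O_{d_L,d_R}\to\mathcal T$, the morphisms $F(\epsilon_X)$ and $F(\epsilon_{X^*})$ are rigidity pairings with copairings $F(\delta_X)$ and $F(\delta_{X^*})$, which are their only copairings, and $$F(\epsilon_X)F(\delta_{X^*})=d_L1_I,\qquad F(\epsilon_{X^*})F(\delta_X)=d_R1_I .$$ 2. $F$ is determined by these pairings: if $F,G:\mathcal O_{d_L,d_R}\to\mathcal T$ are strict monoidal functors with $F(X)=G(X)$, $F(X^*)=G(X^*)$, $F(\epsilon_X)=G(\epsilon_X)$ and $F(\epsilon_{X^*})=G(\epsilon_{X^*})$, then $F=G$. If $F,G$ are monoidal functors, not necessarily strict, with these equalities, then there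 is exactly one monoidal natural isomorphism $F\cong G$ whose components at $X$ and $X^*$ are the identities. 3. Conversely, let $\epsilon_Y:Y\otimes Y^*\to I$ and $\epsilon_{Y^*}:Y^*\otimes Y\to I$ be rigidity pairings in $\mathcal T$ (where $Y,Y^*$ are two objects of $\mathcal T$) with copairings $\delta_Y$ and $\delta_{Y^*}$ such that $$\epsilon_Y\delta_{Y^*}=d_L1_I,\qquad \epsilon_{Y^*}\delta_Y=d_R1_I .$$ Then there is a monoidal functor $F:\mathcal O_{d_L,d_R}\to\mathcal T$ with $F(X)=Y$, $F(X^*)=Y^*$, $F(\epsilon_X)=\epsilon_Y$ and $F(\epsilon_{X^*})=\epsilon_{Y^*}$. If $\mathcal T$ is strict, then $F$ can be chosen strict. -/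

import Mathlib

namespace OrientedKauffman

set_option linter.unusedSimpArgs false
set_option linter.unusedVariables false
set_option linter.unnecessarySeqFocus false

/-- A planar oriented pairing of labelled points. The points of `A` are placed on a line by
`key`; `flow x = none` means that `x` is not an end point of a string, `flow x = some true` that
the string at `x` starts there, and `flow x = some false` that it ends there. The string at `x` has
the other end `σ x` (with `σ x = x` if there is no string at `x`); every string has one starting
point and one ending point, and no two strings cross. -/
structure IsPlanarPairing {A K : Type} [LinearOrder K] (key : A → K)
    (flow : A → Option Bool) (σ : A → A) : Prop where
  invol : ∀ x, σ (σ x) = x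
  fixed : ∀ x, flow x = none → σ x = x
  orient : ∀ x, flow (σ x) = (flow x).map not
  planar : ∀ x y, key x < key y → key y < key (σ x) → ¬ key (σ x) < key (σ y)

/-- Glue the end points `p` and `q` of two strings (or of one string) of the pairing `σ`: the
other ends of these strings become partners of each other, and `p`, `q` disappear (they become fixed
points). If `p` and `q` are the two ends of one string, this closes a loop, which is dropped. -/
def glue {A : Type} [DecidableEq A] (p q : A) (σ : A → A) : A → A := fun x =>
  if x = p ∨ x = q then x
  else if σ x = p then σ q
  else if σ x = q then σ p
  else σ x

/-- Glue `P i` to `Q i`, first for `i = n - 1`, then for `i = n - 2`, ..., at last for `i = 0`. -/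
def glueAll {A : Type} [DecidableEq A] (P Q : ℕ → A) : ℕ → (A → A) → (A → A)
  | 0, σ => σ
  | n + 1, σ => glueAll P Q n (glue (P n) (Q n) σ)

/-- The product of the values `c i` of the loops that are closed in `glueAll P Q n σ`, where
the loop that is closed by the gluing of `P i` to `Q i` has the value `c i`. -/
def loopWeight {A : Type} [DecidableEq A] (P Q : ℕ → A) (c : ℕ → ℂ) : ℕ → (A → A) → ℂ
  | 0, _ => 1
  | n + 1, σ => (if σ (P n) = Q n then c n else 1) * loopWeight P Q c n (glue (P n) (Q n) σ)

section general
set_option linter.unusedSectionVars false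
variable {A B K : Type} [DecidableEq A] [DecidableEq B] [LinearOrder K]

/-- The labelling `fl` after `p` and `q` have been removed. -/
def erase (p q : A) (fl : A → Option Bool) : A → Option Bool :=
  fun x => if x = p ∨ x = q then none else fl x

theorem IsPlanarPairing.ne {key : A → K} {fl : A → Option Bool} {σ : A → A}
    (h : IsPlanarPairing key fl σ) {x : A} (hx : fl x ≠ none) : σ x ≠ x := by
  intro e
  have := h.orient x
  rw [e] at this
  revert this hx
  rcases fl x with _ | b
  · simp
  · cases b <;> simp

theorem IsPlanarPairing.glue {key : A → K} (hk : Function.Injective key)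
    {fl : A → Option Bool} {σ : A → A}
    (h : IsPlanarPairing key fl σ) {p q : A} (hp : fl p ≠ none) (hq : fl q = (fl p).map not)
    (hpq : key p < key q) (had : ∀ x, key p < key x → key x < key q → fl x = none) :
    IsPlanarPairing key (erase p q fl) (glue p q σ) := by
  have hq' : fl q ≠ none := by rw [hq]; simpa using hp
  have np := h.ne hp
  have nq := h.ne hq'
  have npq : p ≠ q := by rintro rfl; exact lt_irrefl _ hpq
  have I := h.invol
  have F := h.fixed
  have O := h.orient
  have nn : ∀ o : Option Bool, (o.map not).map not = o := by
    intro o; rcases o with _ | b <;> simp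
  refine ⟨?_, ?_, ?_, ?_⟩
  · intro x
    unfold OrientedKauffman.glue
    grind
  · intro x hx
    unfold OrientedKauffman.glue
    unfold erase at hx
    grind
  · intro x
    have h1 := O x
    have h2 := O p
    have h3 := O q
    have h4 := nn (fl p)
    have h5 := nn (fl q)
    have h6 := nn (fl x)
    unfold OrientedKauffman.glue erase
    grind
  · intro x y h1 h2 h3
    have out : ∀ z, fl z ≠ none → z ≠ p → z ≠ q → key z < key p ∨ key q < key z := by
      intro z hz zp zq
      by_contra hc
      push Not at hc
      exact hz (had z (lt_of_le_of_ne hc.1 (fun e => zp (hk e).symm))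
        (lt_of_le_of_ne hc.2 (fun e => zq (hk e))))
    have C := h.planar
    have act : ∀ z, σ z ≠ z → fl z ≠ none := fun z hz hn => hz (F z hn)
    have gx : OrientedKauffman.glue p q σ x ≠ x := by
      intro e; rw [e] at h2; exact lt_asymm h1 h2
    have gy : OrientedKauffman.glue p q σ y ≠ y := by
      intro e; rw [e] at h3; exact lt_asymm h2 h3
    have xp : x ≠ p ∧ x ≠ q := by unfold OrientedKauffman.glue at gx; grind
    have yp : y ≠ p ∧ y ≠ q := by unfold OrientedKauffman.glue at gy; grind
    have sx : σ x ≠ x := by unfold OrientedKauffman.glue at gx; grind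
    have sy : σ y ≠ y := by unfold OrientedKauffman.glue at gy; grind
    have ox := out x (act x sx) xp.1 xp.2
    have oy := out y (act y sy) yp.1 yp.2
    have osx : σ x ≠ p → σ x ≠ q → _ := out (σ x) (act (σ x) (by rw [I]; exact sx.symm))
    have osy : σ y ≠ p → σ y ≠ q → _ := out (σ y) (act (σ y) (by rw [I]; exact sy.symm))
    have osp : σ p ≠ q → _ := out (σ p) (act (σ p) (by rw [I]; exact np.symm)) np
    have osq : σ q ≠ p → _ := fun hh => out (σ q) (act (σ q) (by rw [I]; exact nq.symm)) hh nq
    -- an arc does not separate the two ends of another arc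
    have sep1 : ∀ a b, key a < key (σ a) → b ≠ a → b ≠ σ a →
        (key a < key b ∧ key b < key (σ a)) →
        (key a < key (σ b) ∧ key (σ b) < key (σ a)) := by
      intro a b hab hb1 hb2 ⟨h1, h2⟩
      have e1 : σ b ≠ a := fun e => hb2 (by rw [← e, I])
      have e2 : σ b ≠ σ a := fun e => hb1 (by rw [← I b, e, I])
      constructor
      · by_contra hc
        have := lt_of_le_of_ne (not_lt.1 hc) (fun e => e1 (hk e))
        exact C (σ b) a this (by rwa [I]) (by rwa [I])
      · by_contra hc
        have := lt_of_le_of_ne (not_lt.1 hc) (fun e => e2 (hk e).symm)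
        exact C a b h1 h2 this
    have sep2 : ∀ a b, key a < key (σ a) → b ≠ a → b ≠ σ a →
        (key a < key (σ b) ∧ key (σ b) < key (σ a)) →
        (key a < key b ∧ key b < key (σ a)) := by
      intro a b hab hb1 hb2 hh
      have e1 : σ b ≠ a := fun e => hb2 (by rw [← e, I])
      have e2 : σ b ≠ σ a := fun e => hb1 (by rw [← I b, e, I])
      have := sep1 a (σ b) hab e1 e2 hh
      rwa [I] at this
    have xo : ¬(x = p ∨ x = q) := not_or.2 xp
    have yo : ¬(y = p ∨ y = q) := not_or.2 yp
    clear gx gy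
    unfold OrientedKauffman.glue at h2 h3
    rw [if_neg xo] at h2 h3
    rw [if_neg yo] at h3
    by_cases hx : σ x = p ∨ σ x = q
    · by_cases hy : σ y = p ∨ σ y = q
      · have : σ x ≠ σ y := by
          intro e
          have : x = y := by rw [← I x, e, I]
          subst this; exact lt_irrefl _ h1
        exfalso
        rcases hx with hx | hx <;> rcases hy with hy | hy
        · exact this (hx.trans hy.symm)
        · rw [if_pos hx, ← hy, I] at h2
          exact lt_irrefl _ h2
        · rw [if_neg (by rw [hx]; exact npq.symm), if_pos hx, ← hy, I] at h2
          exact lt_irrefl _ h2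
        · exact this (hx.trans hy.symm)
      · rw [not_or] at hy
        rw [if_neg hy.1, if_neg hy.2] at h3
        have osy' := osy hy.1 hy.2
        have yy : key y < key (σ y) := lt_trans h2 h3
        have npy : p ≠ σ y := fun e => hy.1 e.symm
        have nqy : q ≠ σ y := fun e => hy.2 e.symm
        have s1 := sep1 y p yy yp.1.symm npy
        have s2 := sep1 y q yy yp.2.symm nqy
        have s3 := sep2 y p yy yp.1.symm npy
        have s4 := sep2 y q yy yp.2.symm nqy
        have Ix := I x
        rcases hx with hx | hx
        · have e : σ p = x := by rw [← hx, I]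
          rw [if_pos hx] at h2 h3
          have t1 := s4 ⟨h2, h3⟩
          have t2 : key y < key p ∧ key p < key (σ y) := by
            rcases oy with o | o
            · rcases osy' with o' | o'
              · exact absurd (lt_trans t1.2 o') (lt_asymm hpq)
              · exact ⟨o, lt_trans hpq o'⟩
            · exact absurd t1.1 (lt_asymm o)
          have t3 := (s1 t2).1
          rw [e] at t3
          exact lt_asymm h1 t3
        · have e : σ q = x := by rw [← hx, I]
          rw [if_neg (by rw [hx]; exact npq.symm), if_pos hx] at h2 h3
          have t1 := s3 ⟨h2, h3⟩
          have t2 : key y < key q ∧ key q < key (σ y) := by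
            refine ⟨lt_trans t1.1 hpq, ?_⟩
            rcases osy' with o' | o'
            · exact absurd t1.2 (lt_asymm o')
            · exact o'
          have t3 := (s2 t2).1
          rw [e] at t3
          exact lt_asymm h1 t3
    · rw [not_or] at hx
      rw [if_neg hx.1, if_neg hx.2] at h2 h3
      have xx : key x < key (σ x) := lt_trans h1 h2
      by_cases hy : σ y = p ∨ σ y = q
      · have osx' := osx hx.1 hx.2
        have npx : p ≠ σ x := fun e => hx.1 e.symm
        have nqx : q ≠ σ x := fun e => hx.2 e.symm
        have s1 := sep1 x p xx xp.1.symm npx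
        have s2 := sep1 x q xx xp.2.symm nqx
        have yne : y ≠ σ x := by rintro e; rw [← e] at h2; exact lt_irrefl _ h2
        have yne' : y ≠ x := by rintro e; rw [e] at h1; exact lt_irrefl _ h1
        have s5 := sep1 x y xx yne' yne ⟨h1, h2⟩
        rcases hy with hy | hy
        · rw [if_pos hy] at h3
          rw [hy] at s5
          have t2 : key x < key q ∧ key q < key (σ x) := by
            refine ⟨lt_trans s5.1 hpq, ?_⟩
            rcases osx' with o' | o'
            · exact absurd s5.2 (lt_asymm o')
            · exact o'
          exact lt_asymm h3 (s2 t2).2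
        · rw [if_neg (by rw [hy]; exact npq.symm), if_pos hy] at h3
          rw [hy] at s5
          have t2 : key x < key p ∧ key p < key (σ x) := by
            refine ⟨?_, lt_trans hpq s5.2⟩
            rcases ox with o' | o'
            · exact o'
            · exact absurd s5.1 (lt_asymm o')
          exact lt_asymm h3 (s1 t2).2
      · rw [not_or] at hy
        rw [if_neg hy.1, if_neg hy.2] at h3
        exact C x y h1 h2 h3

/-- `P i` can be glued to `Q i` for `i = n - 1, ..., 0` in this order without crossings: when it is
the turn of `i`, nothing is left between `P i` and `Q i`. -/
structure Gluable (key : A → K) (fl : A → Option Bool) (P Q : ℕ → A) (n : ℕ) : Prop where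
  act : ∀ i < n, fl (P i) ≠ none
  opp : ∀ i < n, fl (Q i) = (fl (P i)).map not
  lt : ∀ i < n, key (P i) < key (Q i)
  adj : ∀ i < n, ∀ x, key (P i) < key x → key x < key (Q i) →
    fl x = none ∨ ∃ j < n, i < j ∧ (x = P j ∨ x = Q j)
  inj : ∀ i < n, ∀ j < n, i ≠ j → P i ≠ P j ∧ Q i ≠ Q j ∧ P i ≠ Q j

theorem Gluable.top {key : A → K} {fl : A → Option Bool} {P Q : ℕ → A} {n : ℕ}
    (h : Gluable key fl P Q (n + 1)) (x : A) (h1 : key (P n) < key x) (h2 : key x < key (Q n)) :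
    fl x = none := by
  rcases h.adj n (by omega) x h1 h2 with h | ⟨j, hj, hj', _⟩
  · exact h
  · omega

theorem Gluable.step {key : A → K} {fl : A → Option Bool} {P Q : ℕ → A} {n : ℕ}
    (h : Gluable key fl P Q (n + 1)) : Gluable key (erase (P n) (Q n) fl) P Q n := by
  have e : ∀ i < n, erase (P n) (Q n) fl (P i) = fl (P i) := by
    intro i hi
    have := h.inj i (by omega) n (by omega) (by omega)
    have := h.inj n (by omega) i (by omega) (by omega)
    unfold erase; grind
  have e' : ∀ i < n, erase (P n) (Q n) fl (Q i) = fl (Q i) := by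
    intro i hi
    have := h.inj i (by omega) n (by omega) (by omega)
    have := h.inj n (by omega) i (by omega) (by omega)
    unfold erase; grind
  refine ⟨?_, ?_, ?_, ?_, ?_⟩
  · intro i hi; rw [e i hi]; exact h.act i (by omega)
  · intro i hi; rw [e i hi, e' i hi]; exact h.opp i (by omega)
  · intro i hi; exact h.lt i (by omega)
  · intro i hi x h1 h2
    rcases h.adj i (by omega) x h1 h2 with h3 | ⟨j, hj, hj', h3⟩
    · left; unfold erase; grind
    · by_cases hjn : j = n
      · left; subst hjn; unfold erase; grind
      · right; exact ⟨j, by omega, hj', h3⟩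
  · intro i hi j hj hij; exact h.inj i (by omega) j (by omega) hij

theorem Gluable.erase {key : A → K} {fl : A → Option Bool} {P Q : ℕ → A} {n : ℕ}
    (h : Gluable key fl P Q n) {r s : A} (hr : ∀ i < n, P i ≠ r ∧ Q i ≠ r ∧ P i ≠ s ∧ Q i ≠ s) :
    Gluable key (erase r s fl) P Q n := by
  have e : ∀ i < n, OrientedKauffman.erase r s fl (P i) = fl (P i) := by
    intro i hi
    have := hr i hi
    unfold OrientedKauffman.erase; grind
  have e' : ∀ i < n, OrientedKauffman.erase r s fl (Q i) = fl (Q i) := by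
    intro i hi
    have := hr i hi
    unfold OrientedKauffman.erase; grind
  refine ⟨?_, ?_, h.lt, ?_, h.inj⟩
  · intro i hi; rw [e i hi]; exact h.act i hi
  · intro i hi; rw [e i hi, e' i hi]; exact h.opp i hi
  · intro i hi x h1 h2
    rcases h.adj i hi x h1 h2 with h3 | h3
    · left; unfold OrientedKauffman.erase; grind
    · right; exact h3

/-- The labelling `fl` after all `P i` and `Q i`, `i < n`, have been removed. -/
def eraseAll (P Q : ℕ → A) : ℕ → (A → Option Bool) → (A → Option Bool)
  | 0, fl => fl
  | n + 1, fl => eraseAll P Q n (erase (P n) (Q n) fl)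

theorem eraseAll_apply (P Q : ℕ → A) (n : ℕ) (fl : A → Option Bool) (x : A)
    (hx : ∀ i < n, x ≠ P i ∧ x ≠ Q i) : eraseAll P Q n fl x = fl x := by
  induction n generalizing fl with
  | zero => rfl
  | succ n ih =>
    have := hx n (by omega)
    rw [eraseAll, ih _ (fun i hi => hx i (by omega))]
    unfold erase; grind

theorem eraseAll_none (P Q : ℕ → A) (n : ℕ) (fl : A → Option Bool) (x : A)
    (hx : fl x = none ∨ ∃ i < n, x = P i ∨ x = Q i) : eraseAll P Q n fl x = none := by
  induction n generalizing fl with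
  | zero => simpa [eraseAll] using hx
  | succ n ih =>
    rw [eraseAll]
    apply ih
    rcases hx with hx | ⟨i, hi, hx⟩
    · left; unfold erase; grind
    · by_cases hin : i = n
      · left; subst hin; unfold erase; grind
      · right; exact ⟨i, by omega, hx⟩

theorem IsPlanarPairing.glueStep {key : A → K} (hk : Function.Injective key)
    {fl : A → Option Bool} {σ : A → A} {P Q : ℕ → A} {n : ℕ}
    (h : IsPlanarPairing key fl σ) (hg : Gluable key fl P Q (n + 1)) :
    IsPlanarPairing key (OrientedKauffman.erase (P n) (Q n) fl)
      (OrientedKauffman.glue (P n) (Q n) σ) :=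
  h.glue hk (hg.act n (by omega)) (hg.opp n (by omega)) (hg.lt n (by omega)) hg.top

theorem IsPlanarPairing.glueAll {key : A → K} (hk : Function.Injective key)
    {fl : A → Option Bool} {σ : A → A} {P Q : ℕ → A} {n : ℕ}
    (h : IsPlanarPairing key fl σ) (hg : Gluable key fl P Q n) :
    IsPlanarPairing key (eraseAll P Q n fl) (glueAll P Q n σ) := by
  induction n generalizing fl σ with
  | zero => exact h
  | succ n ih => exact ih (h.glueStep hk hg) hg.step

theorem glue_comm {key : A → K} 
    {fl : A → Option Bool} {σ : A → A} (h : IsPlanarPairing key fl σ) {p q r s : A}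
    (hpq : key p < key q) (hqr : key q < key r) (hrs : key r < key s)
    (hp : fl p ≠ none) (hq : fl q = (fl p).map not) (hr : fl r ≠ none)
    (hs : fl s = (fl r).map not) (val : Option Bool → ℂ) :
    glue p q (glue r s σ) = glue r s (glue p q σ) ∧
    (if σ r = s then val (fl r) else 1) * (if glue r s σ p = q then val (fl p) else 1) =
    (if σ p = q then val (fl p) else 1) * (if glue p q σ r = s then val (fl r) else 1) := by
  have I := h.invol
  have hq' : fl q ≠ none := by rw [hq]; simpa using hp
  have hs' : fl s ≠ none := by rw [hs]; simpa using hr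
  have np := h.ne hp
  have nq := h.ne hq'
  have nr := h.ne hr
  have ns := h.ne hs'
  have e1 : p ≠ q := by rintro rfl; exact lt_irrefl _ hpq
  have e2 : q ≠ r := by rintro rfl; exact lt_irrefl _ hqr
  have e3 : r ≠ s := by rintro rfl; exact lt_irrefl _ hrs
  have e4 : p ≠ r := by rintro rfl; exact lt_asymm hpq hqr
  have e5 : q ≠ s := by rintro rfl; exact lt_asymm hqr hrs
  have e6 : p ≠ s := by rintro rfl; exact lt_irrefl _ (hpq.trans (hqr.trans hrs))
  have Ip := I p
  have Iq := I q
  have Ir := I r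
  have Is := I s
  have key1 : ¬ (σ p = r ∧ σ q = s) := by
    rintro ⟨h1, h2⟩
    refine h.planar p q hpq ?_ ?_
    · rwa [h1]
    · rwa [h1, h2]
  have key2 : σ p = s → σ q = r → fl p = fl r := by
    intro h1 h2
    have := h.orient p
    rw [h1, hs] at this
    revert this
    rcases fl r with _ | a <;> rcases fl p with _ | b
    · simp
    · simp
    · simp
    · cases a <;> cases b <;> simp
  have O := h.orient
  clear O
  constructor
  · funext x
    have Ix := I x
    unfold glue
    grind
  · unfold glue
    grind

theorem glueAll_comm_one {key : A → K} (hk : Function.Injective key)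
    {fl : A → Option Bool} {σ : A → A} {P Q : ℕ → A} {n : ℕ}
    (h : IsPlanarPairing key fl σ) (hg : Gluable key fl P Q n) {r s : A}
    (hr : fl r ≠ none) (hs : fl s = (fl r).map not) (hrs : key r < key s)
    (hlt : ∀ i < n, key (Q i) < key r) (val : Option Bool → ℂ) (c : ℕ → ℂ)
    (hc : ∀ i < n, c i = val (fl (P i))) :
    glueAll P Q n (glue r s σ) = glue r s (glueAll P Q n σ) ∧
    (if σ r = s then val (fl r) else 1) * loopWeight P Q c n (glue r s σ) =
    loopWeight P Q c n σ * (if glueAll P Q n σ r = s then val (fl r) else 1) := by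
  induction n generalizing fl σ with
  | zero => exact ⟨rfl, by rw [loopWeight, loopWeight, one_mul, mul_one]; rfl⟩
  | succ n ih =>
    have hn := hlt n (by omega)
    have hpq := hg.lt n (by omega)
    obtain ⟨c1, c2⟩ := glue_comm h hpq hn hrs (hg.act n (by omega)) (hg.opp n (by omega)) hr hs val
    have er : erase (P n) (Q n) fl r = fl r := by
      have : r ≠ P n := by rintro rfl; exact lt_asymm hpq hn
      have : r ≠ Q n := by rintro rfl; exact lt_irrefl _ hn
      unfold erase; grind
    have es : erase (P n) (Q n) fl s = fl s := by
      have : s ≠ P n := by rintro rfl; exact lt_irrefl _ (hpq.trans (hn.trans hrs))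
      have : s ≠ Q n := by rintro rfl; exact lt_asymm hrs hn
      unfold erase; grind
    have ep : ∀ i < n, erase (P n) (Q n) fl (P i) = fl (P i) := by
      intro i hi
      have := hg.inj i (by omega) n (by omega) (by omega)
      have := hg.inj n (by omega) i (by omega) (by omega)
      unfold erase; grind
    obtain ⟨d1, d2⟩ := ih (h.glueStep hk hg) hg.step (by rwa [er]) (by rw [er, es, hs])
      (fun i hi => hlt i (by omega)) (fun i hi => by rw [ep i hi]; exact hc i (by omega))
    rw [er] at d2
    simp only [glueAll, loopWeight]
    rw [c1]
    refine ⟨d1, ?_⟩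
    rw [hc n (by omega), ← mul_assoc, c2, mul_assoc, d2, mul_assoc]
    rfl

theorem glueAll_comm {key : A → K} (hk : Function.Injective key)
    {fl : A → Option Bool} {σ : A → A} {P Q R S : ℕ → A} {n m : ℕ}
    (h : IsPlanarPairing key fl σ) (hg : Gluable key fl P Q n) (hg' : Gluable key fl R S m)
    (hlt : ∀ i < n, ∀ j < m, key (Q i) < key (R j)) (val : Option Bool → ℂ) (c c' : ℕ → ℂ)
    (hc : ∀ i < n, c i = val (fl (P i))) (hc' : ∀ i < m, c' i = val (fl (R i))) :
    glueAll R S m (glueAll P Q n σ) = glueAll P Q n (glueAll R S m σ) ∧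
    loopWeight P Q c n σ * loopWeight R S c' m (glueAll P Q n σ) =
    loopWeight R S c' m σ * loopWeight P Q c n (glueAll R S m σ) := by
  induction m generalizing fl σ with
  | zero => simp [glueAll, loopWeight]
  | succ m ih =>
    have hrs := hg'.lt m (by omega)
    obtain ⟨c1, c2⟩ := glueAll_comm_one hk h hg (hg'.act m (by omega)) (hg'.opp m (by omega)) hrs
      (fun i hi => hlt i hi m (by omega)) val c hc
    have hne : ∀ i < n, P i ≠ R m ∧ Q i ≠ R m ∧ P i ≠ S m ∧ Q i ≠ S m := by
      intro i hi
      have h1 := hg.lt i hi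
      have h2 := hlt i hi m (by omega)
      refine ⟨?_, ?_, ?_, ?_⟩ <;> intro e
      · rw [e] at h1; exact lt_asymm h1 h2
      · rw [e] at h2; exact lt_irrefl _ h2
      · rw [e] at h1; exact lt_asymm h1 (h2.trans hrs)
      · rw [e] at h2; exact lt_asymm h2 hrs
    have ep : ∀ i < n, erase (R m) (S m) fl (P i) = fl (P i) := by
      intro i hi
      have := hne i hi
      unfold erase; grind
    have er : ∀ i < m, erase (R m) (S m) fl (R i) = fl (R i) := by
      intro i hi
      have := hg'.inj i (by omega) m (by omega) (by omega)
      have := hg'.inj m (by omega) i (by omega) (by omega)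
      unfold erase; grind
    obtain ⟨d1, d2⟩ := ih (h.glueStep hk hg') (hg.erase hne) hg'.step
      (fun i hi j hj => hlt i hi j (by omega))
      (fun i hi => by rw [ep i hi]; exact hc i hi)
      (fun i hi => by rw [er i hi]; exact hc' i (by omega))
    simp only [glueAll, loopWeight]
    rw [← c1]
    refine ⟨d1, ?_⟩
    rw [hc' m (by omega), ← mul_assoc, ← c2, mul_assoc, d2, mul_assoc]

theorem glueAll_nat {e : A → B} {S : Set A} {σ : A → A} {τ : B → B} {P Q : ℕ → A} {P' Q' : ℕ → B}
    {n : ℕ} (c : ℕ → ℂ) (hS : ∀ x ∈ S, σ x ∈ S) (he : Set.InjOn e S)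
    (hστ : ∀ x ∈ S, τ (e x) = e (σ x))
    (hP : ∀ i < n, P i ∈ S ∧ P' i = e (P i)) (hQ : ∀ i < n, Q i ∈ S ∧ Q' i = e (Q i)) :
    (∀ x ∈ S, glueAll P' Q' n τ (e x) = e (glueAll P Q n σ x)) ∧
    (∀ x ∈ S, glueAll P Q n σ x ∈ S) ∧
    loopWeight P' Q' c n τ = loopWeight P Q c n σ := by
  induction n generalizing σ τ with
  | zero => exact ⟨hστ, hS, rfl⟩
  | succ n ih =>
    obtain ⟨hp, hp'⟩ := hP n (by omega)
    obtain ⟨hq, hq'⟩ := hQ n (by omega)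
    have E : ∀ x ∈ S, ∀ y ∈ S, (e x = e y ↔ x = y) := fun x hx y hy =>
      ⟨fun h => he hx hy h, fun h => by rw [h]⟩
    have key1 : ∀ x ∈ S, glue (P n) (Q n) σ x ∈ S := by
      intro x hx
      have := hS x hx
      have := hS _ hp
      have := hS _ hq
      unfold glue; grind
    have key2 : ∀ x ∈ S, glue (P' n) (Q' n) τ (e x) = e (glue (P n) (Q n) σ x) := by
      intro x hx
      unfold glue
      rw [hp', hq', hστ x hx, hστ _ hp, hστ _ hq]
      simp only [E x hx _ hp, E x hx _ hq, E _ (hS x hx) _ hp, E _ (hS x hx) _ hq]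
      split_ifs <;> rfl
    obtain ⟨d1, d2, d3⟩ := ih key1 key2 (fun i hi => hP i (by omega)) (fun i hi => hQ i (by omega))
    refine ⟨d1, d2, ?_⟩
    simp only [loopWeight]
    rw [d3]
    congr 1
    rw [hp', hq', hστ _ hp]
    simp only [E _ (hS _ hp) _ hq]

theorem glueAll_away {S : Set A} {σ : A → A} {P Q : ℕ → A} {n : ℕ}
    (hS : ∀ x ∈ S, σ x ∈ S) (hP : ∀ i < n, P i ∉ S ∧ Q i ∉ S) :
    ∀ x ∈ S, glueAll P Q n σ x = σ x := by
  induction n generalizing σ with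
  | zero => intro x _; rfl
  | succ n ih =>
    obtain ⟨hp, hq⟩ := hP n (by omega)
    have k : ∀ x ∈ S, glue (P n) (Q n) σ x = σ x := by
      intro x hx
      have := hS x hx
      unfold glue; grind
    intro x hx
    rw [glueAll, ih (fun y hy => by rw [k y hy]; exact hS y hy) (fun i hi => hP i (by omega)) x hx,
      k x hx]

theorem glueAll_add (P Q : ℕ → A) (c : ℕ → ℂ) (n m : ℕ) (σ : A → A) :
    glueAll P Q (n + m) σ = glueAll P Q n (glueAll (fun i => P (n + i)) (fun i => Q (n + i)) m σ) ∧
    loopWeight P Q c (n + m) σ =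
      loopWeight (fun i => P (n + i)) (fun i => Q (n + i)) (fun i => c (n + i)) m σ *
      loopWeight P Q c n (glueAll (fun i => P (n + i)) (fun i => Q (n + i)) m σ) := by
  induction m generalizing σ with
  | zero => simp [glueAll, loopWeight]
  | succ m ih =>
    obtain ⟨h1, h2⟩ := ih (glue (P (n + m)) (Q (n + m)) σ)
    rw [← Nat.add_assoc]
    simp only [glueAll, loopWeight]
    exact ⟨h1, by rw [h2, mul_assoc]⟩

theorem loopWeight_congr {P Q : ℕ → A} {c c' : ℕ → ℂ} {n : ℕ} (h : ∀ i < n, c i = c' i)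
    {σ : A → A} : loopWeight P Q c n σ = loopWeight P Q c' n σ := by
  induction n generalizing σ with
  | zero => rfl
  | succ n ih => rw [loopWeight, loopWeight, ih (fun i hi => h i (by omega)), h n (by omega)]

end general

section sums
set_option linter.unusedSectionVars false
variable {A B K L : Type} [DecidableEq A] [DecidableEq B] [LinearOrder K] [LinearOrder L]

/-- Place the points of `A` to the left of the points of `B`. -/
def sumKey (k : A → K) (l : B → L) : A ⊕ B → K ⊕ₗ L := fun x => toLex (Sum.map k l x)

theorem sumKey_injective {k : A → K} {l : B → L} (hk : Function.Injective k)
    (hl : Function.Injective l) : Function.Injective (sumKey k l) := by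
  intro x y h
  exact Sum.map_injective.2 ⟨hk, hl⟩ (toLex.injective h)

theorem IsPlanarPairing.sum {k : A → K} {l : B → L} {fl : A → Option Bool} {fl' : B → Option Bool}
    {σ : A → A} {τ : B → B} (h : IsPlanarPairing k fl σ) (h' : IsPlanarPairing l fl' τ) :
    IsPlanarPairing (sumKey k l) (Sum.elim fl fl') (Sum.map σ τ) := by
  refine ⟨?_, ?_, ?_, ?_⟩
  · rintro (x | x)
    · simp [h.invol]
    · simp [h'.invol]
  · rintro (x | x) hx
    · simpa using h.fixed x hx
    · simpa using h'.fixed x hx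
  · rintro (x | x)
    · simpa using h.orient x
    · simpa using h'.orient x
  · rintro (x | x) (y | y)
    · simpa [sumKey] using h.planar x y
    · simp [sumKey]
    · simp [sumKey]
    · simpa [sumKey] using h'.planar x y

theorem IsPlanarPairing.pullback {k : A → K} {l : B → L} {fl : A → Option Bool}
    {fl' : B → Option Bool} {σ : A → A} {τ : B → B} (h : IsPlanarPairing l fl' τ)
    {e : A → B} (he : ∀ x y, k x < k y ↔ l (e x) < l (e y)) (hi : Function.Injective e)
    (hστ : ∀ x, τ (e x) = e (σ x)) (hf : ∀ x, fl' (e x) = fl x) : IsPlanarPairing k fl σ := by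
  refine ⟨?_, ?_, ?_, ?_⟩
  · intro x; apply hi; rw [← hστ, ← hστ, h.invol]
  · intro x hx; apply hi; rw [← hστ]; exact h.fixed _ (by rw [hf, hx])
  · intro x; rw [← hf, ← hστ, h.orient, hf]
  · intro x y; rw [he, he, he, ← hστ, ← hστ]; exact h.planar _ _

theorem glueAll_inl (P Q : ℕ → A) (c : ℕ → ℂ) (n : ℕ) (σ : A → A) (τ : B → B) :
    glueAll (fun i => Sum.inl (P i)) (fun i => Sum.inl (Q i)) n (Sum.map σ τ) =
      Sum.map (glueAll P Q n σ) τ ∧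
    loopWeight (fun i => Sum.inl (P i)) (fun i => Sum.inl (Q i)) c n (Sum.map σ τ) =
      loopWeight P Q c n σ := by
  have h := glueAll_nat (e := (Sum.inl : A → A ⊕ B)) (S := Set.univ) (σ := σ) (τ := Sum.map σ τ)
    (P := P) (Q := Q) (P' := fun i => Sum.inl (P i)) (Q' := fun i => Sum.inl (Q i)) (n := n) c
    (by simp) (Sum.inl_injective.injOn) (by simp) (by simp) (by simp)
  refine ⟨?_, h.2.2⟩
  funext x
  rcases x with x | x
  · rw [h.1 x trivial]; rfl
  · exact glueAll_away (S := Set.range Sum.inr) (by rintro _ ⟨y, rfl⟩; exact ⟨τ y, rfl⟩)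
      (by simp) _ ⟨x, rfl⟩

end sums

/-- Words in the two letters `X = true` and `X^* = false`, i.e. the elements of `ℕ * ℕ`. -/
abbrev Word := List Bool
/-- The points on the boundary of the rectangle, numbered from left to right starting from `0`:
`Sum.inl i` is the upper point number `i` and `Sum.inr j` is the lower point number `j`. -/
abbrev Pt := ℕ ⊕ ℕ

/-- The position of a boundary point, walking along the boundary counterclockwise from the upper
right corner: the upper points from right to left, then the lower points from left to right. -/
def pos : Pt → ℤ
  | .inl i => -1 - (i : ℤ)
  | .inr j => (j : ℤ)

/-- An upper point is the start of its string iff its letter is `X`, a lower point is the start of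
its string iff its letter is `X^*`. -/
def flow (u v : Word) : Pt → Option Bool
  | .inl i => u[i]?
  | .inr j => v[j]?.map not

/-- An oriented Kauffman diagram of type `(u, v)` up to isotopy: a non-crossing pairing of the
`u.length` upper points and the `v.length` lower points, in which every string starts and ends as
the letters of `u` and `v` prescribe. -/
@[ext]
structure Diagram (u v : Word) where
  partner : Pt → Pt
  isPlanarPairing : IsPlanarPairing pos (flow u v) partner

theorem pos_injective : Function.Injective pos := by
  rintro (i | i) (j | j) h <;> simp [pos] at h ⊢ <;> omega

namespace Diagram

/-- When a diagram is put on top of another one, this is the lower point number `i` of the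
upper diagram. -/
def upperMid (i : ℕ) : Pt ⊕ Pt := .inl (.inr i)
/-- When a diagram is put on top of another one, this is the upper point number `i` of the
lower diagram. -/
def lowerMid (i : ℕ) : Pt ⊕ Pt := .inr (.inl i)
/-- When a diagram is put on top of another one, the boundary points of the outcome are the upper
points of the upper diagram and the lower points of the lower diagram. -/
def outer : Pt → Pt ⊕ Pt := Sum.map Sum.inl Sum.inr

/-- The strings of `D` and `E`, where `D` lies above `E`, before the gluing. -/
def stack {u v w : Word} (D : Diagram u v) (E : Diagram v w) : Pt ⊕ Pt → Pt ⊕ Pt :=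
  Sum.map D.partner E.partner

theorem stack_pairing {u v w : Word} (D : Diagram u v) (E : Diagram v w) :
    IsPlanarPairing (sumKey pos pos) (Sum.elim (flow u v) (flow v w)) (D.stack E) :=
  D.isPlanarPairing.sum E.isPlanarPairing

theorem stack_gluable (u v w : Word) :
    Gluable (sumKey pos pos) (Sum.elim (flow u v) (flow v w)) upperMid lowerMid v.length := by
  refine ⟨?_, ?_, ?_, ?_, ?_⟩
  · intro i hi; simp [upperMid, flow, hi]
  · intro i hi; simp [upperMid, lowerMid, flow, hi]
  · intro i hi; simp [sumKey, upperMid, lowerMid]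
  · rintro i hi ((x | x) | (x | x)) h1 h2
    · simp [sumKey, upperMid, lowerMid, pos] at h1; omega
    · by_cases hx : x < v.length
      · right; refine ⟨x, hx, ?_, Or.inl rfl⟩
        simpa [sumKey, upperMid, lowerMid, pos] using h1
      · left; simp [flow]; omega
    · by_cases hx : x < v.length
      · right; refine ⟨x, hx, ?_, Or.inr rfl⟩
        simpa [sumKey, upperMid, lowerMid, pos] using h2
      · left; simp [flow]; omega
    · simp [sumKey, upperMid, lowerMid, pos] at h2; omega
  · intro i hi j hj hij; simp [upperMid, lowerMid, hij]

/-- The strings of `D` and `E`, where `D` lies above `E`, after the gluing. -/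
def glued {u v w : Word} (D : Diagram u v) (E : Diagram v w) : Pt ⊕ Pt → Pt ⊕ Pt :=
  glueAll upperMid lowerMid v.length (D.stack E)

theorem flow_outer (u v w : Word) (x : Pt) :
    eraseAll upperMid lowerMid v.length (Sum.elim (flow u v) (flow v w)) (outer x) = flow u w x := by
  rw [eraseAll_apply]
  · rcases x with x | x <;> simp [outer, flow]
  · rcases x with x | x <;> simp [outer, upperMid, lowerMid]

theorem glued_pairing {u v w : Word} (D : Diagram u v) (E : Diagram v w) :
    IsPlanarPairing (sumKey pos pos)
      (eraseAll upperMid lowerMid v.length (Sum.elim (flow u v) (flow v w))) (D.glued E) :=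
  (D.stack_pairing E).glueAll (sumKey_injective pos_injective pos_injective) (stack_gluable u v w)

theorem glued_outer {u v w : Word} (D : Diagram u v) (E : Diagram v w) (x : Pt) :
    D.glued E (outer x) = outer (Sum.elim id id (D.glued E (outer x))) := by
  have h := D.glued_pairing E
  by_cases hx : flow u w x = none
  · rw [h.fixed _ (by rw [flow_outer, hx])]
    rcases x with x | x <;> rfl
  · have h1 := h.orient (outer x)
    rw [flow_outer] at h1
    generalize D.glued E (outer x) = y at h1
    have h2 : ∀ i, y ≠ upperMid i ∧ y ≠ lowerMid i := by
      intro i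
      constructor <;> rintro rfl <;> rw [eraseAll_none] at h1
      · simp at h1; exact hx h1
      · by_cases hi : i < v.length
        · right; exact ⟨i, hi, Or.inl rfl⟩
        · left; simp [upperMid, flow]; omega
      · simp at h1; exact hx h1
      · by_cases hi : i < v.length
        · right; exact ⟨i, hi, Or.inr rfl⟩
        · left; simp [lowerMid, flow]; omega
    rcases y with (y | y) | (y | y)
    · rfl
    · exact absurd rfl (h2 y).1
    · exact absurd rfl (h2 y).2
    · rfl

theorem outer_injective : Function.Injective outer :=
  Sum.map_injective.2 ⟨Sum.inl_injective, Sum.inr_injective⟩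

/-- The concatenation of `D` (above) and `E` (below), with the loops removed. By `glued_outer`
the partners of the points `outer x` are again points of this form, and `Sum.elim id id` is just the
inverse of `outer` on them. -/
def comp {u v w : Word} (D : Diagram u v) (E : Diagram v w) : Diagram u w where
  partner x := Sum.elim id id (D.glued E (outer x))
  isPlanarPairing := by
    refine (D.glued_pairing E).pullback (e := outer) ?_ outer_injective (D.glued_outer E)
      (flow_outer u v w)
    rintro (x | x) (y | y) <;> simp [outer, sumKey, pos] <;> omega

/-- The value of a loop whose leftmost crossing with the gluing line has the given letter.
There the loop runs downwards iff the letter is `X`. Since the disc bounded by the loop lies to the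
right of this crossing, the loop is anticlockwise (value `dL`) iff the letter is `X`, and clockwise
(value `dR`) otherwise. -/
def loopValue (dL dR : ℂ) : Option Bool → ℂ
  | some true => dL
  | _ => dR

/-- The product of the values of all loops in the concatenation of `D` (above) and `E` (below).
As the points are glued from right to left, each loop is closed at its leftmost crossing with the
gluing line. -/
def weight (dL dR : ℂ) {u v w : Word} (D : Diagram u v) (E : Diagram v w) : ℂ :=
  loopWeight upperMid lowerMid (fun i => loopValue dL dR v[i]?) v.length (D.stack E)

theorem comp_assoc_aux (dL dR : ℂ) {u v w t : Word} (D : Diagram u v) (E : Diagram v w)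
    (F : Diagram w t) : (D.comp E).comp F = D.comp (E.comp F) ∧
    D.weight dL dR E * (D.comp E).weight dL dR F =
      E.weight dL dR F * D.weight dL dR (E.comp F) := by
  set P : ℕ → (Pt ⊕ Pt) ⊕ Pt := fun i => .inl (upperMid i) with hP
  set Q : ℕ → (Pt ⊕ Pt) ⊕ Pt := fun i => .inl (lowerMid i) with hQ
  set R : ℕ → (Pt ⊕ Pt) ⊕ Pt := fun i => .inl (.inr (.inr i)) with hR
  set S : ℕ → (Pt ⊕ Pt) ⊕ Pt := fun i => .inr (.inl i) with hS
  set T : (Pt ⊕ Pt) ⊕ Pt → (Pt ⊕ Pt) ⊕ Pt := Sum.map (D.stack E) F.partner with hT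
  set c : ℕ → ℂ := fun i => loopValue dL dR v[i]? with hc
  set c' : ℕ → ℂ := fun i => loopValue dL dR w[i]? with hc'
  have pT : IsPlanarPairing (sumKey (sumKey pos pos) pos)
    (Sum.elim (Sum.elim (flow u v) (flow v w)) (flow w t)) T :=
    (D.stack_pairing E).sum F.isPlanarPairing
  have g1 : Gluable (sumKey (sumKey pos pos) pos)
      (Sum.elim (Sum.elim (flow u v) (flow v w)) (flow w t)) P Q v.length := by
    have g := stack_gluable u v w
    refine ⟨g.act, g.opp, ?_, ?_, ?_⟩
    · intro i hi; have := g.lt i hi; simpa [sumKey, hP, hQ] using this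
    · rintro i hi (x | x) h1 h2
      · simp only [sumKey, hP, hQ, Sum.map_inl, Sum.Lex.inl_lt_inl_iff] at h1 h2
        rcases g.adj i hi x h1 h2 with h | ⟨j, h3, h4, h5⟩
        · left; exact h
        · right; exact ⟨j, h3, h4, by simpa [hP, hQ] using h5⟩
      · simp [sumKey, hP, hQ] at h2
    · intro i hi j hj hij; simpa [hP, hQ] using g.inj i hi j hj hij
  have g2 : Gluable (sumKey (sumKey pos pos) pos)
      (Sum.elim (Sum.elim (flow u v) (flow v w)) (flow w t)) R S w.length := by
    refine ⟨?_, ?_, ?_, ?_, ?_⟩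
    · intro i hi; simp [hR, flow, hi]
    · intro i hi; simp [hR, hS, flow, hi]
    · intro i hi; simp [hR, hS, sumKey]
    · rintro i hi (((x | x) | (x | x)) | (x | x)) h1 h2
      · simp [sumKey, hR, hS, pos] at h1
      · simp [sumKey, hR, hS, pos] at h1
      · simp [sumKey, hR, hS, pos] at h1; omega
      · by_cases hx : x < w.length
        · right; refine ⟨x, hx, ?_, Or.inl rfl⟩
          simpa [sumKey, hR, pos] using h1
        · left; simp [flow]; omega
      · by_cases hx : x < w.length
        · right; refine ⟨x, hx, ?_, Or.inr rfl⟩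
          simpa [sumKey, hS, pos] using h2
        · left; simp [flow]; omega
      · simp [sumKey, hR, hS, pos] at h2; omega
    · intro i hi j hj hij; simp [hR, hS, hij]
  obtain ⟨k1, k2⟩ := glueAll_comm (sumKey_injective (sumKey_injective pos_injective pos_injective)
    pos_injective) pT g1 g2
    (by intro i _ j _; simp [sumKey, hQ, hR, lowerMid, pos]; omega)
    (fun o => loopValue dL dR (o.map not)) c c'
    (by intro i _; simp [hc, hP, upperMid, flow, Function.comp_def])
    (by intro i _; simp [hc', hR, flow, Function.comp_def])
  -- first bracketing
  obtain ⟨a1, a2⟩ := glueAll_inl (B := Pt) upperMid lowerMid c v.length (D.stack E) F.partner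
  have a3 := glueAll_nat (e := Sum.map outer id) (S := Set.univ) (σ := (D.comp E).stack F)
    (τ := glueAll P Q v.length T) (P := upperMid) (Q := lowerMid) (P' := R) (Q' := S)
    (n := w.length) c' (by simp)
    ((Sum.map_injective.2 ⟨outer_injective, Function.injective_id⟩).injOn)
    (by
      rintro x -
      rw [hT, hP, hQ, a1]
      rcases x with x | x
      · exact congrArg Sum.inl (D.glued_outer E x)
      · rfl)
    (fun i _ => ⟨trivial, rfl⟩) (fun i _ => ⟨trivial, rfl⟩)
  -- second bracketing
  have b1 := glueAll_nat (e := Sum.map Sum.inr id) (S := Set.univ) (σ := E.stack F)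
    (τ := T) (P := upperMid) (Q := lowerMid) (P' := R) (Q' := S)
    (n := w.length) c' (by simp)
    ((Sum.map_injective.2 ⟨Sum.inr_injective, Function.injective_id⟩).injOn)
    (by
      rintro (x | x) - <;> rfl)
    (fun i _ => ⟨trivial, rfl⟩) (fun i _ => ⟨trivial, rfl⟩)
  have b2 := glueAll_away (S := Set.range (fun x : Pt => (.inl (.inl x) : (Pt ⊕ Pt) ⊕ Pt)))
    (σ := T) (P := R) (Q := S) (n := w.length)
    (by rintro _ ⟨y, rfl⟩; exact ⟨D.partner y, rfl⟩) (by simp [hR, hS])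
  have b3 := glueAll_nat
    (e := fun x : Pt ⊕ Pt => (Equiv.sumAssoc Pt Pt Pt).symm (Sum.map id outer x)) (S := Set.univ)
    (σ := D.stack (E.comp F))
    (τ := glueAll R S w.length T) (P := upperMid) (Q := lowerMid) (P' := P) (Q' := Q)
    (n := v.length) c (by simp)
    (((Equiv.injective _).comp
      (Sum.map_injective.2 ⟨Function.injective_id, outer_injective⟩)).injOn)
    (by
      rintro (x | x) -
      · exact b2 _ ⟨x, rfl⟩
      · have e1 : ∀ y : Pt ⊕ Pt, (Equiv.sumAssoc Pt Pt Pt).symm (.inr y) = Sum.map Sum.inr id y := by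
          rintro (y | y) <;> rfl
        have := b1.1 (outer x) trivial
        simp only [Sum.map_inr, stack, e1]
        rw [this]
        exact congrArg (Sum.map Sum.inr id) (E.glued_outer F x))
    (fun i _ => ⟨trivial, rfl⟩) (fun i _ => ⟨trivial, rfl⟩)
  constructor
  · ext x : 2
    apply outer_injective
    apply (Sum.map_injective.2 ⟨outer_injective, Function.injective_id⟩ :
      Function.Injective (Sum.map outer id : Pt ⊕ Pt → (Pt ⊕ Pt) ⊕ Pt))
    have l := a3.1 (outer x) trivial
    have r := b3.1 (outer x) trivial
    have l' := (D.comp E).glued_outer F x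
    have r' := D.glued_outer (E.comp F) x
    have e0 : ∀ y : Pt, (Equiv.sumAssoc Pt Pt Pt).symm (Sum.map id outer (outer y)) =
      Sum.map outer id (outer y) := by rintro (y | y) <;> rfl
    calc Sum.map outer id (outer (((D.comp E).comp F).partner x))
        = Sum.map outer id ((D.comp E).glued F (outer x)) := by rw [l']; rfl
      _ = glueAll R S w.length (glueAll P Q v.length T) (Sum.map outer id (outer x)) := l.symm
      _ = glueAll P Q v.length (glueAll R S w.length T) (Sum.map outer id (outer x)) := by rw [k1]
      _ = (Equiv.sumAssoc Pt Pt Pt).symm (Sum.map id outer (D.glued (E.comp F) (outer x))) := by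
          rw [← e0]; exact r
      _ = Sum.map outer id (outer ((D.comp (E.comp F)).partner x)) := by rw [r', e0]; rfl
  · have w1 : D.weight dL dR E = loopWeight P Q c v.length T := a2.symm
    have w2 : (D.comp E).weight dL dR F = loopWeight R S c' w.length (glueAll P Q v.length T) :=
      a3.2.2.symm
    have w3 : E.weight dL dR F = loopWeight R S c' w.length T := b1.2.2.symm
    have w4 : D.weight dL dR (E.comp F) = loopWeight P Q c v.length (glueAll R S w.length T) :=
      b3.2.2.symm
    rw [w1, w2, w3, w4, k2]


/-- The pairing given by `n` vertical strings. -/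
def idPartner (n : ℕ) : Pt → Pt
  | .inl i => if i < n then .inr i else .inl i
  | .inr i => if i < n then .inl i else .inr i

/-- The identity diagram: vertical strings. -/
protected def id (u : Word) : Diagram u u where
  partner := idPartner u.length
  isPlanarPairing := by
    refine ⟨?_, ?_, ?_, ?_⟩
    · rintro (i | i) <;> by_cases h : i < u.length <;> simp [idPartner, h]
    · rintro (i | i) h <;> simp [flow] at h <;> simp [idPartner, h]
    · rintro (i | i) <;> by_cases h : i < u.length <;> simp [idPartner, h, flow]
    · rintro (i | i) (j | j) <;> by_cases h : i < u.length <;> by_cases h' : j < u.length <;>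
        simp [idPartner, h, h', pos] <;> omega

theorem partner_cases {u v : Word} (D : Diagram u v) (x : Pt) (hx : flow u v x ≠ none) :
    (∃ i < u.length, D.partner x = .inl i) ∨ (∃ j < v.length, D.partner x = .inr j) := by
  have h := D.isPlanarPairing.orient x
  have h' : flow u v (D.partner x) ≠ none := by rw [h]; simpa using hx
  rcases hy : D.partner x with i | j
  · left; rw [hy] at h'; exact ⟨i, by simpa [flow] using h', rfl⟩
  · right; rw [hy] at h'; exact ⟨j, by simpa [flow] using h', rfl⟩

/-- Auxiliary, for the left unit law. -/
def lphi (n k : ℕ) : Pt → Pt ⊕ Pt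
  | .inl i => if i < k then .inr (.inl i) else if i < n then .inl (.inl i) else .inr (.inl i)
  | .inr j => .inr (.inr j)

/-- Auxiliary, for the left unit law: the pairing after the points `i ≥ k` have been glued. -/
def lstate (n k : ℕ) (f : Pt → Pt) : Pt ⊕ Pt → Pt ⊕ Pt
  | .inl (.inl i) => if i < k then .inl (.inr i) else if i < n then lphi n k (f (.inl i))
      else .inl (.inl i)
  | .inl (.inr i) => if i < k then .inl (.inl i) else .inl (.inr i)
  | .inr (.inl i) => if i < k then lphi n k (f (.inl i)) else if i < n then .inr (.inl i)
      else lphi n k (f (.inl i))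
  | .inr (.inr j) => lphi n k (f (.inr j))

theorem lstate_step {n k : ℕ} (hk : k < n) {f : Pt → Pt} (hf : ∀ x, f (f x) = x)
    (hfix : ∀ i, n ≤ i → f (.inl i) = .inl i) (hne : ∀ i < n, f (.inl i) ≠ .inl i) :
    glue (upperMid k) (lowerMid k) (lstate n (k + 1) f) = lstate n k f := by
  have inj : ∀ x y, f x = y → f y = x := by rintro x y rfl; exact hf x
  have e0 := hf (.inl k)
  have e1 := hne k hk
  funext x
  unfold glue
  rcases x with (i | i) | (i | i)
  · have := hf (.inl i)
    have := hfix i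
    rcases h : f (.inl i) with a | a <;> rcases h' : f (.inl k) with b | b <;> rw [h'] at e1 <;>
    (simp only [lstate, upperMid, lowerMid, lphi, h, h']; grind [lstate, lphi])
  · simp only [lstate, upperMid, lowerMid]; grind
  · have := hf (.inl i)
    have := hfix i
    rcases h : f (.inl i) with a | a <;> rcases h' : f (.inl k) with b | b <;> rw [h'] at e1 <;>
    (simp only [lstate, upperMid, lowerMid, lphi, h, h']; grind [lstate, lphi])
  · have := hf (.inr i)
    rcases h : f (.inr i) with a | a <;> rcases h' : f (.inl k) with b | b <;> rw [h'] at e1 <;>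
    (simp only [lstate, upperMid, lowerMid, lphi, h, h']; grind [lstate, lphi])

theorem lstate_all {n k : ℕ} (hk : k ≤ n) {f : Pt → Pt} (hf : ∀ x, f (f x) = x)
    (hfix : ∀ i, n ≤ i → f (.inl i) = .inl i) (hne : ∀ i < n, f (.inl i) ≠ .inl i) (c : ℕ → ℂ) :
    glueAll upperMid lowerMid k (lstate n k f) = lstate n 0 f ∧
    loopWeight upperMid lowerMid c k (lstate n k f) = 1 := by
  induction k with
  | zero => exact ⟨rfl, rfl⟩
  | succ k ih =>
    obtain ⟨h1, h2⟩ := ih (by omega)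
    rw [glueAll, loopWeight, lstate_step (by omega) hf hfix hne, h2]
    refine ⟨h1, ?_⟩
    simp [lstate, upperMid, lowerMid]

/-- Auxiliary, for the right unit law. -/
def rphi (n k : ℕ) : Pt → Pt ⊕ Pt
  | .inr i => if i < k then .inl (.inr i) else if i < n then .inr (.inr i) else .inl (.inr i)
  | .inl j => .inl (.inl j)

/-- Auxiliary, for the right unit law: the pairing after the points `i ≥ k` have been glued. -/
def rstate (n k : ℕ) (f : Pt → Pt) : Pt ⊕ Pt → Pt ⊕ Pt
  | .inr (.inr i) => if i < k then .inr (.inl i) else if i < n then rphi n k (f (.inr i))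
      else .inr (.inr i)
  | .inr (.inl i) => if i < k then .inr (.inr i) else .inr (.inl i)
  | .inl (.inr i) => if i < k then rphi n k (f (.inr i)) else if i < n then .inl (.inr i)
      else rphi n k (f (.inr i))
  | .inl (.inl j) => rphi n k (f (.inl j))

theorem rstate_step {n k : ℕ} (hk : k < n) {f : Pt → Pt} (hf : ∀ x, f (f x) = x)
    (hfix : ∀ i, n ≤ i → f (.inr i) = .inr i) (hne : ∀ i < n, f (.inr i) ≠ .inr i) :
    glue (upperMid k) (lowerMid k) (rstate n (k + 1) f) = rstate n k f := by
  have inj : ∀ x y, f x = y → f y = x := by rintro x y rfl; exact hf x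
  have e0 := hf (.inr k)
  have e1 := hne k hk
  funext x
  unfold glue
  rcases x with (i | i) | (i | i)
  · have := hf (.inl i)
    rcases h : f (.inl i) with a | a <;> rcases h' : f (.inr k) with b | b <;> rw [h'] at e1 <;>
    (simp only [rstate, upperMid, lowerMid, rphi, h, h']; grind [rstate, rphi])
  · have := hf (.inr i)
    have := hfix i
    rcases h : f (.inr i) with a | a <;> rcases h' : f (.inr k) with b | b <;> rw [h'] at e1 <;>
    (simp only [rstate, upperMid, lowerMid, rphi, h, h']; grind [rstate, rphi])
  · simp only [rstate, upperMid, lowerMid]; grind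
  · have := hf (.inr i)
    have := hfix i
    rcases h : f (.inr i) with a | a <;> rcases h' : f (.inr k) with b | b <;> rw [h'] at e1 <;>
    (simp only [rstate, upperMid, lowerMid, rphi, h, h']; grind [rstate, rphi])

theorem rstate_all {n k : ℕ} (hk : k ≤ n) {f : Pt → Pt} (hf : ∀ x, f (f x) = x)
    (hfix : ∀ i, n ≤ i → f (.inr i) = .inr i) (hne : ∀ i < n, f (.inr i) ≠ .inr i) (c : ℕ → ℂ) :
    glueAll upperMid lowerMid k (rstate n k f) = rstate n 0 f ∧
    loopWeight upperMid lowerMid c k (rstate n k f) = 1 := by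
  induction k with
  | zero => exact ⟨rfl, rfl⟩
  | succ k ih =>
    obtain ⟨h1, h2⟩ := ih (by omega)
    rw [glueAll, loopWeight, rstate_step (by omega) hf hfix hne, h2]
    refine ⟨h1, ?_⟩
    have : ∀ y, rphi n (k + 1) y ≠ lowerMid k := by
      rintro (y | y) <;> simp only [rphi, lowerMid] <;> (try split_ifs) <;> simp
    simp [rstate, upperMid, this]

theorem id_comp_aux (dL dR : ℂ) {u v : Word} (D : Diagram u v) :
    (Diagram.id u).comp D = D ∧ (Diagram.id u).weight dL dR D = 1 := by
  have hfix : ∀ i, u.length ≤ i → D.partner (.inl i) = .inl i := by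
    intro i hi; exact D.isPlanarPairing.fixed _ (by simp [flow, hi])
  have e : (Diagram.id u).stack D = lstate u.length u.length D.partner := by
    have e' : ∀ y, lphi u.length u.length y = Sum.inr y := by
      rintro (i | i) <;> simp [lphi]
    funext x
    rcases x with (i | i) | (i | i)
    · by_cases hi : i < u.length <;> simp [stack, Diagram.id, idPartner, lstate, hi]
    · by_cases hi : i < u.length <;> simp [stack, Diagram.id, idPartner, lstate, hi]
    · simp [stack, lstate, e']; intro h h'; omega
    · simp [stack, lstate, e']
  have h := lstate_all le_rfl D.isPlanarPairing.invol hfix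
    (fun i hi => D.isPlanarPairing.ne (by simp [flow, hi])) (fun i => loopValue dL dR u[i]?)
  rw [← e] at h
  refine ⟨?_, h.2⟩
  ext x : 2
  change Sum.elim id id (glueAll upperMid lowerMid u.length ((Diagram.id u).stack D) (outer x)) = _
  rw [h.1]
  rcases x with i | i
  · by_cases hi : i < u.length
    · rcases D.partner_cases (.inl i) (by simp [flow, hi]) with ⟨j, hj, e⟩ | ⟨j, hj, e⟩ <;>
        simp [outer, lstate, hi, e, lphi, hj]
    · simp [outer, lstate, hi, hfix i (by omega)]
  · have : ∀ y, Sum.elim id id (lphi u.length 0 y) = y := by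
      rintro (y | y) <;> simp only [lphi] <;> (try split_ifs) <;> rfl
    simp [outer, lstate, this]

theorem comp_id_aux (dL dR : ℂ) {u v : Word} (D : Diagram u v) :
    D.comp (Diagram.id v) = D ∧ D.weight dL dR (Diagram.id v) = 1 := by
  have hfix : ∀ i, v.length ≤ i → D.partner (.inr i) = .inr i := by
    intro i hi; exact D.isPlanarPairing.fixed _ (by simp [flow, hi])
  have e : D.stack (Diagram.id v) = rstate v.length v.length D.partner := by
    have e' : ∀ y, rphi v.length v.length y = Sum.inl y := by
      rintro (i | i) <;> simp [rphi]
    funext x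
    rcases x with (i | i) | (i | i)
    · simp [stack, rstate, e']
    · simp [stack, rstate, e']; intro h h'; omega
    · by_cases hi : i < v.length <;> simp [stack, Diagram.id, idPartner, rstate, hi]
    · by_cases hi : i < v.length <;> simp [stack, Diagram.id, idPartner, rstate, hi]
  have h := rstate_all le_rfl D.isPlanarPairing.invol hfix
    (fun i hi => D.isPlanarPairing.ne (by simp [flow, hi])) (fun i => loopValue dL dR v[i]?)
  rw [← e] at h
  refine ⟨?_, h.2⟩
  ext x : 2
  change Sum.elim id id (glueAll upperMid lowerMid v.length (D.stack (Diagram.id v)) (outer x)) = _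
  rw [h.1]
  have key : ∀ y, Sum.elim id id (rphi v.length 0 y) = y := by
      rintro (y | y) <;> simp only [rphi] <;> (try split_ifs) <;> rfl
  rcases x with i | i
  · simp [outer, rstate, key]
  · by_cases hi : i < v.length
    · simp [outer, rstate, hi, key]
    · simp [outer, rstate, hi, hfix i (by omega)]


/-- Move a point to the right of `m` upper points and `n` lower points. -/
def shift (m n : ℕ) : Pt → Pt := Sum.map (m + ·) (n + ·)

/-- The pairing `g` to the right of the pairing `f`, where `f` has `m` upper points and
`n` lower points. -/
def tensorPartner (m n : ℕ) (f g : Pt → Pt) : Pt → Pt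
  | .inl i => if i < m then f (.inl i) else shift m n (g (.inl (i - m)))
  | .inr j => if j < n then f (.inr j) else shift m n (g (.inr (j - n)))

/-- The first `m` upper points and the first `n` lower points. -/
def leftPart (m n : ℕ) : Set Pt := {x | Sum.elim (· < m) (· < n) x}

theorem mem_leftPart_or (m n : ℕ) (x : Pt) : x ∈ leftPart m n ∨ ∃ y, x = shift m n y := by
  rcases x with i | j
  · by_cases h : i < m
    · left; exact h
    · right; exact ⟨.inl (i - m), by simp [shift]; omega⟩
  · by_cases h : j < n
    · left; exact h
    · right; exact ⟨.inr (j - n), by simp [shift]; omega⟩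

theorem tensorPartner_left {m n : ℕ} {f g : Pt → Pt} {x : Pt} (hx : x ∈ leftPart m n) :
    tensorPartner m n f g x = f x := by
  rcases x with i | j <;> exact if_pos hx

theorem tensorPartner_shift {m n : ℕ} {f g : Pt → Pt} (y : Pt) :
    tensorPartner m n f g (shift m n y) = shift m n (g y) := by
  rcases y with i | j <;> simp [tensorPartner, shift]

theorem shift_injective (m n : ℕ) : Function.Injective (shift m n) :=
  Sum.map_injective.2 ⟨add_right_injective m, add_right_injective n⟩

theorem partner_left {u v : Word} (D : Diagram u v) {x : Pt} 
    (hx : x ∈ leftPart u.length v.length) : D.partner x ∈ leftPart u.length v.length := by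
  have : flow u v x ≠ none := by
    rcases x with i | j
    · have : i < u.length := hx
      simp [flow, this]
    · have : j < v.length := hx
      simp [flow, this]
  rcases D.partner_cases x this with ⟨j, hj, e⟩ | ⟨j, hj, e⟩ <;> rw [e] <;> exact hj

theorem pos_left {m n : ℕ} {x : Pt} (hx : x ∈ leftPart m n) : -(m : ℤ) ≤ pos x ∧ pos x < n := by
  rcases x with i | j
  · have : i < m := hx
    simp [pos]; omega
  · have : j < n := hx
    simp [pos]; omega

theorem pos_shift (m n : ℕ) (y : Pt) : pos (shift m n y) < -m ∨ n ≤ pos (shift m n y) := by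
  rcases y with i | j <;> simp [shift, pos] <;> omega

theorem pos_shift_lt (m n : ℕ) (x y : Pt) : pos (shift m n x) < pos (shift m n y) ↔ pos x < pos y := by
  rcases x with i | i <;> rcases y with j | j <;> simp [shift, pos] <;> omega

theorem flow_left {u v u' v' : Word} {x : Pt} (hx : x ∈ leftPart u.length v.length) :
    flow (u ++ u') (v ++ v') x = flow u v x := by
  rcases x with i | j
  · exact List.getElem?_append_left hx
  · exact congrArg (Option.map not) (List.getElem?_append_left hx)

theorem flow_shift {u v u' v' : Word} (y : Pt) :
    flow (u ++ u') (v ++ v') (shift u.length v.length y) = flow u' v' y := by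
  rcases y with i | j <;> simp [flow, shift, List.getElem?_append_right]

/-- The horizontal juxtaposition of `D` (left) and `E` (right). -/
def tensor {u v u' v' : Word} (D : Diagram u v) (E : Diagram u' v') :
    Diagram (u ++ u') (v ++ v') where
  partner := tensorPartner u.length v.length D.partner E.partner
  isPlanarPairing := by
    refine ⟨?_, ?_, ?_, ?_⟩
    · intro x
      rcases mem_leftPart_or u.length v.length x with hx | ⟨y, rfl⟩
      · rw [tensorPartner_left hx, tensorPartner_left (D.partner_left hx), D.isPlanarPairing.invol]
      · rw [tensorPartner_shift, tensorPartner_shift, E.isPlanarPairing.invol]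
    · intro x h
      rcases mem_leftPart_or u.length v.length x with hx | ⟨y, rfl⟩
      · rw [flow_left hx] at h
        rw [tensorPartner_left hx, D.isPlanarPairing.fixed x h]
      · rw [flow_shift] at h
        rw [tensorPartner_shift, E.isPlanarPairing.fixed y h]
    · intro x
      rcases mem_leftPart_or u.length v.length x with hx | ⟨y, rfl⟩
      · rw [tensorPartner_left hx, flow_left hx, flow_left (D.partner_left hx),
          D.isPlanarPairing.orient]
      · rw [tensorPartner_shift, flow_shift, flow_shift, E.isPlanarPairing.orient]
    · intro x y
      rcases mem_leftPart_or u.length v.length x with hx | ⟨x, rfl⟩ <;>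
      rcases mem_leftPart_or u.length v.length y with hy | ⟨y, rfl⟩
      · rw [tensorPartner_left hx, tensorPartner_left hy]
        exact D.isPlanarPairing.planar x y
      · rw [tensorPartner_left hx]
        intro h1 h2
        have := pos_left hx
        have := pos_left (D.partner_left hx)
        have := pos_shift u.length v.length y
        omega
      · rw [tensorPartner_shift, tensorPartner_left hy]
        intro h1 h2 h3
        have := pos_left hy
        have := pos_left (D.partner_left hy)
        have := pos_shift u.length v.length (E.partner x)
        omega
      · rw [tensorPartner_shift, tensorPartner_shift, pos_shift_lt, pos_shift_lt, pos_shift_lt]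
        exact E.isPlanarPairing.planar x y

theorem tensor_id (u v : Word) : (Diagram.id u).tensor (Diagram.id v) = Diagram.id (u ++ v) := by
  ext x : 2
  change tensorPartner u.length u.length (idPartner u.length) (idPartner v.length) x =
    idPartner (u ++ v).length x
  rcases x with i | i <;> by_cases h : i < u.length <;> by_cases h' : i - u.length < v.length <;>
    simp only [tensorPartner, idPartner, shift, h, h', if_true, if_false, List.length_append] <;>
    (try simp) <;> grind

theorem tensor_comp_aux (dL dR : ℂ) {u v w u' v' w' : Word} (D : Diagram u v) (E : Diagram v w)
    (D' : Diagram u' v') (E' : Diagram v' w') :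
    (D.tensor D').comp (E.tensor E') = (D.comp E).tensor (D'.comp E') ∧
    (D.tensor D').weight dL dR (E.tensor E') = D.weight dL dR E * D'.weight dL dR E' := by
  set m := u.length
  set n := v.length with hn
  set k := w.length
  set T := (D.tensor D').stack (E.tensor E') with hT
  set c : ℕ → ℂ := fun i => loopValue dL dR (v ++ v')[i]? with hc
  have hlen : (v ++ v').length = n + v'.length := List.length_append
  obtain ⟨s1, s2⟩ := glueAll_add upperMid lowerMid c n v'.length T
  set T1 := glueAll (fun i => upperMid (n + i)) (fun i => lowerMid (n + i)) v'.length T with hT1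
  have TL1 : ∀ x ∈ leftPart m n, T (.inl x) = .inl (D.partner x) := fun x hx =>
    congrArg Sum.inl (tensorPartner_left hx)
  have TL2 : ∀ x ∈ leftPart n k, T (.inr x) = .inr (E.partner x) := fun x hx =>
    congrArg Sum.inr (tensorPartner_left hx)
  have TR1 : ∀ x, T (.inl (shift m n x)) = .inl (shift m n (D'.partner x)) := fun x =>
    congrArg Sum.inl (tensorPartner_shift x)
  have TR2 : ∀ x, T (.inr (shift n k x)) = .inr (shift n k (E'.partner x)) := fun x =>
    congrArg Sum.inr (tensorPartner_shift x)
  -- the left block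
  set SL : Set (Pt ⊕ Pt) := {x | Sum.elim (· ∈ leftPart m n) (· ∈ leftPart n k) x} with hSL
  have TSL : ∀ x ∈ SL, T x = D.stack E x := by
    rintro (x | x) hx
    · exact TL1 x hx
    · exact TL2 x hx
  have cSL : ∀ x ∈ SL, D.stack E x ∈ SL := by
    rintro (x | x) hx
    · exact D.partner_left hx
    · exact E.partner_left hx
  have awayL := glueAll_away (S := SL) (σ := T) (P := fun i => upperMid (n + i))
    (Q := fun i => lowerMid (n + i)) (n := v'.length)
    (fun x hx => by rw [TSL x hx]; exact cSL x hx)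
    (by intro i _; simp [hSL, upperMid, lowerMid, leftPart])
  have natL := glueAll_nat (e := id) (S := SL) (σ := D.stack E) (τ := T1)
    (P := upperMid) (Q := lowerMid) (P' := upperMid) (Q' := lowerMid) (n := n) c
    cSL Function.injective_id.injOn (fun x hx => by rw [id, hT1, awayL x hx, TSL x hx]; rfl)
    (fun i hi => ⟨hi, rfl⟩) (fun i hi => ⟨hi, rfl⟩)
  -- the right block
  have eInj : Function.Injective (Sum.map (shift m n) (shift n k)) :=
    Sum.map_injective.2 ⟨shift_injective m n, shift_injective n k⟩
  have natR := glueAll_nat (e := Sum.map (shift m n) (shift n k)) (S := Set.univ)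
    (σ := D'.stack E') (τ := T)
    (P := upperMid) (Q := lowerMid) (P' := fun i => upperMid (n + i))
    (Q' := fun i => lowerMid (n + i)) (n := v'.length) (fun i => c (n + i))
    (by simp) eInj.injOn
    (by
      rintro (x | x) -
      · exact TR1 x
      · exact TR2 x)
    (fun i _ => ⟨trivial, rfl⟩) (fun i _ => ⟨trivial, rfl⟩)
  have awayR := glueAll_away (S := Set.range (Sum.map (shift m n) (shift n k))) (σ := T1)
    (P := upperMid) (Q := lowerMid) (n := n)
    (by
      rintro _ ⟨x, rfl⟩
      exact ⟨_, (natR.1 x trivial).symm⟩)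
    (by
      intro i hi
      constructor
      · rintro ⟨(x | x) | (x | x), h⟩ <;> simp [shift, upperMid] at h; omega
      · rintro ⟨(x | x) | (x | x), h⟩ <;> simp [shift, lowerMid] at h; omega)
  constructor
  · ext x : 2
    change Sum.elim id id (glueAll upperMid lowerMid (v ++ v').length T (outer x)) =
      tensorPartner m k (D.comp E).partner (D'.comp E').partner x
    rw [hlen, s1]
    rcases mem_leftPart_or m k x with hx | ⟨y, rfl⟩
    · rw [tensorPartner_left hx]
      have hx' : outer x ∈ SL := by rcases x with x | x <;> exact hx
      have := natL.1 (outer x) hx'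
      simp only [id] at this
      rw [this]
      rfl
    · rw [tensorPartner_shift]
      have e : ∀ z, outer (shift m k z) = Sum.map (shift m n) (shift n k) (outer z) := by
        rintro (z | z) <;> rfl
      rw [e, awayR _ ⟨_, rfl⟩, hT1, natR.1 _ trivial]
      have h2 : glueAll upperMid lowerMid v'.length (D'.stack E') (outer y) =
        outer ((D'.comp E').partner y) := D'.glued_outer E' y
      rw [h2, ← e]
      generalize (D'.comp E').partner y = z
      rcases z with z | z <;> rfl
  · have w1 : (D.tensor D').weight dL dR (E.tensor E') = loopWeight upperMid lowerMid c (n + v'.length) T := by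
      rw [← hlen]; rfl
    rw [w1, s2, natL.2.2, natR.2.2, mul_comm]
    congr 1
    · have : ∀ i < n, c i = loopValue dL dR v[i]? := by
        intro i hi; simp only [hc]; rw [List.getElem?_append_left hi]
      exact loopWeight_congr this
    · have : (fun i => c (n + i)) = fun i => loopValue dL dR v'[i]? := by
        funext i; simp only [hc]; rw [List.getElem?_append_right (by omega)]; congr 2; omega
      rw [this]; rfl

/-- The basic arc with the two upper points `c` and its opposite letter, i.e. `X, X^*` or
`X^*, X`, and without lower points. -/
def cap (c : Bool) : Diagram [c, !c] [] where
  partner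
    | .inl 0 => .inl 1
    | .inl 1 => .inl 0
    | x => x
  isPlanarPairing := by
    refine ⟨?_, ?_, ?_, ?_⟩
    · rintro ((_ | _ | i) | j) <;> rfl
    · rintro ((_ | _ | i) | j) h <;> simp [flow] at h ⊢
    · rintro ((_ | _ | i) | j) <;> simp [flow]
    · rintro ((_ | _ | i) | j) ((_ | _ | i') | j') <;> simp [pos] <;> omega

/-- The basic arc with the two lower points `c` and its opposite letter, i.e. `X, X^*` or
`X^*, X`, and without upper points. -/
def cup (c : Bool) : Diagram [] [c, !c] where
  partner
    | .inr 0 => .inr 1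
    | .inr 1 => .inr 0
    | x => x
  isPlanarPairing := by
    refine ⟨?_, ?_, ?_, ?_⟩
    · rintro (i | (_ | _ | j)) <;> rfl
    · rintro (i | (_ | _ | j)) h <;> simp [flow] at h ⊢
    · rintro (i | (_ | _ | j)) <;> simp [flow]
    · rintro (i | (_ | _ | j)) (i' | (_ | _ | j')) <;> simp [pos] <;> omega

theorem heq_of_partner {u v u' v' : Word} (hu : u = u') (hv : v = v') {D : Diagram u v}
    {E : Diagram u' v'} (h : D.partner = E.partner) : HEq D E := by
  subst hu hv
  exact heq_of_eq (Diagram.ext h)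

theorem tensor_assoc_partner {u v u' v' u'' v'' : Word} (D : Diagram u v) (E : Diagram u' v')
    (F : Diagram u'' v'') :
    ((D.tensor E).tensor F).partner = (D.tensor (E.tensor F)).partner := by
  funext x
  change tensorPartner (u ++ u').length (v ++ v').length
      (tensorPartner u.length v.length D.partner E.partner) F.partner x =
    tensorPartner u.length v.length D.partner
      (tensorPartner u'.length v'.length E.partner F.partner) x
  rw [List.length_append, List.length_append]
  have e : ∀ y, shift (u.length + u'.length) (v.length + v'.length) y =
      shift u.length v.length (shift u'.length v'.length y) := by
    rintro (y | y) <;> simp [shift, Nat.add_assoc]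
  rcases mem_leftPart_or u.length v.length x with hx | ⟨y, rfl⟩
  · have hx' : x ∈ leftPart (u.length + u'.length) (v.length + v'.length) := by
      rcases x with i | i
      · exact Nat.lt_add_right _ hx
      · exact Nat.lt_add_right _ hx
    rw [tensorPartner_left hx', tensorPartner_left hx, tensorPartner_left hx]
  · rw [tensorPartner_shift]
    rcases mem_leftPart_or u'.length v'.length y with hy | ⟨z, rfl⟩
    · have hy' : shift u.length v.length y ∈
          leftPart (u.length + u'.length) (v.length + v'.length) := by
        rcases y with i | i
        · exact Nat.add_lt_add_left hy _
        · exact Nat.add_lt_add_left hy _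
      rw [tensorPartner_left hy', tensorPartner_shift, tensorPartner_left hy]
    · rw [← e, tensorPartner_shift, tensorPartner_shift, e]

theorem id_nil_tensor_partner {u v : Word} (D : Diagram u v) :
    ((Diagram.id []).tensor D).partner = D.partner := by
  have e : ∀ y, shift 0 0 y = y := by rintro (y | y) <;> simp [shift]
  funext x
  have h : ((Diagram.id []).tensor D).partner (shift 0 0 x) = shift 0 0 (D.partner x) :=
    tensorPartner_shift (m := 0) (n := 0) x
  rwa [e, e] at h

theorem tensor_id_nil_partner {u v : Word} (D : Diagram u v) :
    (D.tensor (Diagram.id [])).partner = D.partner := by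
  funext x
  change tensorPartner u.length v.length D.partner (idPartner 0) x = _
  rcases mem_leftPart_or u.length v.length x with hx | ⟨y, rfl⟩
  · rw [tensorPartner_left hx]
  · rw [tensorPartner_shift, D.isPlanarPairing.fixed]
    · rcases y with y | y <;> simp [idPartner]
    · rcases y with y | y <;> simp [shift, flow]

end Diagram

noncomputable section

open CategoryTheory MonoidalCategory

/-- Composition in `ℂ[K]`: the bilinear extension of the concatenation of diagrams, with
clockwise loops replaced by `dR` and anticlockwise loops replaced by `dL`. -/
def linComp (dL dR : ℂ) (u v w : Word) :
    (Diagram u v →₀ ℂ) →ₗ[ℂ] (Diagram v w →₀ ℂ) →ₗ[ℂ] (Diagram u w →₀ ℂ) :=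
  Finsupp.linearCombination ℂ fun D => Finsupp.linearCombination ℂ fun E =>
    Finsupp.single (D.comp E) (D.weight dL dR E)

/-- The bilinear extension of the juxtaposition of diagrams. -/
def linTensor (u v u' v' : Word) :
    (Diagram u v →₀ ℂ) →ₗ[ℂ] (Diagram u' v' →₀ ℂ) →ₗ[ℂ] (Diagram (u ++ u') (v ++ v') →₀ ℂ) :=
  Finsupp.linearCombination ℂ fun D => Finsupp.linearCombination ℂ fun E =>
    Finsupp.single (D.tensor E) 1

theorem linComp_single (dL dR : ℂ) {u v w : Word} (D : Diagram u v) (E : Diagram v w) (a b : ℂ) :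
    linComp dL dR u v w (Finsupp.single D a) (Finsupp.single E b) =
      Finsupp.single (D.comp E) (a * b * D.weight dL dR E) := by
  rw [linComp, Finsupp.linearCombination_single, LinearMap.smul_apply,
    Finsupp.linearCombination_single, Finsupp.smul_single, Finsupp.smul_single, smul_eq_mul,
    smul_eq_mul, mul_assoc]

theorem linTensor_single {u v u' v' : Word} (D : Diagram u v) (E : Diagram u' v') (a b : ℂ) :
    linTensor u v u' v' (Finsupp.single D a) (Finsupp.single E b) =
      Finsupp.single (D.tensor E) (a * b) := by
  rw [linTensor, Finsupp.linearCombination_single, LinearMap.smul_apply,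
    Finsupp.linearCombination_single, Finsupp.smul_single, Finsupp.smul_single, smul_eq_mul,
    smul_eq_mul, mul_one]

theorem add_linComp (dL dR : ℂ) {u v w : Word} (f f' : Diagram u v →₀ ℂ) (g : Diagram v w →₀ ℂ) :
    linComp dL dR u v w (f + f') g = linComp dL dR u v w f g + linComp dL dR u v w f' g := by
  rw [map_add, LinearMap.add_apply]

theorem smul_linComp (dL dR : ℂ) {u v w : Word} (r : ℂ) (f : Diagram u v →₀ ℂ)
    (g : Diagram v w →₀ ℂ) :
    linComp dL dR u v w (r • f) g = r • linComp dL dR u v w f g := by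
  rw [map_smul, LinearMap.smul_apply]

theorem linComp_add (dL dR : ℂ) {u v w : Word} (f : Diagram u v →₀ ℂ) (g g' : Diagram v w →₀ ℂ) :
    linComp dL dR u v w f (g + g') = linComp dL dR u v w f g + linComp dL dR u v w f g' :=
  map_add _ g g'

theorem linComp_smul (dL dR : ℂ) {u v w : Word} (f : Diagram u v →₀ ℂ) (r : ℂ)
    (g : Diagram v w →₀ ℂ) :
    linComp dL dR u v w f (r • g) = r • linComp dL dR u v w f g :=
  map_smul _ r g

theorem id_linComp (dL dR : ℂ) {u v : Word} (f : Diagram u v →₀ ℂ) :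
    linComp dL dR u u v (Finsupp.single (Diagram.id u) 1) f = f := by
  induction f using Finsupp.induction_linear with
  | zero => rw [map_zero]
  | add f g hf hg => rw [map_add, hf, hg]
  | single D a =>
    obtain ⟨h1, h2⟩ := Diagram.id_comp_aux dL dR D
    rw [linComp_single, h1, h2, one_mul, mul_one]

theorem linComp_id (dL dR : ℂ) {u v : Word} (f : Diagram u v →₀ ℂ) :
    linComp dL dR u v v f (Finsupp.single (Diagram.id v) 1) = f := by
  induction f using Finsupp.induction_linear with
  | zero => rw [map_zero, LinearMap.zero_apply]
  | add f g hf hg => rw [map_add, LinearMap.add_apply, hf, hg]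
  | single D a =>
    obtain ⟨h1, h2⟩ := Diagram.comp_id_aux dL dR D
    rw [linComp_single, h1, h2, mul_one, mul_one]

theorem linComp_assoc (dL dR : ℂ) {u v w t : Word} (f : Diagram u v →₀ ℂ) (g : Diagram v w →₀ ℂ)
    (h : Diagram w t →₀ ℂ) :
    linComp dL dR u w t (linComp dL dR u v w f g) h =
      linComp dL dR u v t f (linComp dL dR v w t g h) := by
  induction f using Finsupp.induction_linear with
  | zero => simp only [map_zero, LinearMap.zero_apply]
  | add f f' hf hf' => simp only [map_add, LinearMap.add_apply, hf, hf']
  | single D a =>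
  induction g using Finsupp.induction_linear with
  | zero => simp only [map_zero, LinearMap.zero_apply]
  | add f f' hf hf' => simp only [map_add, LinearMap.add_apply, hf, hf']
  | single E b =>
  induction h using Finsupp.induction_linear with
  | zero => simp only [map_zero]
  | add f f' hf hf' => simp only [map_add, hf, hf']
  | single F c =>
    obtain ⟨h1, h2⟩ := Diagram.comp_assoc_aux dL dR D E F
    rw [linComp_single, linComp_single, linComp_single, linComp_single, h1]
    congr 1
    linear_combination (a * b * c) * h2

theorem linTensor_comp (dL dR : ℂ) {u v w u' v' w' : Word} (f : Diagram u v →₀ ℂ)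
    (f' : Diagram u' v' →₀ ℂ) (g : Diagram v w →₀ ℂ) (g' : Diagram v' w' →₀ ℂ) :
    linComp dL dR _ _ _ (linTensor u v u' v' f f') (linTensor v w v' w' g g') =
      linTensor u w u' w' (linComp dL dR _ _ _ f g) (linComp dL dR _ _ _ f' g') := by
  induction f using Finsupp.induction_linear with
  | zero => simp only [map_zero, LinearMap.zero_apply]
  | add f f' hf hf' => simp only [map_add, LinearMap.add_apply, hf, hf']
  | single D a =>
  induction f' using Finsupp.induction_linear with
  | zero => simp only [map_zero, LinearMap.zero_apply]
  | add f f' hf hf' => simp only [map_add, LinearMap.add_apply, hf, hf']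
  | single D' b =>
  induction g using Finsupp.induction_linear with
  | zero => simp only [map_zero, LinearMap.zero_apply]
  | add f f' hf hf' => simp only [map_add, LinearMap.add_apply, hf, hf']
  | single E c =>
  induction g' using Finsupp.induction_linear with
  | zero => simp only [map_zero]
  | add f f' hf hf' => simp only [map_add, hf, hf']
  | single E' d =>
    obtain ⟨h1, h2⟩ := Diagram.tensor_comp_aux dL dR D E D' E'
    rw [linTensor_single, linTensor_single, linComp_single, linComp_single, linComp_single,
      linTensor_single, h1, h2]
    congr 1
    ring

/-- The same diagram, regarded as a diagram between equal words. -/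
def Diagram.recast {u v u' v' : Word} (hu : u = u') (hv : v = v') (D : Diagram u v) :
    Diagram u' v' := ⟨D.partner, by subst hu hv; exact D.isPlanarPairing⟩

/-- The linear extension of `Diagram.recast`. -/
def linRecast {u v u' v' : Word} (hu : u = u') (hv : v = v') :
    (Diagram u v →₀ ℂ) →ₗ[ℂ] (Diagram u' v' →₀ ℂ) :=
  Finsupp.lmapDomain ℂ ℂ (Diagram.recast hu hv)

theorem linRecast_single {u v u' v' : Word} (hu : u = u') (hv : v = v') (D : Diagram u v) (a : ℂ) :
    linRecast hu hv (Finsupp.single D a) = Finsupp.single (D.recast hu hv) a :=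
  Finsupp.mapDomain_single

theorem linRecast_rfl {u v : Word} (f : Diagram u v →₀ ℂ) : linRecast rfl rfl f = f :=
  Finsupp.mapDomain_id

theorem linTensor_assoc {u v u' v' u'' v'' : Word} (f : Diagram u v →₀ ℂ)
    (f' : Diagram u' v' →₀ ℂ) (f'' : Diagram u'' v'' →₀ ℂ) :
    linRecast (List.append_assoc _ _ _) (List.append_assoc _ _ _)
      (linTensor _ _ _ _ (linTensor _ _ _ _ f f') f'') =
    linTensor _ _ _ _ f (linTensor _ _ _ _ f' f'') := by
  induction f using Finsupp.induction_linear with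
  | zero => simp only [map_zero, LinearMap.zero_apply]
  | add f f' hf hf' => simp only [map_add, LinearMap.add_apply, hf, hf']
  | single D a =>
  induction f' using Finsupp.induction_linear with
  | zero => simp only [map_zero, LinearMap.zero_apply]
  | add f f' hf hf' => simp only [map_add, LinearMap.add_apply, hf, hf']
  | single D' b =>
  induction f'' using Finsupp.induction_linear with
  | zero => simp only [map_zero]
  | add f f' hf hf' => simp only [map_add, hf, hf']
  | single D'' c =>
    rw [linTensor_single, linTensor_single, linTensor_single, linTensor_single, linRecast_single,
      mul_assoc]
    congr 1
    exact Diagram.ext (Diagram.tensor_assoc_partner D D' D'')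

theorem id_nil_linTensor {u v : Word} (f : Diagram u v →₀ ℂ) :
    linTensor [] [] u v (Finsupp.single (Diagram.id []) 1) f = f := by
  induction f using Finsupp.induction_linear with
  | zero => rw [map_zero]
  | add f f' hf hf' => rw [map_add, hf, hf']
  | single D c =>
    rw [linTensor_single, one_mul]
    exact congrArg (Finsupp.single · c) (Diagram.ext (Diagram.id_nil_tensor_partner D))

theorem linTensor_id_nil {u v : Word} (f : Diagram u v →₀ ℂ) :
    linRecast (List.append_nil _) (List.append_nil _)
      (linTensor u v [] [] f (Finsupp.single (Diagram.id []) 1)) = f := by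
  induction f using Finsupp.induction_linear with
  | zero => simp only [map_zero, LinearMap.zero_apply]
  | add f f' hf hf' => simp only [map_add, LinearMap.add_apply, hf, hf']
  | single D c =>
    rw [linTensor_single, mul_one, linRecast_single]
    congr 1
    exact Diagram.ext (Diagram.tensor_id_nil_partner D)

/-- The category of oriented Kauffman diagrams with loop values `dL` (anticlockwise) and `dR`
(clockwise). Its objects are the words `X^w`. -/
@[ext]
structure KauffmanCat (dL dR : ℂ) where
  word : Word

variable {dL dR : ℂ}

/-- The morphisms from `X^w` to `X^{w'}` are the formal complex linear combinations of oriented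
Kauffman diagrams of type `(w, w')`. -/
instance : Category (KauffmanCat dL dR) where
  Hom X Y := Diagram X.word Y.word →₀ ℂ
  id X := Finsupp.single (Diagram.id X.word) 1
  comp f g := linComp dL dR _ _ _ f g
  id_comp f := id_linComp dL dR f
  comp_id f := linComp_id dL dR f
  assoc f g h := linComp_assoc dL dR f g h

instance : Preadditive (KauffmanCat dL dR) where
  homGroup X Y := inferInstanceAs (AddCommGroup (Diagram X.word Y.word →₀ ℂ))
  add_comp _ _ _ f f' g := add_linComp dL dR f f' g
  comp_add _ _ _ f g g' := linComp_add dL dR f g g'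

instance : Linear ℂ (KauffmanCat dL dR) where
  homModule X Y := inferInstanceAs (Module ℂ (Diagram X.word Y.word →₀ ℂ))
  smul_comp _ _ _ r f g := smul_linComp dL dR r f g
  comp_smul _ _ _ f r g := linComp_smul dL dR f r g

theorem KauffmanCat.comp_eqToHom_eq {u v u' v' : Word} (hu : u = u') (hv : v = v')
    (f : Diagram u v →₀ ℂ) (f' : Diagram u' v' →₀ ℂ) (h : linRecast hu hv f = f') :
    (show (KauffmanCat.mk u : KauffmanCat dL dR) ⟶ KauffmanCat.mk v from f) ≫ eqToHom (congrArg KauffmanCat.mk hv) =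
      eqToHom (congrArg KauffmanCat.mk hu) ≫ (show (KauffmanCat.mk u' : KauffmanCat dL dR) ⟶ KauffmanCat.mk v' from f') := by
  subst hu hv
  rw [linRecast_rfl] at h
  subst h
  simp

/-- The tensor product is concatenation on objects and juxtaposition on morphisms; the associators and
unitors are the identities. -/
instance : MonoidalCategoryStruct (KauffmanCat dL dR) where
  tensorObj X Y := ⟨X.word ++ Y.word⟩
  tensorHom f g := linTensor _ _ _ _ f g
  whiskerLeft X _ _ f := linTensor _ _ _ _ (𝟙 X : X ⟶ X) f
  whiskerRight f Y := linTensor _ _ _ _ f (𝟙 Y : Y ⟶ Y)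
  tensorUnit := ⟨[]⟩
  associator X Y Z := eqToIso (congrArg KauffmanCat.mk (List.append_assoc X.word Y.word Z.word))
  leftUnitor X := eqToIso rfl
  rightUnitor X := eqToIso (congrArg KauffmanCat.mk (List.append_nil X.word))

namespace KauffmanCat

theorem id_tensor_id (X Y : KauffmanCat dL dR) : 𝟙 X ⊗ₘ 𝟙 Y = 𝟙 (X ⊗ Y) := by
  change linTensor _ _ _ _ (Finsupp.single (Diagram.id X.word) 1)
    (Finsupp.single (Diagram.id Y.word) 1) = Finsupp.single (Diagram.id (X.word ++ Y.word)) 1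
  rw [linTensor_single, Diagram.tensor_id, mul_one]

theorem tensor_eqToHom {X Y Y' : KauffmanCat dL dR} (h : Y = Y') :
    𝟙 X ⊗ₘ eqToHom h = eqToHom (congrArg (X ⊗ ·) h) := by
  subst h; exact id_tensor_id X Y

theorem eqToHom_tensor {X Y Y' : KauffmanCat dL dR} (h : Y = Y') :
    eqToHom h ⊗ₘ 𝟙 X = eqToHom (congrArg (· ⊗ X) h) := by
  subst h; exact id_tensor_id Y X

theorem tensor_comp_tensor {X₁ Y₁ Z₁ X₂ Y₂ Z₂ : KauffmanCat dL dR} (f₁ : X₁ ⟶ Y₁) (f₂ : X₂ ⟶ Y₂)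
    (g₁ : Y₁ ⟶ Z₁) (g₂ : Y₂ ⟶ Z₂) : (f₁ ⊗ₘ f₂) ≫ (g₁ ⊗ₘ g₂) = (f₁ ≫ g₁) ⊗ₘ (f₂ ≫ g₂) :=
  linTensor_comp dL dR f₁ f₂ g₁ g₂

theorem associator_natural {X₁ X₂ X₃ Y₁ Y₂ Y₃ : KauffmanCat dL dR} (f₁ : X₁ ⟶ Y₁) (f₂ : X₂ ⟶ Y₂)
    (f₃ : X₃ ⟶ Y₃) :
    ((f₁ ⊗ₘ f₂) ⊗ₘ f₃) ≫ (α_ Y₁ Y₂ Y₃).hom = (α_ X₁ X₂ X₃).hom ≫ (f₁ ⊗ₘ (f₂ ⊗ₘ f₃)) :=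
  comp_eqToHom_eq (List.append_assoc _ _ _) (List.append_assoc _ _ _) _ _
    (linTensor_assoc f₁ f₂ f₃)

theorem leftUnitor_natural {X Y : KauffmanCat dL dR} (f : X ⟶ Y) :
    (𝟙 (𝟙_ (KauffmanCat dL dR)) ⊗ₘ f) ≫ (λ_ Y).hom = (λ_ X).hom ≫ f :=
  comp_eqToHom_eq (dL := dL) (dR := dR) (u := X.word) (v := Y.word) rfl rfl
    (linTensor [] [] X.word Y.word (Finsupp.single (Diagram.id []) 1) f) f
    ((linRecast_rfl _).trans (id_nil_linTensor f))

theorem rightUnitor_natural {X Y : KauffmanCat dL dR} (f : X ⟶ Y) :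
    (f ⊗ₘ 𝟙 (𝟙_ (KauffmanCat dL dR))) ≫ (ρ_ Y).hom = (ρ_ X).hom ≫ f :=
  comp_eqToHom_eq (List.append_nil _) (List.append_nil _) _ _ (linTensor_id_nil f)

theorem associator_hom (X Y Z : KauffmanCat dL dR) : (α_ X Y Z).hom =
    eqToHom (congrArg KauffmanCat.mk (List.append_assoc X.word Y.word Z.word)) := rfl

theorem rightUnitor_hom (X : KauffmanCat dL dR) : (ρ_ X).hom =
    eqToHom (congrArg KauffmanCat.mk (List.append_nil X.word)) := rfl

theorem leftUnitor_hom (X : KauffmanCat dL dR) : (λ_ X).hom = 𝟙 X := rfl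

end KauffmanCat

instance : MonoidalCategory (KauffmanCat dL dR) :=
  MonoidalCategory.ofTensorHom
    (id_tensorHom_id := KauffmanCat.id_tensor_id)
    (id_tensorHom := fun _ _ _ _ => rfl)
    (tensorHom_id := fun _ _ => rfl)
    (tensorHom_comp_tensorHom := KauffmanCat.tensor_comp_tensor)
    (associator_naturality := KauffmanCat.associator_natural)
    (leftUnitor_naturality := KauffmanCat.leftUnitor_natural)
    (rightUnitor_naturality := KauffmanCat.rightUnitor_natural)
    (pentagon := fun W X Y Z => by
      rw [KauffmanCat.associator_hom W X Y, KauffmanCat.associator_hom X Y Z]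
      erw [KauffmanCat.eqToHom_tensor, KauffmanCat.tensor_eqToHom]
      simp only [KauffmanCat.associator_hom]
      erw [eqToHom_trans, eqToHom_trans, eqToHom_trans])
    (triangle := fun X Y => by
      rw [KauffmanCat.associator_hom, KauffmanCat.rightUnitor_hom, KauffmanCat.leftUnitor_hom]
      erw [KauffmanCat.eqToHom_tensor, eqToHom_trans, KauffmanCat.eqToHom_tensor]
      rfl)

instance : MonoidalPreadditive (KauffmanCat dL dR) where
  whiskerLeft_zero {X _ _} := map_zero (linTensor _ _ _ _ (𝟙 X : X ⟶ X))
  zero_whiskerRight {X _ _} := (linTensor _ _ _ _).map_zero₂ (𝟙 X : X ⟶ X)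
  whiskerLeft_add {X _ _} f g := map_add (linTensor _ _ _ _ (𝟙 X : X ⟶ X)) f g
  add_whiskerRight {X _ _} f g := (linTensor _ _ _ _).map_add₂ f g (𝟙 X : X ⟶ X)

instance : MonoidalLinear ℂ (KauffmanCat dL dR) where
  whiskerLeft_smul X _ _ r f := map_smul (linTensor _ _ _ _ (𝟙 X : X ⟶ X)) r f
  smul_whiskerRight r _ _ f X := (linTensor _ _ _ _).map_smul₂ r f (𝟙 X : X ⟶ X)

namespace KauffmanCat

variable (dL dR)

/-- The object `X`. -/
def X : KauffmanCat dL dR := ⟨[true]⟩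

/-- The object `X^*`. -/
def Xs : KauffmanCat dL dR := ⟨[false]⟩

/-- The basic arc `ε_X : X ⊗ X^* ⟶ I`. -/
def epsX : X dL dR ⊗ Xs dL dR ⟶ 𝟙_ (KauffmanCat dL dR) :=
  (Finsupp.single (Diagram.cap true) 1 : Diagram [true, false] [] →₀ ℂ)

/-- The basic arc `ε_{X^*} : X^* ⊗ X ⟶ I`. -/
def epsXs : Xs dL dR ⊗ X dL dR ⟶ 𝟙_ (KauffmanCat dL dR) :=
  (Finsupp.single (Diagram.cap false) 1 : Diagram [false, true] [] →₀ ℂ)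

/-- The basic arc `δ_X : I ⟶ X^* ⊗ X`. -/
def delX : 𝟙_ (KauffmanCat dL dR) ⟶ Xs dL dR ⊗ X dL dR :=
  (Finsupp.single (Diagram.cup false) 1 : Diagram [] [false, true] →₀ ℂ)

/-- The basic arc `δ_{X^*} : I ⟶ X ⊗ X^*`. -/
def delXs : 𝟙_ (KauffmanCat dL dR) ⟶ X dL dR ⊗ Xs dL dR :=
  (Finsupp.single (Diagram.cup true) 1 : Diagram [] [true, false] →₀ ℂ)

end KauffmanCat

/-- `ε : V ⊗ W ⟶ I` is a rigidity pairing with associated copairing `δ : I ⟶ W ⊗ V`, i.e.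
`(ε ⊗ 1)(1 ⊗ δ) = 1` and `(1 ⊗ ε)(δ ⊗ 1) = 1` (up to the constraints of the monoidal category). These
are the axioms of Mathlib's `ExactPairing W V`. -/
structure IsRigidityPairing {T : Type*} [Category* T] [MonoidalCategory T] {V W : T}
    (ε : V ⊗ W ⟶ 𝟙_ T) (δ : 𝟙_ T ⟶ W ⊗ V) : Prop where
  zigzag : V ◁ δ ≫ (α_ V W V).inv ≫ ε ▷ V = (ρ_ V).hom ≫ (λ_ V).inv
  zigzag_dual : δ ▷ W ≫ (α_ W V W).hom ≫ W ◁ ε = (λ_ W).hom ≫ (ρ_ W).inv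

/-- The monoidal category is strict: the tensor product is associative and unital on the nose, and
the associators and unitors are the identities. -/
structure IsStrictMonoidal (T : Type*) [Category* T] [MonoidalCategory T] : Prop where
  associator : ∀ A B C : T, ∃ h : (A ⊗ B) ⊗ C = A ⊗ B ⊗ C, (α_ A B C).hom = eqToHom h
  leftUnitor : ∀ A : T, ∃ h : 𝟙_ T ⊗ A = A, (λ_ A).hom = eqToHom h
  rightUnitor : ∀ A : T, ∃ h : A ⊗ 𝟙_ T = A, (ρ_ A).hom = eqToHom h

section functors
variable {S T : Type*} [Category* S] [Category* T] [MonoidalCategory S] [MonoidalCategory T]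
  (F : S ⥤ T) [F.Monoidal]

/-- The monoidal functor is strict: it preserves the unit object and tensor products on the nose,
and its structure morphisms are the identities. -/
structure IsStrictFunctor : Prop where
  unit : ∃ h : 𝟙_ T = F.obj (𝟙_ S), Functor.LaxMonoidal.ε F = eqToHom h
  tensor : ∀ A B : S, ∃ h : F.obj A ⊗ F.obj B = F.obj (A ⊗ B),
    Functor.LaxMonoidal.μ F A B = eqToHom h

/-- The image `F A ⊗ F B ≅ F (A ⊗ B) ⟶ F I ≅ I` of a pairing. For a strict functor, this is `F e`. -/
def mapPairing {A B : S} (e : A ⊗ B ⟶ 𝟙_ S) : F.obj A ⊗ F.obj B ⟶ 𝟙_ T :=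
  Functor.LaxMonoidal.μ F A B ≫ F.map e ≫ Functor.OplaxMonoidal.η F

/-- The image `I ≅ F I ⟶ F (A ⊗ B) ≅ F A ⊗ F B` of a copairing. For a strict functor, this is
`F d`. -/
def mapCopairing {A B : S} (d : 𝟙_ S ⟶ A ⊗ B) : 𝟙_ T ⟶ F.obj A ⊗ F.obj B :=
  Functor.LaxMonoidal.ε F ≫ F.map d ≫ Functor.OplaxMonoidal.δ F A B

end functors

/-- `F(X) = Y`, `F(X^*) = Ys`, `F(ε_X) = e` and `F(ε_{X^*}) = es`. -/
def TakesArcsTo {dL dR : ℂ} {T : Type*} [Category* T] [MonoidalCategory T]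
    (F : KauffmanCat dL dR ⥤ T) [F.Monoidal] {Y Ys : T} (e : Y ⊗ Ys ⟶ 𝟙_ T)
    (es : Ys ⊗ Y ⟶ 𝟙_ T) : Prop :=
  ∃ (hX : F.obj (KauffmanCat.X dL dR) = Y) (hXs : F.obj (KauffmanCat.Xs dL dR) = Ys),
    mapPairing F (KauffmanCat.epsX dL dR) = (eqToHom hX ⊗ₘ eqToHom hXs) ≫ e ∧
    mapPairing F (KauffmanCat.epsXs dL dR) = (eqToHom hXs ⊗ₘ eqToHom hX) ≫ es

end

end OrientedKauffman

set_option linter.unusedSectionVars false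

/-! A monoidal functor carries zigzag identities and loop values over to its target, and a rigidity
pairing has only one copairing (`copairing_unique`). This gives the first part, and it also drives
the comparison of two functors `F` and `G`. The identities on the two letters extend uniquely to a
family compatible with tensor products (`wordIso`). This family is natural at the pairings by
assumption, at the copairings because these are determined by the pairings, and at all morphisms
because arcs generate them (`generated`). For strict functors every component is an identity up to
an equality of objects, so the functors coincide.

The substance is the existence of a functor. An `ArcModel` records what the target provides: an
object for each word, and cups and caps at each `Site` of a word. They satisfy three kinds of
relations: a loop is a scalar, a cup and a cap that overlap in one point straighten, and disjoint
arcs commute. The diagram category is itself such a model, `model`.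

A diagram without upper points has a string joining two neighbours (`exists_neighbours`), so it
arises from the empty diagram by inserting arcs; its value is the corresponding composite of cups.
The value does not depend on the order of insertion (`isValue_unique`): if the last arcs of two
constructions are disjoint, the common remainder is obtained, up to a scalar, by capping off inside
`model`, and the loop values are then divided out. Only this division needs `dL` and `dR` to be
nonzero.

The linear extension of the value commutes with cups by construction, and with caps because the
relations that move a cap up past the cups hold in both models (`eval_cap`). A morphism with upper
points is bent until none are left (`map`). Since cups and caps at the bottom generate all
morphisms, functoriality and compatibility with tensor products need to be checked only for these
(`map_comp`, `map_cons`, `map_whiskerRight`). -/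

namespace OrientedKauffman

noncomputable section

open CategoryTheory MonoidalCategory

/-! ### Rigidity pairings and zigzag identities. -/

section rigidity
variable {T : Type*} [Category* T] [MonoidalCategory T]

/-- The pairing and `f` act on disjoint tensor factors, so by the interchange law one slides past
the other. Besides commuting distant arcs, this moves the splitting isomorphisms of words through an
arc. -/
theorem pairing_naturality {V W A B : T} (ε : V ⊗ W ⟶ 𝟙_ T) (f : A ⟶ B) :
    V ◁ W ◁ f ≫ (α_ V W B).inv ≫ ε ▷ B ≫ (λ_ B).hom =
      (α_ V W A).inv ≫ ε ▷ A ≫ (λ_ A).hom ≫ f := by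
  rw [associator_inv_naturality_right_assoc, whisker_exchange_assoc, leftUnitor_naturality]

theorem copairing_naturality {V W A B : T} (δ : 𝟙_ T ⟶ V ⊗ W) (f : A ⟶ B) :
    (λ_ A).inv ≫ δ ▷ A ≫ (α_ V W A).hom ≫ V ◁ W ◁ f =
      f ≫ (λ_ B).inv ≫ δ ▷ B ≫ (α_ V W B).hom := by
  rw [leftUnitor_inv_naturality_assoc, whisker_exchange_assoc, ← associator_naturality_right]

/-- The form of the zigzag needed inside words: `Z` is the rest of the word, and the unitors are
already absorbed. -/
theorem IsRigidityPairing.zigzag_whisker {V W : T} {ε : V ⊗ W ⟶ 𝟙_ T} {δ : 𝟙_ T ⟶ W ⊗ V}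
    (h : IsRigidityPairing ε δ) (Z : T) :
    V ◁ ((λ_ Z).inv ≫ δ ▷ Z ≫ (α_ W V Z).hom) ≫ (α_ V W (V ⊗ Z)).inv ≫ ε ▷ (V ⊗ Z) ≫
      (λ_ (V ⊗ Z)).hom = 𝟙 (V ⊗ Z) := by
  -- Coherence gathers `Z` into one right whiskering, which exposes the plain zigzag on `V`.
  calc _ = (ρ_ V).inv ▷ Z ≫ (V ◁ δ ≫ (α_ V W V).inv ≫ ε ▷ V) ▷ Z ≫ (λ_ V).hom ▷ Z := by monoidal
    _ = _ := by rw [h.zigzag, ← comp_whiskerRight, ← comp_whiskerRight]; simp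

theorem IsRigidityPairing.zigzag_dual_whisker {V W : T} {ε : V ⊗ W ⟶ 𝟙_ T} {δ : 𝟙_ T ⟶ W ⊗ V}
    (h : IsRigidityPairing ε δ) (Z : T) :
    (λ_ (W ⊗ Z)).inv ≫ δ ▷ (W ⊗ Z) ≫ (α_ W V (W ⊗ Z)).hom ≫
      W ◁ ((α_ V W Z).inv ≫ ε ▷ Z ≫ (λ_ Z).hom) = 𝟙 (W ⊗ Z) := by
  calc _ = (λ_ W).inv ▷ Z ≫ (δ ▷ W ≫ (α_ W V W).hom ≫ W ◁ ε) ▷ Z ≫ (ρ_ W).hom ▷ Z := by monoidal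
    _ = _ := by rw [h.zigzag_dual, ← comp_whiskerRight, ← comp_whiskerRight]; simp

/-- A copairing is determined by its rigidity pairing. -/
theorem IsRigidityPairing.copairing_unique {V W : T} {ε : V ⊗ W ⟶ 𝟙_ T} {δ δ' : 𝟙_ T ⟶ W ⊗ V}
    (h : IsRigidityPairing ε δ) (h' : IsRigidityPairing ε δ') : δ = δ' := by
  -- The identity of `W` is inserted below `δ` and expanded into a zigzag of `δ'` and `ε`. Once `δ`
  -- and `δ'` are interchanged, `δ` and `ε` form the other zigzag, and only `δ'` remains.
  calc δ = δ ≫ ((λ_ W).inv ≫ ((λ_ W).hom ≫ (ρ_ W).inv) ≫ (ρ_ W).hom) ▷ V := by simp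
    _ = δ ≫ ((λ_ W).inv ≫ (δ' ▷ W ≫ (α_ W V W).hom ≫ W ◁ ε) ≫ (ρ_ W).hom) ▷ V := by
        rw [h'.zigzag_dual]
    _ = 𝟙 _ ⊗≫ (𝟙_ T ◁ δ ≫ δ' ▷ (W ⊗ V)) ⊗≫ W ◁ ε ▷ V ⊗≫ 𝟙 _ := by monoidal
    _ = 𝟙 _ ⊗≫ (δ' ▷ 𝟙_ T ≫ (W ⊗ V) ◁ δ) ⊗≫ W ◁ ε ▷ V ⊗≫ 𝟙 _ := by rw [whisker_exchange]
    _ = δ' ≫ W ◁ ((ρ_ V).inv ≫ (V ◁ δ ≫ (α_ V W V).inv ≫ ε ▷ V) ≫ (λ_ V).hom) := by monoidal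
    _ = δ' := by rw [h.zigzag]; simp

end rigidity

/-! ### Places for arcs in a word and their relative positions. -/

theorem Bool.eq_of_ne_of_ne {a b c : Bool} (h : b ≠ c) (h' : a ≠ b) : c = a := by
  revert a b c; decide

/-- The places in a word `t` where two neighbouring opposite letters can be removed,
which leaves the word `s`. -/
inductive Site : Word → Word → Type
  | here {b b' : Bool} (h : b ≠ b') (s : Word) : Site s (b :: b' :: s)
  | there (a : Bool) {s t : Word} (i : Site s t) : Site (a :: s) (a :: t)

namespace Site

/-- The number of letters to the left of the two removed ones. -/
def idx : {s t : Word} → Site s t → ℕ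
  | _, _, here _ _ => 0
  | _, _, there _ i => i.idx + 1

/-- The first of the two removed letters. -/
def letter : {s t : Word} → Site s t → Bool
  | _, _, here (b := b) _ _ => b
  | _, _, there _ i => i.letter

theorem length_eq {s t : Word} (i : Site s t) : t.length = s.length + 2 := by
  induction i with
  | here => rfl
  | there a i ih => simp [ih]

/-- The site `j` lies one letter to the right of the site `i`. -/
inductive Adjacent : {s t : Word} → Site s t → Site s t → Prop
  | here {b b' : Bool} (h : b ≠ b') (h' : b' ≠ b) (s : Word) :
      Adjacent (here h (b :: s)) (there b (here h' s))
  | there (a : Bool) {s t : Word} {i j : Site s t} : Adjacent i j → Adjacent (there a i) (there a j)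

theorem Adjacent.idx_eq {s t : Word} {i j : Site s t} (h : Adjacent i j) : j.idx = i.idx + 1 := by
  induction h with
  | here => rfl
  | there a _ ih => simp [idx, ih]

/-- The sites `i` and `j` are disjoint, and their removal in either order is described by the
square of `i`, `j`, `i'`, `j'`. -/
inductive Disjoint : {r s s' t : Word} → Site s t → Site s' t → Site r s' → Site r s → Prop
  | left {b b' : Bool} (h : b ≠ b') {r s : Word} (j : Site r s) :
      Disjoint (here h s) (there b (there b' j)) (here h r) j
  | right {b b' : Bool} (h : b ≠ b') {r s : Word} (i : Site r s) :
      Disjoint (there b (there b' i)) (here h s) i (here h r)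
  | there (a : Bool) {r s s' t : Word} {i : Site s t} {j : Site s' t} {i' : Site r s'}
      {j' : Site r s} : Disjoint i j i' j' →
      Disjoint (there a i) (there a j) (there a i') (there a j')

theorem Disjoint.symm {r s s' t : Word} {i : Site s t} {j : Site s' t} {i' : Site r s'}
    {j' : Site r s} (h : Disjoint i j i' j') : Disjoint j i j' i' := by
  induction h with
  | left h j => exact .right h j
  | right h i => exact .left h i
  | there a _ ih => exact ih.there a

/-- The possible relative positions of two sites. -/
inductive Position : {s s' t : Word} → Site s t → Site s' t → Prop
  | refl {s t : Word} (i : Site s t) : Position i i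
  | adjacent {s t : Word} {i j : Site s t} : Adjacent i j → Position i j
  | adjacent' {s t : Word} {i j : Site s t} : Adjacent j i → Position i j
  | disjoint {r s s' t : Word} {i : Site s t} {j : Site s' t} {i' : Site r s'} {j' : Site r s} :
      Disjoint i j i' j' → Position i j

theorem Position.there (a : Bool) {s s' t : Word} {i : Site s t} {j : Site s' t}
    (h : Position i j) : Position (Site.there a i) (Site.there a j) := by
  cases h with
  | refl => exact .refl _
  | adjacent h => exact .adjacent (h.there a)
  | adjacent' h => exact .adjacent' (h.there a)
  | disjoint h => exact .disjoint (h.there a)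

/-- Two pairs of neighbouring places share two places, one, or none. With one in common the three
letters alternate, so both removals leave the same word; this is why adjacent sites have a common
source. The distinction drives `isValue_unique` and `eval_cap`. -/
theorem position {s s' t : Word} (i : Site s t) (j : Site s' t) : Position i j := by
  induction i generalizing s' with
  | @here b b' h s =>
    cases j with
    | here => exact .refl _
    | there _ j =>
      cases j with
      | @here _ b'' h' s =>
        -- There are only two letters, so the third letter equals the first one.
        obtain rfl : b'' = b := Bool.eq_of_ne_of_ne h' h
        exact .adjacent (.here h h' _)
      | there _ j => exact .disjoint (.left h j)
  | there a i ih =>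
    cases j with
    | here h' s =>
      cases i with
      | @here _ b'' h s =>
        obtain rfl : b'' = a := Bool.eq_of_ne_of_ne h h'
        exact .adjacent' (.here h' h _)
      | there _ i => exact .disjoint (.right h' i)
    | there _ j => exact (ih j).there a

end Site

/-! ### Cups and caps in a linear monoidal category, and their relations. -/

/-- Objects indexed by the words, letter by letter tensor products of two objects
in duality, together with the rigidity pairings, whose loops have the values `dL` and `dR`. -/
structure ArcModel (dL dR : ℂ) (T : Type*) [Category* T] [Preadditive T] [Linear ℂ T]
    [MonoidalCategory T] where
  obj : Word → T
  letter : Bool → T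
  split (a : Bool) (s : Word) : obj (a :: s) ≅ letter a ⊗ obj s
  ev {b b' : Bool} (h : b ≠ b') : letter b ⊗ letter b' ⟶ 𝟙_ T
  coev {b b' : Bool} (h : b ≠ b') : 𝟙_ T ⟶ letter b ⊗ letter b'
  rigid {b b' : Bool} (h : b ≠ b') : IsRigidityPairing (ev h) (coev h.symm)
  loop {b b' : Bool} (h : b ≠ b') :
    coev h ≫ ev h = Diagram.loopValue dL dR (some b) • 𝟙 (𝟙_ T)

namespace ArcModel

variable {dL dR : ℂ} {T : Type*} [Category* T] [Preadditive T] [Linear ℂ T] [MonoidalCategory T]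
  (M : ArcModel dL dR T)

/-- Tensor a morphism with the identity of a letter from the left. -/
def cons (a : Bool) {s t : Word} (f : M.obj s ⟶ M.obj t) : M.obj (a :: s) ⟶ M.obj (a :: t) :=
  (M.split a s).hom ≫ M.letter a ◁ f ≫ (M.split a t).inv

/-- Pair the first two letters. -/
def capFront {b b' : Bool} (h : b ≠ b') (s : Word) : M.obj (b :: b' :: s) ⟶ M.obj s :=
  (M.split b _).hom ≫ M.letter b ◁ (M.split b' s).hom ≫ (α_ _ _ _).inv ≫ M.ev h ▷ M.obj s ≫
    (λ_ _).hom

/-- Insert two letters at the front by the copairing. -/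
def cupFront {b b' : Bool} (h : b ≠ b') (s : Word) : M.obj s ⟶ M.obj (b :: b' :: s) :=
  (λ_ _).inv ≫ M.coev h ▷ M.obj s ≫ (α_ _ _ _).hom ≫ M.letter b ◁ (M.split b' s).inv ≫
    (M.split b _).inv

@[simp] theorem cons_id (a : Bool) (s : Word) : M.cons a (𝟙 (M.obj s)) = 𝟙 _ := by simp [cons]

theorem cons_comp (a : Bool) {s t u : Word} (f : M.obj s ⟶ M.obj t) (g : M.obj t ⟶ M.obj u) :
    M.cons a (f ≫ g) = M.cons a f ≫ M.cons a g := by simp [cons]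

theorem cons_smul [MonoidalPreadditive T] [MonoidalLinear ℂ T] (a : Bool) {s t : Word} (r : ℂ)
    (f : M.obj s ⟶ M.obj t) : M.cons a (r • f) = r • M.cons a f := by simp [cons]

theorem cons_add [MonoidalPreadditive T] (a : Bool) {s t : Word}
    (f g : M.obj s ⟶ M.obj t) : M.cons a (f + g) = M.cons a f + M.cons a g := by simp [cons]

theorem cons_zero [MonoidalPreadditive T] (a : Bool) (s t : Word) :
    M.cons a (0 : M.obj s ⟶ M.obj t) = 0 := by simp [cons]

theorem capFront_naturality {b b' : Bool} (h : b ≠ b') {s t : Word} (f : M.obj s ⟶ M.obj t) :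
    M.cons b (M.cons b' f) ≫ M.capFront h t = M.capFront h s ≫ f := by
  simp [cons, capFront, pairing_naturality]

theorem cupFront_naturality {b b' : Bool} (h : b ≠ b') {s t : Word} (f : M.obj s ⟶ M.obj t) :
    M.cupFront h s ≫ M.cons b (M.cons b' f) = f ≫ M.cupFront h t := by
  have k := copairing_naturality (M.coev h) f
  simp only [cons, cupFront, Category.assoc, Iso.inv_hom_id_assoc, whiskerLeft_comp,
    whiskerLeft_inv_hom_assoc]
  rw [reassoc_of% k]

theorem cupFront_capFront {b b' : Bool} [MonoidalPreadditive T] [MonoidalLinear ℂ T]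
    (h : b ≠ b') (s : Word) :
    M.cupFront h s ≫ M.capFront h s = Diagram.loopValue dL dR (some b) • 𝟙 _ := by
  have : M.cupFront h s ≫ M.capFront h s =
      (λ_ _).inv ≫ (M.coev h ≫ M.ev h) ▷ M.obj s ≫ (λ_ _).hom := by
    simp [cupFront, capFront]
  rw [this, M.loop]
  simp

theorem zigzag {b b' : Bool} (h : b ≠ b') (h' : b' ≠ b) (s : Word) :
    M.cons b (M.cupFront h' s) ≫ M.capFront h (b :: s) = 𝟙 _ := by
  have := (M.rigid h).zigzag_whisker (M.obj s)
  simp only [whiskerLeft_comp, Category.assoc] at this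
  -- The splitting of the lower word sits between the cup and the cap; it slides through the pairing
  -- and leaves the zigzag undisturbed.
  have k := pairing_naturality (M.ev h) (M.split b s).inv
  simp only [cons, cupFront, capFront, Category.assoc, Iso.inv_hom_id_assoc, whiskerLeft_comp,
    whiskerLeft_inv_hom_assoc, k]
  rw [reassoc_of% this, Iso.hom_inv_id]

theorem zigzag_dual {b b' : Bool} (h : b ≠ b') (h' : b' ≠ b) (s : Word) :
    M.cupFront h (b :: s) ≫ M.cons b (M.capFront h' s) = 𝟙 _ := by
  have := (M.rigid h').zigzag_dual_whisker (M.obj s)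
  simp only [whiskerLeft_comp] at this
  have k := copairing_naturality (M.coev h) (M.split b s).hom
  simp only [cons, cupFront, capFront, Category.assoc, Iso.inv_hom_id_assoc, whiskerLeft_comp,
    whiskerLeft_inv_hom_assoc]
  rw [reassoc_of% k, reassoc_of% this, Iso.hom_inv_id]

/-- Insert the two letters at a site by the copairing. -/
def cup : {s t : Word} → Site s t → (M.obj s ⟶ M.obj t)
  | _, _, .here h s => M.cupFront h s
  | _, _, .there a i => M.cons a (cup i)

/-- Pair the two letters at a site. -/
def cap : {s t : Word} → Site s t → (M.obj t ⟶ M.obj s)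
  | _, _, .here h s => M.capFront h s
  | _, _, .there a i => M.cons a (cap i)

/-- With `cup_cap_of_adjacent` and `cup_cap_of_disjoint`, this covers every composite of a cup
followed by a cap: the two close a loop, form a zigzag, or exchange their order. All three are
proved at the front of the word and carried inwards by `cons`. -/
theorem cup_cap [MonoidalPreadditive T] [MonoidalLinear ℂ T] {s t : Word} (i : Site s t) :
    M.cup i ≫ M.cap i = Diagram.loopValue dL dR (some i.letter) • 𝟙 _ := by
  induction i with
  | here h s => exact M.cupFront_capFront h s
  | there a i ih => rw [cup, cap, ← cons_comp, ih, cons_smul, cons_id]; rfl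

theorem cup_cap_of_adjacent {s t : Word} {i j : Site s t} (h : Site.Adjacent i j) :
    M.cup i ≫ M.cap j = 𝟙 _ ∧ M.cup j ≫ M.cap i = 𝟙 _ := by
  induction h with
  | here h h' s => exact ⟨M.zigzag_dual h h' s, M.zigzag h h' s⟩
  | there a _ ih => simp only [cup, cap, ← cons_comp, ih, cons_id, and_self]

theorem cup_cup_of_disjoint {r s s' t : Word} {i : Site s t} {j : Site s' t} {i' : Site r s'}
    {j' : Site r s} (h : Site.Disjoint i j i' j') :
    M.cup j' ≫ M.cup i = M.cup i' ≫ M.cup j := by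
  induction h with
  | left h j => exact (M.cupFront_naturality h _).symm
  | right h j => exact M.cupFront_naturality h _
  | there a _ ih => simp only [cup, ← cons_comp, ih]

theorem cup_cap_of_disjoint {r s s' t : Word} {i : Site s t} {j : Site s' t} {i' : Site r s'}
    {j' : Site r s} (h : Site.Disjoint i j i' j') :
    M.cup j ≫ M.cap i = M.cap i' ≫ M.cup j' := by
  induction h with
  | left h j => exact M.capFront_naturality h _
  | right h j => exact M.cupFront_naturality h _
  | there a _ ih => simp only [cup, cap, ← cons_comp, ih]

end ArcModel
end

noncomputable section

open CategoryTheory MonoidalCategory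

variable {dL dR : ℂ}

/-! ### The diagram category as a model. -/

namespace KauffmanCat

/-- A diagram as a morphism. -/
def ofDiagram {u v : Word} (D : Diagram u v) :
    (KauffmanCat.mk u : KauffmanCat dL dR) ⟶ KauffmanCat.mk v :=
  (Finsupp.single D 1 : Diagram u v →₀ ℂ)

theorem ofDiagram_comp {u v w : Word} (D : Diagram u v) (E : Diagram v w) :
    (ofDiagram D ≫ ofDiagram E : (KauffmanCat.mk u : KauffmanCat dL dR) ⟶ _) =
      D.weight dL dR E • ofDiagram (D.comp E) := by
  change linComp dL dR u v w (Finsupp.single D 1) (Finsupp.single E 1) =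
    (D.weight dL dR E • Finsupp.single (D.comp E) 1 : Diagram u w →₀ ℂ)
  rw [linComp_single, Finsupp.smul_single, smul_eq_mul, one_mul, one_mul, mul_one]

theorem ofDiagram_id (u : Word) :
    (ofDiagram (Diagram.id u) : (KauffmanCat.mk u : KauffmanCat dL dR) ⟶ _) = 𝟙 _ := rfl

theorem ofDiagram_whiskerLeft {u v : Word} (w : Word) (D : Diagram u v) :
    ((KauffmanCat.mk w : KauffmanCat dL dR) ◁ ofDiagram D) =
      ofDiagram ((Diagram.id w).tensor D) := by
  change linTensor w w u v (Finsupp.single _ 1) (Finsupp.single _ 1) = Finsupp.single _ 1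
  rw [linTensor_single, one_mul]

theorem ofDiagram_whiskerRight {u v : Word} (D : Diagram u v) (w : Word) :
    (ofDiagram D ▷ (KauffmanCat.mk w : KauffmanCat dL dR)) =
      ofDiagram (D.tensor (Diagram.id w)) := by
  change linTensor u v w w (Finsupp.single _ 1) (Finsupp.single _ 1) = Finsupp.single _ 1
  rw [linTensor_single, one_mul]

theorem hom_induction {u v : Word}
    {P : ((KauffmanCat.mk u : KauffmanCat dL dR) ⟶ KauffmanCat.mk v) → Prop} (zero : P 0)
    (add : ∀ f g, P f → P g → P (f + g)) (smul : ∀ (r : ℂ) f, P f → P (r • f))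
    (diagram : ∀ D, P (ofDiagram D)) (f) : P f := by
  refine Finsupp.induction_linear (motive := P) f zero add fun D a => ?_
  have := smul a _ (diagram D)
  rwa [show a • ofDiagram D = (Finsupp.single D a : Diagram u v →₀ ℂ) from
    (Finsupp.smul_single a D 1).trans (by rw [smul_eq_mul, mul_one])] at this

end KauffmanCat

/-- The cap with end points labelled by two opposite letters. -/
def arcCap : {b b' : Bool} → b ≠ b' → Diagram [b, b'] []
  | true, false, _ => Diagram.cap true
  | false, true, _ => Diagram.cap false
  | true, true, h => absurd rfl h
  | false, false, h => absurd rfl h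

/-- The cup with end points labelled by two opposite letters. -/
def arcCup : {b b' : Bool} → b ≠ b' → Diagram [] [b, b']
  | true, false, _ => Diagram.cup true
  | false, true, _ => Diagram.cup false
  | true, true, h => absurd rfl h
  | false, false, h => absurd rfl h

/-- A finite computation with three gluing points, none of which closes a loop. -/
theorem diagram_zigzag {b b' : Bool} (h : b ≠ b') :
    ((Diagram.id [b]).tensor (arcCup h.symm)).comp ((arcCap h).tensor (Diagram.id [b])) =
      Diagram.id [b] ∧
    ((Diagram.id [b]).tensor (arcCup h.symm)).weight dL dR ((arcCap h).tensor (Diagram.id [b])) =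
      1 := by
  cases b <;> cases b' <;> try exact absurd rfl h
  all_goals
    constructor
    · ext x : 2
      rcases x with (_ | i) | (_ | i)
      · rfl
      -- Only the points numbered `0` carry a string; all others are fixed by both pairings.
      · rw [Diagram.isPlanarPairing _ |>.fixed _ (by simp [flow]),
          Diagram.isPlanarPairing _ |>.fixed _ (by simp [flow])]
      · rfl
      · rw [Diagram.isPlanarPairing _ |>.fixed _ (by simp [flow]),
          Diagram.isPlanarPairing _ |>.fixed _ (by simp [flow])]
    · change (if _ = _ then _ else (1 : ℂ)) * ((if _ = _ then _ else (1 : ℂ)) *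
        ((if _ = _ then _ else (1 : ℂ)) * 1)) = 1
      rw [if_neg (by revert h; decide), if_neg (by revert h; decide), if_neg (by revert h; decide)]
      norm_num

theorem diagram_loop {b b' : Bool} (h : b ≠ b') :
    (arcCup h).comp (arcCap h) = Diagram.id [] ∧
    (arcCup h).weight dL dR (arcCap h) = Diagram.loopValue dL dR (some b) := by
  cases b <;> cases b' <;> try exact absurd rfl h
  all_goals
    constructor
    · ext x : 2
      rw [Diagram.isPlanarPairing _ |>.fixed _ (by rcases x with i | i <;> simp [flow]),
          Diagram.isPlanarPairing _ |>.fixed _ (by rcases x with i | i <;> simp [flow])]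
    · change (if _ = _ then _ else (1 : ℂ)) * ((if _ = _ then _ else (1 : ℂ)) * 1) = _
      -- Gluing goes from right to left: point `1` merges two different strings, and only point `0`,
      -- with the letter `b`, closes the loop.
      rw [if_neg (by revert h; decide), if_pos (by revert h; decide)]
      simp

theorem diagram_zigzag_dual {b b' : Bool} (h : b ≠ b') :
    ((arcCup h.symm).tensor (Diagram.id [b'])).comp ((Diagram.id [b']).tensor (arcCap h)) =
      Diagram.id [b'] ∧
    ((arcCup h.symm).tensor (Diagram.id [b'])).weight dL dR ((Diagram.id [b']).tensor (arcCap h)) =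
      1 := by
  cases b <;> cases b' <;> try exact absurd rfl h
  all_goals
    constructor
    · ext x : 2
      rcases x with (_ | i) | (_ | i)
      · rfl
      · rw [Diagram.isPlanarPairing _ |>.fixed _ (by simp [flow]),
          Diagram.isPlanarPairing _ |>.fixed _ (by simp [flow])]
      · rfl
      · rw [Diagram.isPlanarPairing _ |>.fixed _ (by simp [flow]),
          Diagram.isPlanarPairing _ |>.fixed _ (by simp [flow])]
    · change (if _ = _ then _ else (1 : ℂ)) * ((if _ = _ then _ else (1 : ℂ)) *
        ((if _ = _ then _ else (1 : ℂ)) * 1)) = 1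
      rw [if_neg (by revert h; decide), if_neg (by revert h; decide), if_neg (by revert h; decide)]
      norm_num

namespace KauffmanCat

/-- The diagram computations transfer directly: for these explicit words the associators and unitors
reduce to identities, which `Category.id_comp` removes. -/
theorem arc_rigid {b b' : Bool} (h : b ≠ b') :
    IsRigidityPairing (T := KauffmanCat dL dR) (V := ⟨[b]⟩) (W := ⟨[b']⟩)
      (ofDiagram (arcCap h)) (ofDiagram (arcCup h.symm)) where
  zigzag := by
    obtain ⟨h1, h2⟩ := diagram_zigzag (dL := dL) (dR := dR) h
    have e := ofDiagram_comp (dL := dL) (dR := dR) ((Diagram.id [b]).tensor (arcCup h.symm))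
      ((arcCap h).tensor (Diagram.id [b]))
    rw [h1, h2, one_smul] at e
    have l : (mk [b] : KauffmanCat dL dR) ◁ ofDiagram (arcCup h.symm) = _ :=
      ofDiagram_whiskerLeft [b] (arcCup h.symm)
    have r : ofDiagram (arcCap h) ▷ (mk [b] : KauffmanCat dL dR) = _ :=
      ofDiagram_whiskerRight (arcCap h) [b]
    have r1 : (ρ_ (mk [b] : KauffmanCat dL dR)).hom ≫ (λ_ (mk [b] : KauffmanCat dL dR)).inv =
      𝟙 (mk [b]) := Category.id_comp (𝟙 (mk [b]))
    exact (congrArg₂ (· ≫ ·) l ((Category.id_comp _).trans r)).trans (e.trans r1.symm)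
  zigzag_dual := by
    obtain ⟨h1, h2⟩ := diagram_zigzag_dual (dL := dL) (dR := dR) h
    have e := ofDiagram_comp (dL := dL) (dR := dR) ((arcCup h.symm).tensor (Diagram.id [b']))
      ((Diagram.id [b']).tensor (arcCap h))
    rw [h1, h2, one_smul] at e
    have l : (mk [b'] : KauffmanCat dL dR) ◁ ofDiagram (arcCap h) = _ :=
      ofDiagram_whiskerLeft [b'] (arcCap h)
    have r : ofDiagram (arcCup h.symm) ▷ (mk [b'] : KauffmanCat dL dR) = _ :=
      ofDiagram_whiskerRight (arcCup h.symm) [b']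
    have r1 : (λ_ (mk [b'] : KauffmanCat dL dR)).hom ≫ (ρ_ (mk [b'] : KauffmanCat dL dR)).inv =
      𝟙 (mk [b']) := Category.id_comp (𝟙 (mk [b']))
    exact (congrArg₂ (· ≫ ·) r ((Category.id_comp _).trans l)).trans (e.trans r1.symm)

theorem arc_loop {b b' : Bool} (h : b ≠ b') :
    (ofDiagram (arcCup h) : 𝟙_ (KauffmanCat dL dR) ⟶ _) ≫ ofDiagram (arcCap h) =
      Diagram.loopValue dL dR (some b) • 𝟙 _ := by
  obtain ⟨h1, h2⟩ := diagram_loop (dL := dL) (dR := dR) h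
  have e := ofDiagram_comp (dL := dL) (dR := dR) (arcCup h) (arcCap h)
  rw [h1, h2, ofDiagram_id] at e
  exact e

variable (dL dR) in
/-- The category of Kauffman diagrams itself, with the basic arcs. -/
abbrev model : ArcModel dL dR (KauffmanCat dL dR) where
  obj s := ⟨s⟩
  letter a := ⟨[a]⟩
  split _ _ := Iso.refl _
  ev h := ofDiagram (arcCap h)
  coev h := ofDiagram (arcCup h)
  rigid := arc_rigid
  loop := arc_loop

/-- In `model` the splitting isomorphisms are identities, as are the constraints that occur in
`cons`, `capFront` and `cupFront`. These operations therefore reduce to juxtaposition with vertical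
strings. -/
theorem model_cons (a : Bool) {s t : Word} (f : (model dL dR).obj s ⟶ (model dL dR).obj t) :
    (model dL dR).cons a f = (mk [a] : KauffmanCat dL dR) ◁ f :=
  (Category.id_comp _).trans (Category.comp_id _)

theorem model_capFront {b b' : Bool} (h : b ≠ b') (s : Word) :
    (model dL dR).capFront h s = ofDiagram ((arcCap h).tensor (Diagram.id s)) := by
  refine (Category.id_comp _).trans ((congrArg (· ≫ _) (whiskerLeft_id _ _)).trans ?_)
  exact (Category.id_comp _).trans ((Category.id_comp _).trans
    ((Category.comp_id _).trans (ofDiagram_whiskerRight (arcCap h) s)))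

theorem model_cupFront {b b' : Bool} (h : b ≠ b') (s : Word) :
    (model dL dR).cupFront h s = ofDiagram ((arcCup h).tensor (Diagram.id s)) := by
  refine (Category.id_comp _).trans ((congrArg (_ ≫ ·) ?_).trans
    ((Category.comp_id _).trans (ofDiagram_whiskerRight (arcCup h) s)))
  exact (Category.id_comp _).trans ((Category.comp_id _).trans (whiskerLeft_id _ _))

/-- The diagram that inserts an arc at a site. -/
def siteDiagram : {s t : Word} → Site s t → Diagram s t
  | _, _, .here h s => (arcCup h).tensor (Diagram.id s)
  | _, _, .there a i => (Diagram.id [a]).tensor (siteDiagram i)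

/-- The link between the algebra of models and the combinatorics: a cup is one diagram with
coefficient one, whose pairing can be written down. -/
theorem model_cup {s t : Word} (i : Site s t) : (model dL dR).cup i = ofDiagram (siteDiagram i) := by
  induction i with
  | here h s => exact model_cupFront h s
  | there a i ih =>
    rw [ArcModel.cup, ih]
    exact (model_cons a _).trans (ofDiagram_whiskerLeft [a] _)

end KauffmanCat
end

noncomputable section

open CategoryTheory MonoidalCategory KauffmanCat

variable {dL dR : ℂ}

/-! ### Inserting and removing an arc between neighbouring points. -/

/-- Skip the numbers `k` and `k + 1`. -/
def skip (k j : ℕ) : ℕ := if j < k then j else j + 2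

theorem skip_injective (k : ℕ) : Function.Injective (skip k) := by
  intro i j h
  unfold skip at h
  grind

theorem skip_zero (j : ℕ) : skip 0 j = j + 2 := by simp [skip]

theorem skip_succ_succ (k j : ℕ) : skip (k + 1) (j + 1) = skip k j + 1 := by
  unfold skip; grind

namespace Site

theorem idx_le {s t : Word} (i : Site s t) : i.idx ≤ s.length := by
  induction i with
  | here => simp [idx]
  | there a i ih => simpa [idx] using ih

theorem getElem?_skip {s t : Word} (i : Site s t) (j : ℕ) : t[skip i.idx j]? = s[j]? := by
  induction i generalizing j with
  | here h s => simp [idx, skip_zero]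
  | there a i ih =>
    rcases j with _ | j
    · simp [idx, skip]
    · simp [idx, skip_succ_succ, ih]

/-- Turns a position found by counting into an inductive site, so that the relations between sites
apply. -/
theorem exists_of_getElem? {t : Word} {k : ℕ} {b b' : Bool} (h : t[k]? = some b)
    (h' : t[k + 1]? = some b') (hb : b ≠ b') : ∃ (s : Word) (i : Site s t), i.idx = k := by
  induction k generalizing t with
  | zero =>
    rcases t with _ | ⟨c, _ | ⟨c', t⟩⟩
    · simp at h
    · simp at h'
    · obtain rfl : c = b := by simpa using h
      obtain rfl : c' = b' := by simpa using h'
      exact ⟨t, here hb t, rfl⟩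
  | succ k ih =>
    rcases t with _ | ⟨c, t⟩
    · simp at h
    · obtain ⟨s, i, hi⟩ := ih (t := t) (by simpa using h) (by simpa using h')
      exact ⟨c :: s, there c i, by simp [idx, hi]⟩

end Site

theorem siteDiagram_inl {s t : Word} (i : Site s t) {j : ℕ} (hj : j < s.length) :
    (siteDiagram i).partner (.inl j) = .inr (skip i.idx j) := by
  induction i generalizing j with
  | @here b b' h s =>
    change Diagram.shift 0 2 (Diagram.idPartner s.length (.inl j)) = _
    simp [Diagram.idPartner, hj, Site.idx, skip_zero, Diagram.shift]; omega
  | there a i ih =>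
    rcases j with _ | j
    · simp [Site.idx, skip]; rfl
    · change Diagram.shift 1 1 ((siteDiagram i).partner (.inl j)) = _
      rw [ih (by simpa using hj)]
      simp [Site.idx, skip_succ_succ, Diagram.shift]; omega

theorem siteDiagram_inr {s t : Word} (i : Site s t) :
    (siteDiagram i).partner (.inr i.idx) = .inr (i.idx + 1) := by
  induction i with
  | @here b b' h s => cases b <;> cases b' <;> first | exact absurd rfl h | rfl
  | there a i ih =>
    change Diagram.shift 1 1 ((siteDiagram i).partner (.inr i.idx)) = _
    rw [ih]
    simp [Site.idx, Diagram.shift]; omega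

/-- `skip` on the lower points. -/
def skipLower (k : ℕ) : Pt → Pt := Sum.map id (skip k)

theorem skipLower_injective (k : ℕ) : Function.Injective (skipLower k) :=
  Sum.map_injective.2 ⟨Function.injective_id, skip_injective k⟩

/-- Apart from the new arc, the lower diagram is the identity with its lower points renumbered. The
gluing thus mirrors that of `D` with the identity, for which `comp_id_aux` gives the result and the
weight, while the new arc is never touched. -/
theorem comp_siteDiagram {u s t : Word} (D : Diagram u s) (i : Site s t) :
    (∀ x, (D.comp (siteDiagram i)).partner (skipLower i.idx x) = skipLower i.idx (D.partner x)) ∧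
    (D.comp (siteDiagram i)).partner (.inr i.idx) = .inr (i.idx + 1) ∧
    D.weight dL dR (siteDiagram i) = 1 := by
  have hlen := i.length_eq
  have hidx := i.idx_le
  obtain ⟨c1, c2⟩ := Diagram.comp_id_aux dL dR D
  -- The renumbering intertwines the two stacks and fixes all gluing points, so it also intertwines
  -- the glued pairings and preserves the weight.
  have nat := glueAll_nat (e := Sum.map id (skipLower i.idx)) (S := Set.univ)
    (σ := D.stack (Diagram.id s)) (τ := D.stack (siteDiagram i)) (P := Diagram.upperMid)
    (Q := Diagram.lowerMid) (P' := Diagram.upperMid) (Q' := Diagram.lowerMid) (n := s.length)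
    (fun i => Diagram.loopValue dL dR s[i]?) (by simp)
    ((Sum.map_injective.2 ⟨Function.injective_id, skipLower_injective _⟩).injOn)
    (by
      rintro (x | j | j) -
      · rfl
      · by_cases hj : j < s.length
        · have : (Diagram.id s).partner (.inl j) = .inr j := if_pos hj
          simp [Diagram.stack, skipLower, siteDiagram_inl i hj, this]
        · have : (Diagram.id s).partner (.inl j) = .inl j := if_neg hj
          have h' := (siteDiagram i).isPlanarPairing.fixed (.inl j) (by simpa [flow] using hj)
          simp [Diagram.stack, skipLower, h', this]
      · by_cases hj : j < s.length
        · have : (Diagram.id s).partner (.inr j) = .inl j := if_pos hj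
          have h' := (siteDiagram i).isPlanarPairing.invol (.inl j)
          rw [siteDiagram_inl i hj] at h'
          simp [Diagram.stack, skipLower, h', this]
        · have : (Diagram.id s).partner (.inr j) = .inr j := if_neg hj
          have h' := (siteDiagram i).isPlanarPairing.fixed (.inr (skip i.idx j))
            (by simp [flow, i.getElem?_skip]; omega)
          simp [Diagram.stack, skipLower, h', this])
    (fun i _ => ⟨trivial, rfl⟩) (fun i _ => ⟨trivial, rfl⟩)
  refine ⟨fun x => ?_, ?_, ?_⟩
  · have e : ∀ y, Diagram.outer (skipLower i.idx y) =
        Sum.map id (skipLower i.idx) (Diagram.outer y) := by rintro (y | y) <;> rfl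
    have h1 := nat.1 (Diagram.outer x) trivial
    have h2 := D.glued_outer (Diagram.id s) x
    apply Diagram.outer_injective
    refine (D.glued_outer (siteDiagram i) _).symm.trans ?_
    rw [e, e]
    refine h1.trans ?_
    have h3 : Diagram.outer (D.partner x) =
      glueAll Diagram.upperMid Diagram.lowerMid s.length (D.stack (Diagram.id s))
        (Diagram.outer x) := by
      conv_lhs => rw [← c1]
      exact h2.symm
    rw [h3]
  · have hr := siteDiagram_inr i
    have hr' : (siteDiagram i).partner (.inr (i.idx + 1)) = .inr i.idx := by
      rw [← hr, (siteDiagram i).isPlanarPairing.invol]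
    -- The two ends of the new arc are partners of each other and lie off the gluing line.
    have away := glueAll_away (σ := D.stack (siteDiagram i))
      (S := {.inr (.inr i.idx), .inr (.inr (i.idx + 1))}) (P := Diagram.upperMid)
      (Q := Diagram.lowerMid) (n := s.length)
      (by rintro x (rfl | rfl) <;> simp [Diagram.stack, hr, hr'])
      (by simp [Diagram.upperMid, Diagram.lowerMid]) (.inr (.inr i.idx)) (Or.inl rfl)
    change Sum.elim id id (glueAll Diagram.upperMid Diagram.lowerMid s.length
      (D.stack (siteDiagram i)) (.inr (.inr i.idx))) = _
    rw [away]
    simp [Diagram.stack, hr]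
  · exact nat.2.2.trans c2

/-- A diagram without upper points has two neighbouring lower points joined by a string. -/
theorem exists_neighbours {t : Word} (D : Diagram [] t) (ht : t ≠ []) :
    ∃ k, k + 1 < t.length ∧ D.partner (.inr k) = .inr (k + 1) := by
  have low : ∀ j, ∃ k, D.partner (.inr j) = .inr k := by
    intro j
    by_cases hj : j < t.length
    · rcases D.partner_cases (.inr j) (by simp [flow, hj]) with ⟨i, hi, -⟩ | ⟨k, -, h⟩
      · simp at hi
      · exact ⟨k, h⟩
    · exact ⟨j, D.isPlanarPairing.fixed _ (by simp [flow]; omega)⟩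
  choose f hf using low
  have ne : ∀ j < t.length, f j ≠ j := by
    intro j hj h
    exact D.isPlanarPairing.ne (x := .inr j) (by simp [flow, hj]) (by rw [hf, h])
  have inv : ∀ j, f (f j) = j := by
    intro j
    have := D.isPlanarPairing.invol (.inr j)
    rw [hf, hf] at this
    simpa using this
  have out : ∀ j, t.length ≤ j → f j = j := by
    intro j hj
    have := D.isPlanarPairing.fixed (.inr j) (by simp [flow, hj])
    rw [hf] at this
    simpa using this
  have lt : ∀ j < t.length, f j < t.length := by
    intro j hj
    by_contra h
    have := out (f j) (by omega)
    rw [inv] at this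
    omega
  have planar : ∀ i j, i < j → j < f i → ¬ f i < f j := by
    intro i j h1 h2
    have := D.isPlanarPairing.planar (.inr i) (.inr j)
    rw [hf, hf] at this
    simpa [pos, h1, h2] using this
  have hpos : 0 < t.length := List.length_pos_iff.2 ht
  -- Right ends of strings exist: the partner of the leftmost point is one. The least right end will
  -- belong to an innermost string.
  have ex : ∃ j, j < t.length ∧ f j < j := by
    refine ⟨f 0, lt 0 hpos, ?_⟩
    have := ne 0 hpos
    rw [inv]
    omega
  obtain ⟨h1, h2⟩ := Nat.find_spec ex
  have hmin := fun m hm => Nat.find_min (H := ex) (m := m) hm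
  set j := Nat.find ex
  -- If there were points below this string, `f j + 1` would be one of them. By minimality of `j` it
  -- is not a right end, and planarity traps its string, whose right end would then be smaller than
  -- `j`.
  have hj : f j + 1 = j := by
    by_contra hne
    have a1 := hmin (f j + 1) (by omega)
    have a2 := planar (f j) (f j + 1) (by omega) (by rw [inv]; omega)
    rw [inv] at a2
    have a3 := ne (f j + 1) (by omega)
    have a4 : f (f j + 1) ≠ j := fun h => by
      have := inv (f j + 1)
      rw [h] at this
      omega
    have a5 := hmin (f (f j + 1)) (by omega)
    rw [inv] at a5
    omega
  refine ⟨f j, by omega, ?_⟩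
  rw [hf, inv, hj]

/-- A string between neighbours joins opposite letters, so its ends form a site. Removing it and
renumbering the other points leaves a smaller diagram, from which the string is recovered by
inserting an arc. -/
theorem exists_site {t : Word} (D : Diagram [] t) (ht : t ≠ []) :
    ∃ (s : Word) (i : Site s t) (E : Diagram [] s), D = E.comp (siteDiagram i) := by
  obtain ⟨k, hk, hD⟩ := exists_neighbours D ht
  obtain ⟨s, i, rfl⟩ : ∃ (s : Word) (i : Site s t), i.idx = k := by
    refine Site.exists_of_getElem? (List.getElem?_eq_getElem (by omega))
      (List.getElem?_eq_getElem hk) ?_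
    have := D.isPlanarPairing.orient (.inr k)
    rw [hD] at this
    simp only [flow, List.getElem?_eq_getElem hk,
      List.getElem?_eq_getElem (show k < t.length by omega)] at this
    intro h
    simp [← h] at this
  have hD' : D.partner (.inr (i.idx + 1)) = .inr i.idx := by
    rw [← hD, D.isPlanarPairing.invol]
  -- The two removed points are partners of each other, so no remaining point is joined to them.
  have hr : ∀ x, ∃ y, D.partner (skipLower i.idx x) = skipLower i.idx y := by
    intro x
    rcases h : D.partner (skipLower i.idx x) with j | j
    · exact ⟨.inl j, rfl⟩
    · by_cases h1 : j < i.idx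
      · exact ⟨.inr j, by simp [skipLower, skip, h1]⟩
      · refine ⟨.inr (j - 2), ?_⟩
        have n1 : j ≠ i.idx := by
          rintro rfl
          have := D.isPlanarPairing.invol (skipLower i.idx x)
          rw [h, hD] at this
          rcases x with x | x <;> simp [skipLower, skip] at this
          grind
        have n2 : j ≠ i.idx + 1 := by
          rintro rfl
          have := D.isPlanarPairing.invol (skipLower i.idx x)
          rw [h, hD'] at this
          rcases x with x | x <;> simp [skipLower, skip] at this
          grind
        simp [skipLower, skip]
        grind
  choose g hg using hr
  let E : Diagram [] s :=
    { partner := g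
      isPlanarPairing := D.isPlanarPairing.pullback (e := skipLower i.idx)
        (by rintro (x | x) (y | y) <;> simp [skipLower, pos, skip] <;> grind)
        (skipLower_injective _) hg
        (by rintro (x | x) <;> simp [skipLower, flow, i.getElem?_skip]) }
  -- The loop values are placeholders: the two parts that are kept do not involve them.
  obtain ⟨h1, h2, -⟩ := comp_siteDiagram (dL := 1) (dR := 1) E i
  refine ⟨s, i, E, Diagram.ext (funext fun x => ?_)⟩
  by_cases hx : ∃ y, x = skipLower i.idx y
  · obtain ⟨y, rfl⟩ := hx
    rw [hg, h1]
  · have : x = .inr i.idx ∨ x = .inr (i.idx + 1) := by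
      rcases x with x | x
      · exact absurd ⟨.inl x, rfl⟩ hx
      · by_contra hc
        simp at hc
        apply hx
        by_cases hlt : x < i.idx
        · exact ⟨.inr x, by simp [skipLower, skip, hlt]⟩
        · refine ⟨.inr (x - 2), ?_⟩
          simp [skipLower, skip]
          grind
    rcases this with rfl | rfl
    · rw [hD, h2]
    · rw [hD', ← h2, (E.comp _).isPlanarPairing.invol]

theorem ofDiagram_comp_cup {u s t : Word} (D : Diagram u s) (i : Site s t) :
    ofDiagram D ≫ (model dL dR).cup i = ofDiagram (D.comp (siteDiagram i)) := by
  have := ofDiagram_comp (dL := dL) (dR := dR) D (siteDiagram i)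
  rw [(comp_siteDiagram D i).2.2, one_smul] at this
  rw [model_cup]
  exact this

end

noncomputable section

open CategoryTheory MonoidalCategory KauffmanCat

theorem smul_hom_cancel {T : Type*} [Category* T] [Preadditive T] [Linear ℂ T] {x y : T} {r : ℂ} (hr : r ≠ 0) {f g : x ⟶ y} (h : r • f = r • g) : f = g := by
  have := congrArg (r⁻¹ • ·) h
  simpa [smul_smul, hr] using this

variable {dL dR : ℂ} {T : Type*} [Category* T] [Preadditive T] [Linear ℂ T] [MonoidalCategory T]

/-! ### Evaluation of diagrams without upper points. -/

namespace ArcModel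

variable (M : ArcModel dL dR T)

/-- `m` is the morphism obtained from some way to build up the diagram by inserting arcs. -/
inductive IsValue : ∀ {t : Word}, Diagram [] t → (M.obj [] ⟶ M.obj t) → Prop
  | nil : IsValue (Diagram.id []) (𝟙 _)
  | cup {s t : Word} (i : Site s t) {D : Diagram [] s} {m : M.obj [] ⟶ M.obj s} : IsValue D m →
      IsValue (D.comp (siteDiagram i)) (m ≫ M.cup i)

theorem diagram_nil_nil (D : Diagram [] []) : D = Diagram.id [] :=
  Diagram.ext (funext fun x => by
    have : flow [] [] x = none := by rcases x with x | x <;> rfl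
    rw [D.isPlanarPairing.fixed x this, (Diagram.id []).isPlanarPairing.fixed x this])

/-- Induction over the insertion of arcs. -/
theorem diagram_induction {P : ∀ {t : Word}, Diagram [] t → Prop} (nil : P (Diagram.id []))
    (comp : ∀ {s t : Word} (i : Site s t) (D : Diagram [] s), P D → P (D.comp (siteDiagram i)))
    {t : Word} (D : Diagram [] t) : P D := by
  induction hn : t.length using Nat.strong_induction_on generalizing t with
  | _ n ih =>
    by_cases ht : t = []
    · subst ht
      rw [diagram_nil_nil D]
      exact nil
    · obtain ⟨s, i, E, rfl⟩ := exists_site D ht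
      exact comp i E (ih s.length (by rw [← hn, i.length_eq]; omega) E rfl)

theorem exists_isValue {t : Word} (D : Diagram [] t) : ∃ m, M.IsValue D m :=
  diagram_induction (P := fun D => ∃ m, M.IsValue D m) ⟨_, .nil⟩
    (fun i _ ⟨_, hm⟩ => ⟨_, hm.cup i⟩) D

/-- The image of a diagram without upper points. -/
def value {t : Word} (D : Diagram [] t) : M.obj [] ⟶ M.obj t := (M.exists_isValue D).choose

theorem isValue_value {t : Word} (D : Diagram [] t) : M.IsValue D (M.value D) :=
  (M.exists_isValue D).choose_spec

/-- The linear extension of `value`. -/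
def eval (t : Word) :
    ((KauffmanCat.mk [] : KauffmanCat dL dR) ⟶ KauffmanCat.mk t) →ₗ[ℂ] (M.obj [] ⟶ M.obj t) :=
  (Finsupp.linearCombination ℂ M.value : (Diagram [] t →₀ ℂ) →ₗ[ℂ] (M.obj [] ⟶ M.obj t))

theorem eval_ofDiagram {t : Word} (D : Diagram [] t) : M.eval t (ofDiagram D) = M.value D :=
  (Finsupp.linearCombination_single ℂ 1 D).trans (one_smul _ _)

theorem IsValue.eq_id {M : ArcModel dL dR T} {D : Diagram [] []} {m : M.obj [] ⟶ M.obj []}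
    (h : M.IsValue D m) : m = 𝟙 _ := by
  cases h with
  | nil => rfl
  -- No pair of letters can be removed from the empty word.
  | cup i h => cases i

theorem IsValue.exists_site {M : ArcModel dL dR T} {t : Word} {D : Diagram [] t}
    {m : M.obj [] ⟶ M.obj t} (h : M.IsValue D m) (ht : t ≠ []) :
    ∃ (s : Word) (i : Site s t) (E : Diagram [] s) (n : M.obj [] ⟶ M.obj s),
      M.IsValue E n ∧ D = E.comp (siteDiagram i) ∧ m = n ≫ M.cup i := by
  cases h with
  | nil => exact absurd rfl ht
  | cup i h => exact ⟨_, i, _, _, h, rfl, rfl⟩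

/-- Uniqueness of values is assumed at the word `t` only. This lets the induction in
`isValue_unique` use the statement at shorter words before uniqueness is known in general. -/
theorem eval_cup_of_unique {s t : Word} (i : Site s t)
    (h : ∀ (D : Diagram [] t) (m : M.obj [] ⟶ M.obj t), M.IsValue D m → m = M.value D)
    (x : (KauffmanCat.mk [] : KauffmanCat dL dR) ⟶ KauffmanCat.mk s) :
    M.eval t (x ≫ (model dL dR).cup i) = M.eval s x ≫ M.cup i := by
  induction x using hom_induction with
  | zero => rw [Limits.zero_comp, map_zero, map_zero, Limits.zero_comp]
  | add f g hf hg => rw [Preadditive.add_comp, map_add, map_add, hf, hg, Preadditive.add_comp]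
  | smul r f hf => rw [Linear.smul_comp, map_smul, map_smul, hf, Linear.smul_comp]
  | diagram D =>
    rw [ofDiagram_comp_cup, eval_ofDiagram, eval_ofDiagram]
    exact (h _ _ ((M.isValue_value D).cup i)).symm

theorem loopValue_ne_zero (hL : dL ≠ 0) (hR : dR ≠ 0) (b : Bool) :
    Diagram.loopValue dL dR (some b) ≠ 0 := by
  cases b
  · exact hR
  · exact hL

theorem eval_id : M.eval [] (𝟙 _) = 𝟙 _ :=
  (M.eval_ofDiagram (Diagram.id [])).trans (M.isValue_value _).eq_id

/-- Induction on the length of the word, comparing the last arcs `i` and `j` of two constructions.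
Equal arcs cancel after capping off. Adjacent arcs cannot belong to one diagram. Disjoint arcs are
compared through a common remainder, on which the two cups commute. -/
theorem isValue_unique (hL : dL ≠ 0) (hR : dR ≠ 0) {t : Word} {D : Diagram [] t}
    {m m' : M.obj [] ⟶ M.obj t} (h : M.IsValue D m) (h' : M.IsValue D m') : m = m' := by
  induction hn : t.length using Nat.strong_induction_on generalizing t with
  | _ n ih =>
  by_cases ht : t = []
  · subst ht
    rw [h.eq_id, h'.eq_id]
  obtain ⟨s, i, D₁, m₁, hm₁, rfl, rfl⟩ := h.exists_site ht
  obtain ⟨s', j, D₂, m₂, hm₂, hD, rfl⟩ := h'.exists_site ht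
  have uniq : ∀ r : Word, r.length < n → ∀ (D : Diagram [] r) (m : M.obj [] ⟶ M.obj r),
      M.IsValue D m → m = M.value D := fun r hr D m hD => ih r.length hr hD (M.isValue_value D) rfl
  have hi := i.length_eq
  have hj := j.length_eq
  obtain rfl := uniq s (by omega) _ _ hm₁
  obtain rfl := uniq s' (by omega) _ _ hm₂
  have key : (ofDiagram D₁ : (KauffmanCat.mk [] : KauffmanCat dL dR) ⟶ _) ≫ (model dL dR).cup i =
      ofDiagram D₂ ≫ (model dL dR).cup j := by
    rw [ofDiagram_comp_cup, ofDiagram_comp_cup, hD]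
  have li := loopValue_ne_zero hL hR i.letter
  have lj := loopValue_ne_zero hL hR j.letter
  -- The middle one of the three points would have both of its neighbours as partner.
  have ne_adj : ∀ {s : Word} {i j : Site s t} {D₁ D₂ : Diagram [] s}, Site.Adjacent i j →
      D₁.comp (siteDiagram i) ≠ D₂.comp (siteDiagram j) := by
    intro s i j D₁ D₂ ha he
    have h1 := (comp_siteDiagram (dL := dL) (dR := dR) D₁ i).2.1
    have h2 := (comp_siteDiagram (dL := dL) (dR := dR) D₂ j).2.1
    rw [← he, ha.idx_eq, ← h1, (D₁.comp _).isPlanarPairing.invol] at h2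
    simp at h2
    omega
  cases i.position j with
  | refl =>
    have : (ofDiagram D₁ : (KauffmanCat.mk [] : KauffmanCat dL dR) ⟶ _) = ofDiagram D₂ := by
      have := congrArg (· ≫ (model dL dR).cap i) key
      simp only [Category.assoc, cup_cap, Linear.comp_smul] at this
      exact (Category.comp_id _).symm.trans ((smul_hom_cancel li this).trans (Category.comp_id _))
    rw [← M.eval_ofDiagram, ← M.eval_ofDiagram, this]
  | adjacent ha => exact absurd hD (ne_adj ha)
  | adjacent' ha => exact absurd hD.symm (ne_adj ha)
  | @disjoint r _ _ _ _ _ i' j' hd =>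
    -- `E` is the remainder without both arcs, up to a scalar. It need not be recognised as a
    -- multiple of a diagram: `h1` and `h2` follow from the relations in `model`, and `eval` is
    -- linear.
    set E := ofDiagram D₂ ≫ (model dL dR).cap i' with hE
    have h1 : Diagram.loopValue dL dR (some i.letter) • ofDiagram D₁ =
        E ≫ (model dL dR).cup j' := by
      have := congrArg (· ≫ (model dL dR).cap i) key
      simp only [Category.assoc, cup_cap, Linear.comp_smul, cup_cap_of_disjoint _ hd] at this
      rw [hE, Category.assoc, ← this]
      exact congrArg _ (Category.comp_id _).symm
    have h2 : Diagram.loopValue dL dR (some i.letter) • ofDiagram D₂ =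
        E ≫ (model dL dR).cup i' := by
      -- Adding the cup `i` to `h1` turns the left side into `D₂` with the cup `j`; the cap `j` then
      -- isolates `D₂`, at the cost of the loop value of `j`.
      have := congrArg (· ≫ (model dL dR).cup i) h1
      simp only [Category.assoc, Linear.smul_comp, key, cup_cup_of_disjoint _ hd] at this
      have := congrArg (· ≫ (model dL dR).cap j) this
      simp only [Category.assoc, Linear.smul_comp, Linear.comp_smul, cup_cap] at this
      rw [smul_comm] at this
      have := smul_hom_cancel lj this
      simpa only [Category.comp_id] using this
    have e1 := congrArg (M.eval _) h1
    have e2 := congrArg (M.eval _) h2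
    rw [M.eval_cup_of_unique j' (uniq _ (by omega)), map_smul, eval_ofDiagram] at e1
    rw [M.eval_cup_of_unique i' (uniq _ (by omega)), map_smul, eval_ofDiagram] at e2
    apply smul_hom_cancel li
    rw [← Linear.smul_comp, ← Linear.smul_comp, e1, e2, Category.assoc, Category.assoc,
      M.cup_cup_of_disjoint hd]

theorem eval_cup (hL : dL ≠ 0) (hR : dR ≠ 0) {s t : Word} (i : Site s t)
    (x : (KauffmanCat.mk [] : KauffmanCat dL dR) ⟶ KauffmanCat.mk s) :
    M.eval t (x ≫ (model dL dR).cup i) = M.eval s x ≫ M.cup i :=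
  M.eval_cup_of_unique i (fun D _ h => M.isValue_unique hL hR h (M.isValue_value D)) x

variable [MonoidalPreadditive T] [MonoidalLinear ℂ T]

/-- Induction on the number of arcs: the cap meets the last cup inserted. It closes a loop,
straightens a string, or passes to the smaller diagram above, by the same relation in `model` and in
`M`. -/
theorem eval_cap (hL : dL ≠ 0) (hR : dR ≠ 0) {s t : Word} (i : Site s t)
    (x : (KauffmanCat.mk [] : KauffmanCat dL dR) ⟶ KauffmanCat.mk t) :
    M.eval s (x ≫ (model dL dR).cap i) = M.eval t x ≫ M.cap i := by
  induction x using hom_induction with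
  | zero => rw [Limits.zero_comp, map_zero, map_zero, Limits.zero_comp]
  | add f g hf hg => rw [Preadditive.add_comp, map_add, map_add, hf, hg, Preadditive.add_comp]
  | smul r f hf => rw [Linear.smul_comp, map_smul, map_smul, hf, Linear.smul_comp]
  | diagram D =>
    induction D using diagram_induction generalizing s with
    | nil => cases i
    | comp j D ih =>
      rw [← ofDiagram_comp_cup, M.eval_cup hL hR, Category.assoc, Category.assoc]
      cases i.position j with
      | refl =>
        rw [cup_cap, cup_cap, Linear.comp_smul, Linear.comp_smul, map_smul, Category.comp_id]
        exact congrArg (_ • ·) (Category.comp_id _).symm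
      | adjacent ha =>
        rw [(cup_cap_of_adjacent _ ha).2, (cup_cap_of_adjacent _ ha).2, Category.comp_id]
        exact (Category.comp_id _).symm
      | adjacent' ha =>
        rw [(cup_cap_of_adjacent _ ha).1, (cup_cap_of_adjacent _ ha).1, Category.comp_id]
        exact (Category.comp_id _).symm
      | disjoint hd =>
        rw [cup_cap_of_disjoint _ hd, cup_cap_of_disjoint _ hd, ← Category.assoc, ← Category.assoc,
          M.eval_cup hL hR, ih]

end ArcModel
end

noncomputable section

open CategoryTheory MonoidalCategory KauffmanCat

variable {dL dR : ℂ} {T : Type*} [Category* T] [Preadditive T] [Linear ℂ T] [MonoidalCategory T]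

/-! ### Morphisms between arbitrary words. -/

namespace KauffmanCat

/-- Bend the first upper point of a morphism to the lower left. -/
def bend {a a' : Bool} (h : a' ≠ a) {u v : Word}
    (f : (KauffmanCat.mk (a :: u) : KauffmanCat dL dR) ⟶ KauffmanCat.mk v) :
    (KauffmanCat.mk u : KauffmanCat dL dR) ⟶ KauffmanCat.mk (a' :: v) :=
  (model dL dR).cupFront h u ≫ (model dL dR).cons a' f

/-- Bending back recovers the morphism by a zigzag. Read in another model, the left side is the
recursive definition of `map`. -/
theorem cons_bend_capFront {a a' : Bool} (h : a' ≠ a) {u v : Word}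
    (f : (KauffmanCat.mk (a :: u) : KauffmanCat dL dR) ⟶ KauffmanCat.mk v) :
    (model dL dR).cons a (bend h f) ≫ (model dL dR).capFront h.symm v = f := by
  rw [bend, ArcModel.cons_comp, Category.assoc, ArcModel.capFront_naturality,
    reassoc_of% (model dL dR).zigzag h.symm h u]

theorem bend_comp {a a' : Bool} (h : a' ≠ a) {u v w : Word}
    (f : (KauffmanCat.mk (a :: u) : KauffmanCat dL dR) ⟶ KauffmanCat.mk v)
    (g : (KauffmanCat.mk v : KauffmanCat dL dR) ⟶ KauffmanCat.mk w) :
    bend h (f ≫ g) = bend h f ≫ (model dL dR).cons a' g := by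
  rw [bend, ArcModel.cons_comp, bend, Category.assoc]

theorem bend_add {a a' : Bool} (h : a' ≠ a) {u v : Word}
    (f g : (KauffmanCat.mk (a :: u) : KauffmanCat dL dR) ⟶ KauffmanCat.mk v) :
    bend h (f + g) = bend h f + bend h g :=
  (congrArg _ ((model dL dR).cons_add a' f g)).trans (Preadditive.comp_add _ _ _ _ _ _)

theorem bend_smul {a a' : Bool} (h : a' ≠ a) {u v : Word} (r : ℂ)
    (f : (KauffmanCat.mk (a :: u) : KauffmanCat dL dR) ⟶ KauffmanCat.mk v) :
    bend h (r • f) = r • bend h f :=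
  (congrArg _ ((model dL dR).cons_smul a' r f)).trans (Linear.comp_smul _ _ _ _ _ _)

/-- The morphisms built up by linear combinations, and by cups and caps on the lower side. -/
inductive Generated (u : Word) :
    ∀ {v : Word}, ((KauffmanCat.mk u : KauffmanCat dL dR) ⟶ KauffmanCat.mk v) → Prop
  | id : Generated u (𝟙 _)
  | zero (v : Word) : Generated u (0 : KauffmanCat.mk u ⟶ KauffmanCat.mk v)
  | add {v : Word} {f g : (KauffmanCat.mk u : KauffmanCat dL dR) ⟶ KauffmanCat.mk v} :
      Generated u f → Generated u g → Generated u (f + g)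
  | smul (r : ℂ) {v : Word} {f : (KauffmanCat.mk u : KauffmanCat dL dR) ⟶ KauffmanCat.mk v} :
      Generated u f → Generated u (r • f)
  | cup {v w : Word} {f : (KauffmanCat.mk u : KauffmanCat dL dR) ⟶ KauffmanCat.mk v}
      (i : Site v w) : Generated u f → Generated u (f ≫ (model dL dR).cup i)
  | cap {v w : Word} {f : (KauffmanCat.mk u : KauffmanCat dL dR) ⟶ KauffmanCat.mk v}
      (i : Site w v) : Generated u f → Generated u (f ≫ (model dL dR).cap i)

theorem Generated.cons (a : Bool) {u v : Word}
    {f : (KauffmanCat.mk u : KauffmanCat dL dR) ⟶ KauffmanCat.mk v} (h : Generated u f) :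
    Generated (a :: u) ((model dL dR).cons a f) := by
  induction h with
  | id => rw [ArcModel.cons_id]; exact .id
  | zero v => rw [ArcModel.cons_zero]; exact .zero _
  | add _ _ hf hg => rw [ArcModel.cons_add]; exact hf.add hg
  | smul r _ hf => rw [ArcModel.cons_smul]; exact hf.smul r
  | cup i _ hf => rw [ArcModel.cons_comp]; exact hf.cup (i.there a)
  | cap i _ hf => rw [ArcModel.cons_comp]; exact hf.cap (i.there a)

/-- Without upper points a diagram is a composite of cups. Otherwise bending removes an upper
letter, and bending back adds only a vertical string and a cap at the bottom. -/
theorem generated {u v : Word} (f : (KauffmanCat.mk u : KauffmanCat dL dR) ⟶ KauffmanCat.mk v) :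
    Generated u f := by
  induction u generalizing v with
  | nil =>
    induction f using hom_induction with
    | zero => exact .zero _
    | add f g hf hg => exact hf.add hg
    | smul r f hf => exact hf.smul r
    | diagram D =>
      induction D using ArcModel.diagram_induction with
      | nil => exact .id
      | comp i D ih => rw [← ofDiagram_comp_cup]; exact ih.cup i
  | cons a u ih =>
    rw [← cons_bend_capFront (Bool.not_ne_self a) f]
    exact ((ih (bend (Bool.not_ne_self a) f)).cons a).cap
      (.here (Bool.not_ne_self a).symm v)

end KauffmanCat

namespace ArcModel

variable [MonoidalPreadditive T] [MonoidalLinear ℂ T] (M : ArcModel dL dR T)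

/-- The images of the morphisms of the category of Kauffman diagrams. -/
def map : ∀ (u : Word) {v : Word},
    ((KauffmanCat.mk u : KauffmanCat dL dR) ⟶ KauffmanCat.mk v) → (M.obj u ⟶ M.obj v)
  | [], v, f => M.eval v f
  -- The formula of `cons_bend_capFront`, carried out in `M`.
  | a :: u, v, f => M.cons a (map u (bend (Bool.not_ne_self a) f)) ≫
      M.capFront (Bool.not_ne_self a).symm v

theorem map_add (u : Word) {v : Word}
    (f g : (KauffmanCat.mk u : KauffmanCat dL dR) ⟶ KauffmanCat.mk v) :
    M.map u (f + g) = M.map u f + M.map u g := by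
  induction u generalizing v with
  | nil => exact _root_.map_add _ f g
  | cons a u ih => simp only [map, bend_add, cons_add, ih, Preadditive.add_comp]

theorem map_smul (u : Word) {v : Word} (r : ℂ)
    (f : (KauffmanCat.mk u : KauffmanCat dL dR) ⟶ KauffmanCat.mk v) :
    M.map u (r • f) = r • M.map u f := by
  induction u generalizing v with
  | nil => exact _root_.map_smul _ r f
  | cons a u ih => simp only [map, bend_smul, cons_smul, ih, Linear.smul_comp]

theorem map_zero (u v : Word) :
    M.map u (0 : (KauffmanCat.mk u : KauffmanCat dL dR) ⟶ KauffmanCat.mk v) = 0 := by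
  simpa using M.map_smul u 0 (0 : (KauffmanCat.mk u : KauffmanCat dL dR) ⟶ KauffmanCat.mk v)

/-- Bending happens at the left edge and commutes with attaching an arc below. This reduces the
claim to `eval_cup`; `map_comp_cap` reduces to `eval_cap` in the same way. -/
theorem map_comp_cup (hL : dL ≠ 0) (hR : dR ≠ 0) (u : Word) {v w : Word}
    (f : (KauffmanCat.mk u : KauffmanCat dL dR) ⟶ KauffmanCat.mk v) (i : Site v w) :
    M.map u (f ≫ (model dL dR).cup i) = M.map u f ≫ M.cup i := by
  induction u generalizing v w with
  | nil => exact M.eval_cup hL hR i f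
  | cons a u ih =>
    -- The bent morphism has the additional lower letter `!a` on the left, so the site moves one
    -- place to the right.
    have := ih (bend (Bool.not_ne_self a) f) (i.there (!a))
    simp only [cup] at this
    rw [map, bend_comp, this, cons_comp, Category.assoc, capFront_naturality, ← Category.assoc]
    rfl

theorem map_comp_cap (hL : dL ≠ 0) (hR : dR ≠ 0) (u : Word) {v w : Word}
    (f : (KauffmanCat.mk u : KauffmanCat dL dR) ⟶ KauffmanCat.mk v) (i : Site w v) :
    M.map u (f ≫ (model dL dR).cap i) = M.map u f ≫ M.cap i := by
  induction u generalizing v w with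
  | nil => exact M.eval_cap hL hR i f
  | cons a u ih =>
    have := ih (bend (Bool.not_ne_self a) f) (i.there (!a))
    simp only [cap] at this
    rw [map, bend_comp, this, cons_comp, Category.assoc, capFront_naturality, ← Category.assoc]
    rfl

/-- A bent identity is the cup at the front of the word, and bending back in `M` gives a zigzag. -/
theorem map_id (hL : dL ≠ 0) (hR : dR ≠ 0) (u : Word) : M.map u (𝟙 _) = 𝟙 _ := by
  induction u with
  | nil => exact M.eval_id
  | cons a u ih =>
    have := M.map_comp_cup hL hR u (𝟙 _) (.here (Bool.not_ne_self a) u)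
    rw [ih, Category.id_comp] at this
    have e : bend (Bool.not_ne_self a) (𝟙 (KauffmanCat.mk (a :: u) : KauffmanCat dL dR)) =
        (model dL dR).cup (.here (Bool.not_ne_self a) u) :=
      (congrArg _ ((model dL dR).cons_id _ _)).trans (Category.comp_id _)
    rw [map, e, this, Category.id_comp]
    exact M.zigzag _ _ _

theorem map_comp (hL : dL ≠ 0) (hR : dR ≠ 0) (u : Word) {v w : Word}
    (f : (KauffmanCat.mk u : KauffmanCat dL dR) ⟶ KauffmanCat.mk v)
    (g : (KauffmanCat.mk v : KauffmanCat dL dR) ⟶ KauffmanCat.mk w) :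
    M.map u (f ≫ g) = M.map u f ≫ M.map v g := by
  induction generated g with
  | id => rw [M.map_id hL hR, Category.comp_id, Category.comp_id]
  | zero v => rw [Limits.comp_zero, map_zero, map_zero, Limits.comp_zero]
  | add _ _ hf hg =>
    rw [Preadditive.comp_add, map_add, map_add, hf, hg, Preadditive.comp_add]
  | smul r _ hf => rw [Linear.comp_smul, map_smul, map_smul, hf, Linear.comp_smul]
  | cup i _ hf =>
    rw [← Category.assoc, M.map_comp_cup hL hR, M.map_comp_cup hL hR, hf, Category.assoc]
  | cap i _ hf =>
    rw [← Category.assoc, M.map_comp_cap hL hR, M.map_comp_cap hL hR, hf, Category.assoc]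

theorem map_cup (hL : dL ≠ 0) (hR : dR ≠ 0) {u v : Word} (i : Site u v) :
    M.map u ((model dL dR).cup i) = M.cup i := by
  have := M.map_comp_cup hL hR u (𝟙 _) i
  rw [M.map_id hL hR, Category.id_comp] at this
  exact this.trans (Category.id_comp _)

theorem map_cap (hL : dL ≠ 0) (hR : dR ≠ 0) {u v : Word} (i : Site u v) :
    M.map v ((model dL dR).cap i) = M.cap i := by
  have := M.map_comp_cap hL hR v (𝟙 _) i
  rw [M.map_id hL hR, Category.id_comp] at this
  exact this.trans (Category.id_comp _)

/-- The source of compatibility with left tensoring. It holds on generators because `cons` shifts a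
site by one letter in both models. -/
theorem map_cons (hL : dL ≠ 0) (hR : dR ≠ 0) (a : Bool) {u v : Word}
    (f : (KauffmanCat.mk u : KauffmanCat dL dR) ⟶ KauffmanCat.mk v) :
    M.map (a :: u) ((model dL dR).cons a f) = M.cons a (M.map u f) := by
  induction generated f with
  | id => rw [cons_id, M.map_id hL hR, M.map_id hL hR, cons_id]
  | zero v => rw [cons_zero, map_zero, map_zero, cons_zero]
  | add _ _ hf hg => rw [cons_add, map_add, map_add, hf, hg, cons_add]
  | smul r _ hf => rw [cons_smul, map_smul, map_smul, hf, cons_smul]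
  | cup i _ hf =>
    rw [cons_comp, M.map_comp hL hR, M.map_comp hL hR, hf, M.map_cup hL hR, cons_comp]
    exact congrArg _ (M.map_cup hL hR (i.there a))
  | cap i _ hf =>
    rw [cons_comp, M.map_comp hL hR, M.map_comp hL hR, hf, M.map_cap hL hR, cons_comp]
    exact congrArg _ (M.map_cap hL hR (i.there a))

/-- The functor from the category of Kauffman diagrams given by an `ArcModel`. -/
def functor (hL : dL ≠ 0) (hR : dR ≠ 0) : KauffmanCat dL dR ⥤ T where
  obj X := M.obj X.word
  map {X _} f := M.map X.word f
  map_id X := M.map_id hL hR X.word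
  map_comp {X _ _} f g := M.map_comp hL hR X.word f g

end ArcModel
end

noncomputable section

open CategoryTheory MonoidalCategory KauffmanCat

variable {dL dR : ℂ} {T : Type*} [Category* T] [Preadditive T] [Linear ℂ T] [MonoidalCategory T]

/-! ### Compatibility with tensor products. -/

/-- Append letters to the right of a site. -/
def Site.append (w : Word) : {s t : Word} → Site s t → Site (s ++ w) (t ++ w)
  | _, _, .here h s => .here h (s ++ w)
  | _, _, .there a i => .there a (i.append w)

namespace ArcModel

section tensorIso
variable (M : ArcModel dL dR T) (υ : M.obj [] ≅ 𝟙_ T)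

/-- The concatenation of words is sent to the tensor product. -/
def tensorIso : ∀ u v : Word, M.obj u ⊗ M.obj v ≅ M.obj (u ++ v)
  | [], v => whiskerRightIso υ (M.obj v) ≪≫ λ_ (M.obj v)
  | a :: u, v => whiskerRightIso (M.split a u) (M.obj v) ≪≫ α_ _ _ _ ≪≫
      whiskerLeftIso (M.letter a) (tensorIso u v) ≪≫ (M.split a (u ++ v)).symm

theorem tensorIso_nil_hom (v : Word) :
    (M.tensorIso υ [] v).hom = υ.hom ▷ M.obj v ≫ (λ_ (M.obj v)).hom := rfl

theorem tensorIso_cons_hom (a : Bool) (u v : Word) :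
    (M.tensorIso υ (a :: u) v).hom = (M.split a u).hom ▷ M.obj v ≫ (α_ _ _ _).hom ≫
      M.letter a ◁ (M.tensorIso υ u v).hom ≫ (M.split a (u ++ v)).inv := rfl

/-- The inductive step over letters on the left, for an arbitrary square. This one step serves both
cups and caps; `associator_cons` and `rightUnitor_cons` play the same role for the coherence axioms.
-/
theorem cons_whiskerRight (a : Bool) {s t : Word} (f : M.obj s ⟶ M.obj t) (w : Word)
    (g : M.obj (s ++ w) ⟶ M.obj (t ++ w))
    (h : f ▷ M.obj w ≫ (M.tensorIso υ t w).hom = (M.tensorIso υ s w).hom ≫ g) :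
    M.cons a f ▷ M.obj w ≫ (M.tensorIso υ (a :: t) w).hom =
      (M.tensorIso υ (a :: s) w).hom ≫ M.cons (s := s ++ w) (t := t ++ w) a g := by
  have h' := congrArg (M.letter a ◁ ·) h
  simp only [whiskerLeft_comp] at h'
  simp only [tensorIso_cons_hom, cons, comp_whiskerRight, Category.assoc, inv_hom_whiskerRight_assoc,
    associator_naturality_middle_assoc, Iso.inv_hom_id_assoc]
  rw [reassoc_of% h']

theorem associator_cons (a : Bool) (u v w : Word)
    (g : M.obj ((u ++ v) ++ w) ⟶ M.obj (u ++ (v ++ w)))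
    (h : (M.tensorIso υ u v).hom ▷ M.obj w ≫ (M.tensorIso υ (u ++ v) w).hom ≫ g =
      (α_ _ _ _).hom ≫ M.obj u ◁ (M.tensorIso υ v w).hom ≫ (M.tensorIso υ u (v ++ w)).hom) :
    (M.tensorIso υ (a :: u) v).hom ▷ M.obj w ≫ (M.tensorIso υ (a :: (u ++ v)) w).hom ≫
        M.cons (s := (u ++ v) ++ w) (t := u ++ (v ++ w)) a g =
      (α_ _ _ _).hom ≫ M.obj (a :: u) ◁ (M.tensorIso υ v w).hom ≫
        (M.tensorIso υ (a :: u) (v ++ w)).hom := by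
  have h' := congrArg (M.letter a ◁ ·) h
  simp only [whiskerLeft_comp] at h'
  simp only [tensorIso_cons_hom, cons, comp_whiskerRight, Category.assoc,
    inv_hom_whiskerRight_assoc, Iso.inv_hom_id_assoc, associator_naturality_middle_assoc]
  rw [reassoc_of% h', whisker_exchange_assoc]
  simp

theorem rightUnitor_cons (a : Bool) (u : Word) (g : M.obj (u ++ []) ⟶ M.obj u)
    (h : (ρ_ (M.obj u)).hom = M.obj u ◁ υ.inv ≫ (M.tensorIso υ u []).hom ≫ g) :
    (ρ_ (M.obj (a :: u))).hom = M.obj (a :: u) ◁ υ.inv ≫ (M.tensorIso υ (a :: u) []).hom ≫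
      M.cons (s := u ++ []) (t := u) a g := by
  have h' := congrArg (M.letter a ◁ ·) h
  simp only [whiskerLeft_comp] at h'
  simp only [tensorIso_cons_hom, cons, Category.assoc, Iso.inv_hom_id_assoc]
  rw [whisker_exchange_assoc, tensor_whiskerLeft_assoc, Iso.inv_hom_id_assoc, ← reassoc_of% h']
  simp

theorem cup_whiskerRight {s t : Word} (i : Site s t) (w : Word) :
    M.cup i ▷ M.obj w ≫ (M.tensorIso υ t w).hom =
      (M.tensorIso υ s w).hom ≫ M.cup (i.append w) := by
  induction i with
  | here h s =>
    change M.cupFront h s ▷ M.obj w ≫ _ = _ ≫ M.cupFront h (s ++ w)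
    have k := copairing_naturality (M.coev h) (M.tensorIso υ s w).hom
    simp only [tensorIso_cons_hom, cupFront]
    rw [← reassoc_of% k]
    simp
  | there a i ih => exact M.cons_whiskerRight υ a _ w _ ih

theorem cap_whiskerRight {s t : Word} (i : Site s t) (w : Word) :
    M.cap i ▷ M.obj w ≫ (M.tensorIso υ s w).hom =
      (M.tensorIso υ t w).hom ≫ M.cap (i.append w) := by
  induction i with
  | here h s =>
    change M.capFront h s ▷ M.obj w ≫ _ = _ ≫ M.capFront h (s ++ w)
    have k := pairing_naturality (M.ev h) (M.tensorIso υ s w).hom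
    simp only [tensorIso_cons_hom, capFront]
    simp [k]
  | there a i ih => exact M.cons_whiskerRight υ a _ w _ ih

end tensorIso
end ArcModel

namespace KauffmanCat

/-- The general whiskering lemmas thereby specialise to equalities in the diagram category, without
a further computation with pairings. -/
theorem model_tensorIso (u v : Word) :
    ((model dL dR).tensorIso (Iso.refl _) u v).hom = 𝟙 (KauffmanCat.mk (u ++ v)) := by
  induction u with
  | nil =>
    rw [ArcModel.tensorIso_nil_hom]
    exact (congrArg (· ≫ _) (id_whiskerRight _ _)).trans (Category.id_comp _)
  | cons a u ih =>
    rw [ArcModel.tensorIso_cons_hom, ih]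
    refine (congrArg (· ≫ _) (id_whiskerRight _ _)).trans ((Category.id_comp _).trans ?_)
    refine (Category.id_comp _).trans ((Category.comp_id _).trans (whiskerLeft_id _ _))

theorem cup_whiskerRight {s t : Word} (i : Site s t) (w : Word) :
    (model dL dR).cup i ▷ KauffmanCat.mk w = (model dL dR).cup (i.append w) := by
  have := (model dL dR).cup_whiskerRight (Iso.refl _) i w
  rw [model_tensorIso, model_tensorIso] at this
  exact (Category.comp_id _).symm.trans (this.trans (Category.id_comp _))

theorem cap_whiskerRight {s t : Word} (i : Site s t) (w : Word) :
    (model dL dR).cap i ▷ KauffmanCat.mk w = (model dL dR).cap (i.append w) := by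
  have := (model dL dR).cap_whiskerRight (Iso.refl _) i w
  rw [model_tensorIso, model_tensorIso] at this
  exact (Category.comp_id _).symm.trans (this.trans (Category.id_comp _))

theorem nil_whiskerLeft {u v : Word}
    (f : (KauffmanCat.mk u : KauffmanCat dL dR) ⟶ KauffmanCat.mk v) :
    (KauffmanCat.mk [] : KauffmanCat dL dR) ◁ f = f := id_nil_linTensor f

theorem cons_whiskerLeft (a : Bool) (w : Word) {u v : Word}
    (f : (KauffmanCat.mk u : KauffmanCat dL dR) ⟶ KauffmanCat.mk v) :
    (KauffmanCat.mk (a :: w) : KauffmanCat dL dR) ◁ f =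
      (model dL dR).cons a ((KauffmanCat.mk w : KauffmanCat dL dR) ◁ f) := by
  rw [model_cons]
  refine (tensor_whiskerLeft (KauffmanCat.mk [a] : KauffmanCat dL dR) (KauffmanCat.mk w) f).trans ?_
  exact (Category.id_comp _).trans (Category.comp_id _)

theorem cons_eqToHom (a : Bool) {u v : Word} (h : u = v) :
    (model dL dR).cons a (eqToHom (congrArg KauffmanCat.mk h)) =
      eqToHom (congrArg (fun s => KauffmanCat.mk (a :: s)) h) := by
  subst h
  exact (model dL dR).cons_id a u

/-- Lets the image of the associator be computed letter by letter with `map_cons`. -/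
theorem associator_cons (a : Bool) (u v w : Word) :
    (α_ (KauffmanCat.mk (a :: u) : KauffmanCat dL dR) (KauffmanCat.mk v) (KauffmanCat.mk w)).hom =
      (model dL dR).cons a (α_ (KauffmanCat.mk u) (KauffmanCat.mk v) (KauffmanCat.mk w)).hom :=
  (cons_eqToHom a (List.append_assoc u v w)).symm

theorem rightUnitor_cons (a : Bool) (u : Word) :
    (ρ_ (KauffmanCat.mk (a :: u) : KauffmanCat dL dR)).hom =
      (model dL dR).cons a (ρ_ (KauffmanCat.mk u)).hom :=
  (cons_eqToHom a (List.append_nil u)).symm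

end KauffmanCat

namespace ArcModel

variable [MonoidalPreadditive T] [MonoidalLinear ℂ T] (M : ArcModel dL dR T)
  (υ : M.obj [] ≅ 𝟙_ T) (hL : dL ≠ 0) (hR : dR ≠ 0)

include hL hR in
-- Appending letters on the right turns a generating cup or cap into the one at the same site of the
-- longer word, so checking generators suffices.
theorem map_whiskerRight {u v : Word}
    (f : (KauffmanCat.mk u : KauffmanCat dL dR) ⟶ KauffmanCat.mk v) (w : Word) :
    M.map u f ▷ M.obj w ≫ (M.tensorIso υ v w).hom =
      (M.tensorIso υ u w).hom ≫ M.map (u ++ w) (f ▷ KauffmanCat.mk w) := by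
  induction generated f with
  | id =>
    rw [M.map_id hL hR, id_whiskerRight, id_whiskerRight, Category.id_comp]
    exact ((congrArg _ (M.map_id hL hR (u ++ w))).trans (Category.comp_id _)).symm
  | zero v =>
    rw [map_zero, MonoidalPreadditive.zero_whiskerRight, MonoidalPreadditive.zero_whiskerRight,
      Limits.zero_comp]
    exact ((congrArg _ (M.map_zero (u ++ w) _)).trans Limits.comp_zero).symm
  | add _ _ hf hg =>
    rw [map_add, MonoidalPreadditive.add_whiskerRight, MonoidalPreadditive.add_whiskerRight,
      Preadditive.add_comp, hf, hg, ← Preadditive.comp_add]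
    exact congrArg _ (M.map_add (u ++ w) _ _).symm
  | smul r _ hf =>
    rw [map_smul, MonoidalLinear.smul_whiskerRight, MonoidalLinear.smul_whiskerRight,
      Linear.smul_comp, hf, ← Linear.comp_smul]
    exact congrArg _ (M.map_smul (u ++ w) _ _).symm
  | cup i _ hf =>
    rw [comp_whiskerRight, KauffmanCat.cup_whiskerRight, M.map_comp_cup hL hR, comp_whiskerRight,
      Category.assoc, M.cup_whiskerRight υ, reassoc_of% hf]
    exact congrArg _ (M.map_comp_cup hL hR (u ++ w) _ _).symm
  | cap i _ hf =>
    rw [comp_whiskerRight, KauffmanCat.cap_whiskerRight, M.map_comp_cap hL hR, comp_whiskerRight,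
      Category.assoc, M.cap_whiskerRight υ, reassoc_of% hf]
    exact congrArg _ (M.map_comp_cap hL hR (u ++ w) _ _).symm

include hL hR in
-- Here the induction runs over the letters of `w`, because `map_cons` already treats arbitrary
-- morphisms.
theorem map_whiskerLeft (w : Word) {u v : Word}
    (f : (KauffmanCat.mk u : KauffmanCat dL dR) ⟶ KauffmanCat.mk v) :
    M.obj w ◁ M.map u f ≫ (M.tensorIso υ w v).hom =
      (M.tensorIso υ w u).hom ≫ M.map (w ++ u) (KauffmanCat.mk w ◁ f) := by
  induction w with
  | nil =>
    rw [tensorIso_nil_hom, tensorIso_nil_hom, nil_whiskerLeft]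
    simp [whisker_exchange_assoc]
  | cons a w ih =>
    have ih' := congrArg (M.letter a ◁ ·) ih
    simp only [whiskerLeft_comp] at ih'
    have e := M.map_cons hL hR a (KauffmanCat.mk w ◁ f)
    rw [cons_whiskerLeft]
    refine Eq.trans ?_ (congrArg _ e.symm)
    simp only [tensorIso_cons_hom, cons, Category.assoc, Iso.inv_hom_id_assoc]
    rw [whisker_exchange_assoc, tensor_whiskerLeft_assoc, Iso.inv_hom_id_assoc, reassoc_of% ih']

include hL hR in
theorem map_associator (u v w : Word) :
    (M.tensorIso υ u v).hom ▷ M.obj w ≫ (M.tensorIso υ (u ++ v) w).hom ≫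
      M.map ((u ++ v) ++ w) (α_ (KauffmanCat.mk u) (KauffmanCat.mk v) (KauffmanCat.mk w)).hom =
    (α_ _ _ _).hom ≫ M.obj u ◁ (M.tensorIso υ v w).hom ≫ (M.tensorIso υ u (v ++ w)).hom := by
  induction u with
  | nil =>
    have e : M.map (v ++ w) (𝟙 (KauffmanCat.mk (v ++ w))) = _ := M.map_id hL hR _
    refine (congrArg (_ ≫ _ ≫ ·) e).trans ?_
    simp only [tensorIso_nil_hom]
    simp [whisker_exchange_assoc]
  | cons a u ih =>
    have e := M.map_cons hL hR a (α_ (KauffmanCat.mk u) (KauffmanCat.mk v) (KauffmanCat.mk w)).hom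
    rw [KauffmanCat.associator_cons]
    refine (congrArg (_ ≫ _ ≫ ·) e).trans ?_
    exact M.associator_cons υ a u v w _ ih

include hL hR in
theorem map_rightUnitor (u : Word) :
    (ρ_ (M.obj u)).hom = M.obj u ◁ υ.inv ≫ (M.tensorIso υ u []).hom ≫
      M.map (u ++ []) (ρ_ (KauffmanCat.mk u)).hom := by
  induction u with
  | nil =>
    have e : M.map [] (𝟙 (KauffmanCat.mk [])) = _ := M.map_id hL hR _
    refine Eq.trans ?_ (congrArg (_ ≫ _ ≫ ·) e.symm)
    simp [tensorIso_nil_hom, whisker_exchange_assoc, unitors_equal]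
  | cons a u ih =>
    have e := M.map_cons hL hR a (ρ_ (KauffmanCat.mk u)).hom
    rw [KauffmanCat.rightUnitor_cons]
    refine Eq.trans ?_ (congrArg (_ ≫ _ ≫ ·) e.symm)
    exact M.rightUnitor_cons υ a u _ ih

/-- The monoidal structure of `ArcModel.functor`. -/
def coreMonoidal : (M.functor hL hR).CoreMonoidal where
  εIso := υ.symm
  μIso X Y := M.tensorIso υ X.word Y.word
  μIso_hom_natural_left f X := M.map_whiskerRight υ hL hR f X.word
  μIso_hom_natural_right X f := M.map_whiskerLeft υ hL hR X.word f
  associativity X Y Z := M.map_associator υ hL hR X.word Y.word Z.word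
  left_unitality X := by
    have e : M.map X.word (𝟙 (KauffmanCat.mk X.word)) = _ := M.map_id hL hR _
    refine Eq.trans ?_ (congrArg (_ ≫ _ ≫ ·) e.symm)
    change (λ_ (M.obj X.word)).hom = υ.inv ▷ M.obj X.word ≫ (M.tensorIso υ [] X.word).hom ≫ 𝟙 _
    simp [tensorIso_nil_hom]
  right_unitality X := M.map_rightUnitor υ hL hR X.word

end ArcModel
end

noncomputable section

open CategoryTheory MonoidalCategory KauffmanCat

/-! ### The functor given by two rigidity pairings. -/

/-- The morphism is the identity, up to an equality of objects. -/
def IsEqToHom {T : Type*} [Category* T] {A B : T} (f : A ⟶ B) : Prop := ∃ h : A = B, f = eqToHom h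

namespace IsEqToHom

variable {T : Type*} [Category* T]

theorem id (A : T) : IsEqToHom (𝟙 A) := ⟨rfl, rfl⟩

theorem comp {A B C : T} {f : A ⟶ B} {g : B ⟶ C} (hf : IsEqToHom f) (hg : IsEqToHom g) :
    IsEqToHom (f ≫ g) := by
  obtain ⟨rfl, rfl⟩ := hf
  obtain ⟨rfl, rfl⟩ := hg
  exact ⟨rfl, by simp⟩

theorem inv {A B : T} {f : A ≅ B} (hf : IsEqToHom f.hom) : IsEqToHom f.inv := by
  obtain ⟨rfl, h⟩ := hf
  exact ⟨rfl, by rw [Iso.inv_eq_inv f (Iso.refl _) |>.2 h]; rfl⟩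

theorem of_inverse {A B : T} {f : A ⟶ B} {g : B ⟶ A} (hf : IsEqToHom f) (h : f ≫ g = 𝟙 A) :
    IsEqToHom g := by
  obtain ⟨rfl, rfl⟩ := hf
  exact ⟨rfl, by simpa using h⟩

variable [MonoidalCategory T]

theorem whiskerLeft (A : T) {B C : T} {f : B ⟶ C} (hf : IsEqToHom f) : IsEqToHom (A ◁ f) := by
  obtain ⟨rfl, rfl⟩ := hf
  exact ⟨rfl, by simp⟩

theorem whiskerRight {B C : T} {f : B ⟶ C} (hf : IsEqToHom f) (A : T) : IsEqToHom (f ▷ A) := by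
  obtain ⟨rfl, rfl⟩ := hf
  exact ⟨rfl, by simp⟩

theorem tensorHom {A B C D : T} {f : A ⟶ B} {g : C ⟶ D} (hf : IsEqToHom f) (hg : IsEqToHom g) :
    IsEqToHom (f ⊗ₘ g) := by
  obtain ⟨rfl, rfl⟩ := hf
  obtain ⟨rfl, rfl⟩ := hg
  exact ⟨rfl, by simp⟩

end IsEqToHom

/-- The basic arc is the cap at the front of a word with empty remainder; juxtaposition with the
empty diagram leaves the pairing unchanged. -/
theorem epsX_eq (dL dR : ℂ) :
    epsX dL dR = (model dL dR).cap (.here (b := true) (b' := false) (by decide) []) :=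
  (congrArg ofDiagram (Diagram.ext (Diagram.tensor_id_nil_partner (Diagram.cap true)).symm)).trans
    (model_capFront _ []).symm

theorem epsXs_eq (dL dR : ℂ) :
    epsXs dL dR = (model dL dR).cap (.here (b := false) (b' := true) (by decide) []) :=
  (congrArg ofDiagram (Diagram.ext (Diagram.tensor_id_nil_partner (Diagram.cap false)).symm)).trans
    (model_capFront _ []).symm

section
variable {dL dR : ℂ} {T : Type*} [Category* T] [MonoidalCategory T]

/-- The object for a letter. -/
def letterObj (Y Ys : T) : Bool → T
  | true => Y
  | false => Ys

/-- The tensor product of the letters of a word. -/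
def wordObj (Y Ys : T) : Word → T
  | [] => 𝟙_ T
  -- A separate case, so that no unit factor is attached to a single letter and `F(X) = Y` holds on
  -- the nose even if `T` is not strict.
  | [a] => letterObj Y Ys a
  | a :: b :: s => letterObj Y Ys a ⊗ wordObj Y Ys (b :: s)

/-- Split off the first letter. -/
def wordSplit (Y Ys : T) (a : Bool) :
    ∀ s : Word, wordObj Y Ys (a :: s) ≅ letterObj Y Ys a ⊗ wordObj Y Ys s
  | [] => (ρ_ _).symm
  | _ :: _ => Iso.refl _

/-- The pairing of two opposite letters. -/
def letterPairing {Y Ys : T} (e : Y ⊗ Ys ⟶ 𝟙_ T) (es : Ys ⊗ Y ⟶ 𝟙_ T) :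
    ∀ {b b' : Bool}, b ≠ b' → (letterObj Y Ys b ⊗ letterObj Y Ys b' ⟶ 𝟙_ T)
  | true, false, _ => e
  | false, true, _ => es
  | true, true, h => absurd rfl h
  | false, false, h => absurd rfl h

/-- The copairing of two opposite letters. -/
def letterCopairing {Y Ys : T} (d : 𝟙_ T ⟶ Ys ⊗ Y) (ds : 𝟙_ T ⟶ Y ⊗ Ys) :
    ∀ {b b' : Bool}, b ≠ b' → (𝟙_ T ⟶ letterObj Y Ys b ⊗ letterObj Y Ys b')
  | true, false, _ => ds
  | false, true, _ => d
  | true, true, h => absurd rfl h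
  | false, false, h => absurd rfl h

theorem wordSplit_isEqToHom (hT : IsStrictMonoidal T) (Y Ys : T) (a : Bool) (s : Word) :
    IsEqToHom (wordSplit Y Ys a s).hom := by
  cases s with
  | nil => exact IsEqToHom.inv (f := ρ_ _) (hT.rightUnitor _)
  | cons => exact .id _

/-- The left side is `mapPairing` of a basic arc for the functor built below, with all definitions
unfolded. The unitors come from splitting one-letter words, and they cancel. -/
theorem unit_pairing {V W : T} (e : V ⊗ W ⟶ 𝟙_ T) :
    ((ρ_ V).inv ▷ W ≫ (α_ V (𝟙_ T) W).hom ≫ V ◁ (𝟙 (𝟙_ T) ▷ W ≫ (λ_ W).hom) ≫ 𝟙 (V ⊗ W)) ≫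
      (𝟙 (V ⊗ W) ≫ V ◁ (ρ_ W).inv ≫ (α_ V W (𝟙_ T)).inv ≫ e ▷ 𝟙_ T ≫ (λ_ (𝟙_ T)).hom) ≫
      𝟙 (𝟙_ T) = e := by
  simp [unitors_equal]

variable [Preadditive T] [Linear ℂ T]

/-- The model given by two rigidity pairings. -/
def ArcModel.ofPairings {Y Ys : T} {e : Y ⊗ Ys ⟶ 𝟙_ T} {es : Ys ⊗ Y ⟶ 𝟙_ T}
    {d : 𝟙_ T ⟶ Ys ⊗ Y} {ds : 𝟙_ T ⟶ Y ⊗ Ys} (h : IsRigidityPairing e d)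
    (hs : IsRigidityPairing es ds) (hL : ds ≫ e = dL • 𝟙 (𝟙_ T))
    (hR : d ≫ es = dR • 𝟙 (𝟙_ T)) : ArcModel dL dR T where
  obj := wordObj Y Ys
  letter := letterObj Y Ys
  split := wordSplit Y Ys
  ev := letterPairing e es
  coev := letterCopairing d ds
  rigid {b b'} hb := by
    cases b <;> cases b' <;> first | exact absurd rfl hb | assumption
  loop {b b'} hb := by
    cases b <;> cases b' <;> first | exact absurd rfl hb | assumption

/-- Over a strict target every ingredient of `tensorIso` is an identity up to an equality of
objects, a property stable under composition, inverses and whiskering. -/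
theorem ArcModel.tensorIso_isEqToHom (hT : IsStrictMonoidal T) (M : ArcModel dL dR T)
    (υ : M.obj [] ≅ 𝟙_ T) (hυ : IsEqToHom υ.hom) (hs : ∀ a s, IsEqToHom (M.split a s).hom)
    (u v : Word) : IsEqToHom (M.tensorIso υ u v).hom := by
  induction u with
  | nil => exact (hυ.whiskerRight _).comp (hT.leftUnitor _)
  | cons a u ih =>
    exact ((hs a u).whiskerRight _).comp (IsEqToHom.comp (hT.associator _ _ _)
      ((ih.whiskerLeft _).comp (hs a (u ++ v)).inv))

theorem exists_functor [MonoidalPreadditive T] [MonoidalLinear ℂ T] (hL : dL ≠ 0) (hR : dR ≠ 0)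
    {Y Ys : T} (e : Y ⊗ Ys ⟶ 𝟙_ T) (es : Ys ⊗ Y ⟶ 𝟙_ T)
    (d : 𝟙_ T ⟶ Ys ⊗ Y) (ds : 𝟙_ T ⟶ Y ⊗ Ys) (h : IsRigidityPairing e d)
    (hs : IsRigidityPairing es ds) (hl : ds ≫ e = dL • 𝟙 (𝟙_ T))
    (hr : d ≫ es = dR • 𝟙 (𝟙_ T)) :
    ∃ (F : KauffmanCat dL dR ⥤ T) (_ : F.Additive) (_ : F.Linear ℂ) (_ : F.Monoidal),
      TakesArcsTo F e es ∧ (IsStrictMonoidal T → IsStrictFunctor F) := by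
  let M := ArcModel.ofPairings h hs hl hr
  let υ : M.obj [] ≅ 𝟙_ T := Iso.refl _
  let core := M.coreMonoidal υ hL hR
  refine ⟨M.functor hL hR, ⟨fun {X _ f g} => M.map_add X.word f g⟩,
    ⟨fun {X _} f r => M.map_smul X.word r f⟩, core.toMonoidal, ?_, fun hT => ?_⟩
  · let _ := core.toMonoidal
    refine ⟨rfl, rfl, ?_, ?_⟩
    · have e1 : (M.functor hL hR).map (epsX dL dR) = _ :=
        (congrArg _ (epsX_eq dL dR)).trans (M.map_cap hL hR _)
      have e2 : mapPairing (M.functor hL hR) (epsX dL dR) = e := by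
        rw [mapPairing, e1]
        exact unit_pairing e
      refine e2.trans ?_
      change e = (𝟙 Y ⊗ₘ 𝟙 Ys) ≫ e
      simp
    · have e1 : (M.functor hL hR).map (epsXs dL dR) = _ :=
        (congrArg _ (epsXs_eq dL dR)).trans (M.map_cap hL hR _)
      have e2 : mapPairing (M.functor hL hR) (epsXs dL dR) = es := by
        rw [mapPairing, e1]
        exact unit_pairing es
      refine e2.trans ?_
      change es = (𝟙 Ys ⊗ₘ 𝟙 Y) ≫ es
      simp
  · let _ := core.toMonoidal
    exact ⟨IsEqToHom.id _, fun A B =>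
      M.tensorIso_isEqToHom hT υ (.id _) (wordSplit_isEqToHom hT Y Ys) A.word B.word⟩

end
end

noncomputable section

open CategoryTheory MonoidalCategory KauffmanCat Functor.LaxMonoidal Functor.OplaxMonoidal

/-! ### Images of pairings under monoidal functors. -/

section map
variable {S T : Type*} [Category* S] [Category* T] [MonoidalCategory S] [MonoidalCategory T]
  (F : S ⥤ T) [F.Monoidal]

theorem IsRigidityPairing.map {V W : S} {e : V ⊗ W ⟶ 𝟙_ S} {d : 𝟙_ S ⟶ W ⊗ V}
    (h : IsRigidityPairing e d) : IsRigidityPairing (mapPairing F e) (mapCopairing F d) where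
  zigzag := by
    have := congrArg F.map h.zigzag
    simp only [F.map_comp, Functor.Monoidal.map_whiskerLeft, Functor.Monoidal.map_whiskerRight,
      Functor.Monoidal.map_associator_inv, Functor.Monoidal.map_rightUnitor,
      Functor.Monoidal.map_leftUnitor_inv, Category.assoc, Functor.Monoidal.μ_δ_assoc] at this
    -- The image of the zigzag goes from `F (V ⊗ I)` to `F (I ⊗ V)`; the structure morphisms at both
    -- ends turn it into one from `F V ⊗ I` to `I ⊗ F V`.
    have := congrArg (fun f => F.obj V ◁ ε F ≫ μ F V (𝟙_ S) ≫ f ≫ δ F (𝟙_ S) V ≫ η F ▷ F.obj V) this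
    simp only [Category.assoc, Functor.Monoidal.μ_δ_assoc, Functor.Monoidal.whiskerLeft_ε_η_assoc,
      Functor.Monoidal.whiskerRight_ε_η, Category.comp_id] at this
    simp only [mapPairing, mapCopairing, MonoidalCategory.whiskerLeft_comp,
      MonoidalCategory.comp_whiskerRight, Category.assoc]
    exact this
  zigzag_dual := by
    have := congrArg F.map h.zigzag_dual
    simp only [F.map_comp, Functor.Monoidal.map_whiskerLeft, Functor.Monoidal.map_whiskerRight,
      Functor.Monoidal.map_associator, Functor.Monoidal.map_rightUnitor_inv,
      Functor.Monoidal.map_leftUnitor, Category.assoc, Functor.Monoidal.μ_δ_assoc] at this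
    have := congrArg (fun f => ε F ▷ F.obj W ≫ μ F (𝟙_ S) W ≫ f ≫ δ F W (𝟙_ S) ≫ F.obj W ◁ η F) this
    simp only [Category.assoc, Functor.Monoidal.μ_δ_assoc, Functor.Monoidal.whiskerRight_ε_η_assoc,
      Functor.Monoidal.whiskerLeft_ε_η, Category.comp_id] at this
    simp only [mapPairing, mapCopairing, MonoidalCategory.whiskerLeft_comp,
      MonoidalCategory.comp_whiskerRight, Category.assoc]
    exact this

theorem mapCopairing_comp_mapPairing {V W : S} (e : V ⊗ W ⟶ 𝟙_ S) (d : 𝟙_ S ⟶ V ⊗ W) :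
    mapCopairing F d ≫ mapPairing F e = ε F ≫ F.map (d ≫ e) ≫ η F := by
  simp [mapPairing, mapCopairing]

end map

/-- Uniqueness of the copairing for pairings on equal, not syntactically identical, objects, as they
arise from two functors. -/
theorem IsRigidityPairing.copairing_eq {T : Type*} [Category* T] [MonoidalCategory T]
    {V W V' W' : T} {e : V ⊗ W ⟶ 𝟙_ T} {d : 𝟙_ T ⟶ W ⊗ V} {e' : V' ⊗ W' ⟶ 𝟙_ T}
    {d' : 𝟙_ T ⟶ W' ⊗ V'} (h : IsRigidityPairing e d) (h' : IsRigidityPairing e' d')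
    (hV : V = V') (hW : W = W') (he : e = (eqToHom hV ⊗ₘ eqToHom hW) ≫ e') :
    d ≫ (eqToHom hW ⊗ₘ eqToHom hV) = d' := by
  subst hV hW
  obtain rfl : e = e' := by simpa using he
  simpa using h.copairing_unique h'

/-! ### Families compatible with tensor products, and naturality morphism by morphism. -/

section naturality
variable {S T : Type*} [Category* S] [Category* T] [MonoidalCategory S] [MonoidalCategory T]
  {F G : S ⥤ T} [F.Monoidal] [G.Monoidal] (θ : ∀ A, F.obj A ⟶ G.obj A)

/-- The family of morphisms is natural with respect to the morphism `f`. -/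
def IsNaturalAt {A B : S} (f : A ⟶ B) : Prop := F.map f ≫ θ B = θ A ≫ G.map f

/-- The family of morphisms is compatible with the monoidal structures. -/
structure IsMonoidalFamily : Prop where
  unit : ε F ≫ θ (𝟙_ S) = ε G
  tensor : ∀ A B, μ F A B ≫ θ (A ⊗ B) = (θ A ⊗ₘ θ B) ≫ μ G A B

variable {θ}

theorem IsNaturalAt.comp {A B C : S} {f : A ⟶ B} {g : B ⟶ C} (hf : IsNaturalAt θ f)
    (hg : IsNaturalAt θ g) : IsNaturalAt θ (f ≫ g) := by
  unfold IsNaturalAt at *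
  rw [F.map_comp, G.map_comp, Category.assoc, hg, reassoc_of% hf]

theorem IsMonoidalFamily.app_tensor (h : IsMonoidalFamily θ) (A B : S) :
    θ (A ⊗ B) = δ F A B ≫ (θ A ⊗ₘ θ B) ≫ μ G A B := by
  rw [← h.tensor, Functor.Monoidal.δ_μ_assoc]

theorem IsMonoidalFamily.app_unit (h : IsMonoidalFamily θ) : θ (𝟙_ S) = η F ≫ ε G := by
  rw [← h.unit, Functor.Monoidal.η_ε_assoc]

/-- The components at tensor products are determined by those at the factors, so naturality is
tested on the factor where `f` acts. -/
theorem IsNaturalAt.whiskerRight (h : IsMonoidalFamily θ) {A B : S} {f : A ⟶ B}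
    (hf : IsNaturalAt θ f) (C : S) : IsNaturalAt θ (f ▷ C) := by
  unfold IsNaturalAt at *
  rw [h.app_tensor, h.app_tensor, Functor.Monoidal.map_whiskerRight,
    Functor.Monoidal.map_whiskerRight]
  simp only [Category.assoc, Functor.Monoidal.μ_δ_assoc, MonoidalCategory.tensorHom_def]
  simp only [← comp_whiskerRight_assoc, hf, whisker_exchange_assoc]

theorem IsNaturalAt.whiskerLeft (h : IsMonoidalFamily θ) (C : S) {A B : S} {f : A ⟶ B}
    (hf : IsNaturalAt θ f) : IsNaturalAt θ (C ◁ f) := by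
  unfold IsNaturalAt at *
  rw [h.app_tensor, h.app_tensor, Functor.Monoidal.map_whiskerLeft,
    Functor.Monoidal.map_whiskerLeft]
  simp only [Category.assoc, Functor.Monoidal.μ_δ_assoc, tensorHom_def']
  simp only [← whiskerLeft_comp_assoc, hf, whisker_exchange_assoc]

/-- The hypothesis is the naturality square conjugated by invertible structure morphisms, which can
be cancelled. -/
theorem IsNaturalAt.of_mapPairing (h : IsMonoidalFamily θ) {A B : S} {e : A ⊗ B ⟶ 𝟙_ S}
    (he : mapPairing F e = (θ A ⊗ₘ θ B) ≫ mapPairing G e) : IsNaturalAt θ e := by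
  unfold IsNaturalAt
  rw [h.app_tensor, h.app_unit]
  have := congrArg (δ F A B ≫ · ≫ ε G) he
  simpa [mapPairing] using this

theorem IsNaturalAt.of_mapCopairing (h : IsMonoidalFamily θ) {A B : S} {d : 𝟙_ S ⟶ A ⊗ B}
    (hd : mapCopairing F d ≫ (θ A ⊗ₘ θ B) = mapCopairing G d) : IsNaturalAt θ d := by
  unfold IsNaturalAt
  rw [h.app_tensor, h.app_unit]
  have := congrArg (η F ≫ · ≫ μ G A B) hd
  simpa [mapCopairing] using this

end naturality
end

noncomputable section

open CategoryTheory MonoidalCategory KauffmanCat Functor.LaxMonoidal Functor.OplaxMonoidal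

/-! ### Comparison of two monoidal functors on diagrams. -/

section comparison
variable {dL dR : ℂ} {T : Type*} [Category* T] [MonoidalCategory T]
  {F G : KauffmanCat dL dR ⥤ T} [F.Monoidal] [G.Monoidal]

section
variable [Preadditive T] [Linear ℂ T]
  {θ : ∀ A, F.obj A ⟶ G.obj A} (h : IsMonoidalFamily θ)

include h in
theorem IsNaturalAt.cons (a : Bool) {u v : Word}
    {f : (KauffmanCat.mk u : KauffmanCat dL dR) ⟶ KauffmanCat.mk v} (hf : IsNaturalAt θ f) :
    IsNaturalAt θ ((model dL dR).cons a f) := by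
  rw [model_cons]
  exact hf.whiskerLeft h (KauffmanCat.mk [a])

include h in
theorem isNaturalAt_cap
    (hc : ∀ {b b' : Bool} (hb : b ≠ b'), IsNaturalAt θ (A := KauffmanCat.mk [b] ⊗ KauffmanCat.mk [b'])
      (B := 𝟙_ _) (ofDiagram (arcCap hb))) {u v : Word} (i : Site u v) :
    IsNaturalAt θ ((model dL dR).cap i) := by
  induction i with
  | here hb s =>
    have := (hc hb).whiskerRight h (KauffmanCat.mk s)
    have e := (model_capFront (dL := dL) (dR := dR) hb s).trans (ofDiagram_whiskerRight _ _).symm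
    change IsNaturalAt θ ((model dL dR).capFront hb s)
    rw [e]
    exact this
  | there a i ih => exact ih.cons h a

include h in
theorem isNaturalAt_cup
    (hc : ∀ {b b' : Bool} (hb : b ≠ b'), IsNaturalAt θ (A := 𝟙_ _)
      (B := KauffmanCat.mk [b] ⊗ KauffmanCat.mk [b']) (ofDiagram (arcCup hb)))
    {u v : Word} (i : Site u v) :
    IsNaturalAt θ ((model dL dR).cup i) := by
  induction i with
  | here hb s =>
    have := (hc hb).whiskerRight h (KauffmanCat.mk s)
    have e := (model_cupFront (dL := dL) (dR := dR) hb s).trans (ofDiagram_whiskerRight _ _).symm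
    change IsNaturalAt θ ((model dL dR).cupFront hb s)
    rw [e]
    exact this
  | there a i ih => exact ih.cons h a

include h in
-- Naturality survives composition, whiskering and linear combinations, and the four arcs generate
-- all morphisms under these operations.
theorem isNaturalAt_of_arcs [F.Additive] [F.Linear ℂ] [G.Additive] [G.Linear ℂ]
    (h1 : IsNaturalAt θ (epsX dL dR)) (h2 : IsNaturalAt θ (epsXs dL dR))
    (h3 : IsNaturalAt θ (delX dL dR)) (h4 : IsNaturalAt θ (delXs dL dR))
    {u v : Word} (f : (KauffmanCat.mk u : KauffmanCat dL dR) ⟶ KauffmanCat.mk v) :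
    IsNaturalAt θ f := by
  have hcap := @isNaturalAt_cap _ _ _ _ _ _ _ _ _ _ _ _ h (by
    intro b b' hb
    cases b <;> cases b' <;> first | exact absurd rfl hb | assumption)
  have hcup := @isNaturalAt_cup _ _ _ _ _ _ _ _ _ _ _ _ h (by
    intro b b' hb
    cases b <;> cases b' <;> first | exact absurd rfl hb | assumption)
  induction generated f with
  | id => simp [IsNaturalAt]
  | zero v => simp [IsNaturalAt]
  | add _ _ hf hg =>
    unfold IsNaturalAt at *
    rw [F.map_add, G.map_add, Preadditive.add_comp, Preadditive.comp_add, hf, hg]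
  | smul r _ hf =>
    unfold IsNaturalAt at *
    rw [F.map_smul, G.map_smul, Linear.smul_comp, Linear.comp_smul, hf]
  | cup i _ hf => exact hf.comp (hcup i)
  | cap i _ hf => exact hf.comp (hcap i)

end

theorem μ_nil (H : KauffmanCat dL dR ⥤ T) [H.Monoidal] (v : Word) :
    μ H ⟨[]⟩ ⟨v⟩ = η H ▷ H.obj ⟨v⟩ ≫ (λ_ (H.obj ⟨v⟩)).hom := by
  have e : (λ_ (H.obj ⟨v⟩)).hom = ε H ▷ H.obj ⟨v⟩ ≫ μ H ⟨[]⟩ ⟨v⟩ :=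
    (Functor.LaxMonoidal.left_unitality H ⟨v⟩).trans
      (congrArg _ ((congrArg _ (H.map_id _)).trans (Category.comp_id _)))
  rw [e]
  exact (Functor.Monoidal.whiskerRight_η_ε_assoc H (H.obj ⟨v⟩) _).symm

/-- Only one letter is considered, since `[a] ++ []` reduces to `[a]` and the right unitor is then
an identity by computation. -/
theorem μ_letter_nil (H : KauffmanCat dL dR ⥤ T) [H.Monoidal] (a : Bool) :
    μ H ⟨[a]⟩ ⟨[]⟩ = H.obj ⟨[a]⟩ ◁ η H ≫ (ρ_ (H.obj ⟨[a]⟩)).hom := by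
  have e : (ρ_ (H.obj ⟨[a]⟩)).hom = H.obj ⟨[a]⟩ ◁ ε H ≫ μ H ⟨[a]⟩ ⟨[]⟩ :=
    (Functor.LaxMonoidal.right_unitality H ⟨[a]⟩).trans
      (congrArg _ ((congrArg _ (H.map_id _)).trans (Category.comp_id _)))
  rw [e]
  exact (Functor.Monoidal.whiskerLeft_η_ε_assoc H (H.obj ⟨[a]⟩) _).symm

theorem μ_cons (H : KauffmanCat dL dR ⥤ T) [H.Monoidal] (a : Bool) (u v : Word) :
    μ H ⟨[a]⟩ ⟨u⟩ ▷ H.obj ⟨v⟩ ≫ μ H ⟨a :: u⟩ ⟨v⟩ =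
      (α_ _ _ _).hom ≫ H.obj ⟨[a]⟩ ◁ μ H ⟨u⟩ ⟨v⟩ ≫ μ H ⟨[a]⟩ ⟨u ++ v⟩ := by
  refine Eq.trans ?_ (Functor.LaxMonoidal.associativity H ⟨[a]⟩ ⟨u⟩ ⟨v⟩)
  exact congrArg _ ((congrArg _ (H.map_id _)).trans (Category.comp_id _)).symm

section
variable (F G) (t : ∀ a : Bool, F.obj ⟨[a]⟩ ≅ G.obj ⟨[a]⟩)

/-- Extend isomorphisms for the letters to the words. -/
def wordIso : ∀ s : Word, F.obj ⟨s⟩ ≅ G.obj ⟨s⟩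
  | [] => (Functor.Monoidal.εIso F).symm ≪≫ Functor.Monoidal.εIso G
  | a :: s => (Functor.Monoidal.μIso F ⟨[a]⟩ ⟨s⟩).symm ≪≫ (t a ⊗ᵢ wordIso s) ≪≫
      Functor.Monoidal.μIso G ⟨[a]⟩ ⟨s⟩

theorem wordIso_nil_hom : (wordIso F G t []).hom = η F ≫ ε G := rfl

theorem wordIso_cons_hom (a : Bool) (s : Word) : (wordIso F G t (a :: s)).hom =
    δ F ⟨[a]⟩ ⟨s⟩ ≫ ((t a).hom ⊗ₘ (wordIso F G t s).hom) ≫ μ G ⟨[a]⟩ ⟨s⟩ := rfl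

/-- The recursion fixes compatibility for one letter in front of a word; the associativity law of
`F` and `G`, in the form `μ_cons`, propagates it to arbitrary products. -/
theorem wordIso_append (u v : Word) :
    μ F ⟨u⟩ ⟨v⟩ ≫ (wordIso F G t (u ++ v)).hom =
      ((wordIso F G t u).hom ⊗ₘ (wordIso F G t v).hom) ≫ μ G ⟨u⟩ ⟨v⟩ := by
  induction u with
  | nil =>
    rw [wordIso_nil_hom, μ_nil, μ_nil]
    change (η F ▷ F.obj ⟨v⟩ ≫ (λ_ (F.obj ⟨v⟩)).hom) ≫ (wordIso F G t v).hom =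
      ((η F ≫ ε G) ⊗ₘ (wordIso F G t v).hom) ≫ η G ▷ G.obj ⟨v⟩ ≫ (λ_ (G.obj ⟨v⟩)).hom
    simp only [MonoidalCategory.tensorHom_def, comp_whiskerRight, Category.assoc,
      whisker_exchange_assoc, Functor.Monoidal.whiskerRight_ε_η_assoc, leftUnitor_naturality]
  | cons a u ih =>
    -- Composing with this isomorphism first makes both sides start at `(F a ⊗ F u) ⊗ F v`, where
    -- `μ_cons` applies.
    rw [← cancel_epi (μ F ⟨[a]⟩ ⟨u⟩ ▷ F.obj ⟨v⟩), ← Category.assoc, μ_cons, wordIso_cons_hom]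
    have e : (wordIso F G t (a :: u ++ v)).hom = _ := wordIso_cons_hom F G t a (u ++ v)
    have l : μ F ⟨[a]⟩ ⟨u⟩ ▷ F.obj ⟨v⟩ ≫ ((δ F ⟨[a]⟩ ⟨u⟩ ≫ ((t a).hom ⊗ₘ (wordIso F G t u).hom) ≫
        μ G ⟨[a]⟩ ⟨u⟩) ⊗ₘ (wordIso F G t v).hom) =
        (((t a).hom ⊗ₘ (wordIso F G t u).hom) ⊗ₘ (wordIso F G t v).hom) ≫
          μ G ⟨[a]⟩ ⟨u⟩ ▷ G.obj ⟨v⟩ := by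
      rw [← MonoidalCategory.tensorHom_id, ← MonoidalCategory.tensorHom_id]
      simp only [MonoidalCategory.tensorHom_comp_tensorHom, Category.id_comp, Category.comp_id,
        Functor.Monoidal.μ_δ_assoc]
    rw [e]
    refine Eq.trans ?_ (congrArg (· ≫ μ G ⟨a :: u⟩ ⟨v⟩) l.symm |>.trans (Category.assoc _ _ _))
    have r : F.obj ⟨[a]⟩ ◁ μ F ⟨u⟩ ⟨v⟩ ≫ ((t a).hom ⊗ₘ (wordIso F G t (u ++ v)).hom) =
        ((t a).hom ⊗ₘ (wordIso F G t u).hom ⊗ₘ (wordIso F G t v).hom) ≫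
          G.obj ⟨[a]⟩ ◁ μ G ⟨u⟩ ⟨v⟩ := by
      rw [← MonoidalCategory.id_tensorHom, ← MonoidalCategory.id_tensorHom,
        MonoidalCategory.tensorHom_comp_tensorHom, MonoidalCategory.tensorHom_comp_tensorHom, ih,
        Category.id_comp, Category.comp_id]
    simp only [Category.assoc, Functor.Monoidal.μ_δ_assoc]
    rw [μ_cons, MonoidalCategory.associator_naturality_assoc, reassoc_of% r]

theorem isMonoidalFamily_wordIso :
    IsMonoidalFamily fun A : KauffmanCat dL dR => (wordIso F G t A.word).hom where
  unit := by
    change ε F ≫ η F ≫ ε G = ε G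
    simp
  tensor A B := wordIso_append F G t A.word B.word

theorem wordIso_letter (a : Bool) : (wordIso F G t [a]).hom = (t a).hom := by
  rw [wordIso_cons_hom, wordIso_nil_hom, ← cancel_epi (μ F ⟨[a]⟩ ⟨[]⟩), Functor.Monoidal.μ_δ_assoc,
    μ_letter_nil, μ_letter_nil]
  change ((t a).hom ⊗ₘ (η F ≫ ε G)) ≫ G.obj ⟨[a]⟩ ◁ η G ≫ (ρ_ (G.obj ⟨[a]⟩)).hom = _
  simp [MonoidalCategory.tensorHom_def', whisker_exchange_assoc]

/-- Gives the uniqueness of the isomorphism: compatibility with units and products forces every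
component from those at the letters. -/
theorem app_eq_wordIso {θ : ∀ A, F.obj A ⟶ G.obj A} (h : IsMonoidalFamily θ)
    (ht : ∀ a, θ ⟨[a]⟩ = (t a).hom) (s : Word) : θ ⟨s⟩ = (wordIso F G t s).hom := by
  induction s with
  | nil => exact h.app_unit
  | cons a s ih =>
    refine (h.app_tensor ⟨[a]⟩ ⟨s⟩).trans ?_
    rw [ht, ih, wordIso_cons_hom]

theorem wordIso_isEqToHom (hF : IsStrictFunctor F) (hG : IsStrictFunctor G)
    (ht : ∀ a, IsEqToHom (t a).hom) (s : Word) : IsEqToHom (wordIso F G t s).hom := by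
  induction s with
  | nil => exact (IsEqToHom.of_inverse hF.unit (Functor.Monoidal.ε_η F)).comp hG.unit
  | cons a s ih =>
    exact (IsEqToHom.of_inverse (hF.tensor ⟨[a]⟩ ⟨s⟩) (Functor.Monoidal.μ_δ F _ _)).comp
      (((ht a).tensorHom ih).comp (hG.tensor ⟨[a]⟩ ⟨s⟩))

end

section
variable [Preadditive T] [Linear ℂ T] [F.Additive] [F.Linear ℂ] [G.Additive] [G.Linear ℂ]
  {Y Ys : T} {e : Y ⊗ Ys ⟶ 𝟙_ T} {es : Ys ⊗ Y ⟶ 𝟙_ T}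

/-- Two functors with the same values on the letters agree there. -/
def letterIso (h : F.obj (X dL dR) = G.obj (X dL dR)) (h' : F.obj (Xs dL dR) = G.obj (Xs dL dR)) :
    ∀ a : Bool, F.obj ⟨[a]⟩ ≅ G.obj ⟨[a]⟩
  | true => eqToIso h
  | false => eqToIso h'

variable (dL dR) in
theorem rigid_epsX : IsRigidityPairing (epsX dL dR) (delX dL dR) :=
  arc_rigid (b := true) (b' := false) (by decide)

variable (dL dR) in
theorem rigid_epsXs : IsRigidityPairing (epsXs dL dR) (delXs dL dR) :=
  arc_rigid (b := false) (b' := true) (by decide)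

/-- The components are kept explicit, since uniqueness, monoidality and the strict case are all read
off from `wordIso`. -/
theorem exists_natIso (hF : TakesArcsTo F e es) (hG : TakesArcsTo G e es) :
    ∃ (h : F.obj (X dL dR) = G.obj (X dL dR)) (h' : F.obj (Xs dL dR) = G.obj (Xs dL dR))
      (θ : F ≅ G), ∀ A, θ.hom.app A = (wordIso F G (letterIso h h') A.word).hom := by
  obtain ⟨hX, hXs, h1, h2⟩ := hF
  obtain ⟨gX, gXs, k1, k2⟩ := hG
  have eX := hX.trans gX.symm
  have eXs := hXs.trans gXs.symm
  have pX : mapPairing F (epsX dL dR) = (eqToHom eX ⊗ₘ eqToHom eXs) ≫ mapPairing G (epsX dL dR) := by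
    rw [h1, k1, MonoidalCategory.tensorHom_comp_tensorHom_assoc, eqToHom_trans, eqToHom_trans]
  have pXs : mapPairing F (epsXs dL dR) =
      (eqToHom eXs ⊗ₘ eqToHom eX) ≫ mapPairing G (epsXs dL dR) := by
    rw [h2, k2, MonoidalCategory.tensorHom_comp_tensorHom_assoc, eqToHom_trans, eqToHom_trans]
  -- Agreement on the copairings is not assumed; it follows from agreement on the pairings.
  have qX := ((rigid_epsX dL dR).map F).copairing_eq ((rigid_epsX dL dR).map G) eX eXs pX
  have qXs := ((rigid_epsXs dL dR).map F).copairing_eq ((rigid_epsXs dL dR).map G) eXs eX pXs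
  have hm := isMonoidalFamily_wordIso F G (letterIso eX eXs)
  have tX : (wordIso F G (letterIso eX eXs) (X dL dR).word).hom = eqToHom eX :=
    wordIso_letter F G (letterIso eX eXs) true
  have tXs : (wordIso F G (letterIso eX eXs) (Xs dL dR).word).hom = eqToHom eXs :=
    wordIso_letter F G (letterIso eX eXs) false
  refine ⟨eX, eXs, NatIso.ofComponents (fun A => wordIso F G (letterIso eX eXs) A.word)
    fun {A B} f => isNaturalAt_of_arcs (u := A.word) (v := B.word) hm ?_ ?_ ?_ ?_ f, fun A => rfl⟩
  · exact .of_mapPairing hm (by rw [tX, tXs]; exact pX)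
  · exact .of_mapPairing hm (by rw [tX, tXs]; exact pXs)
  · exact .of_mapCopairing hm (by rw [tX, tXs]; exact qX)
  · exact .of_mapCopairing hm (by rw [tX, tXs]; exact qXs)

theorem isMonoidalFamily_app {θ : F ⟶ G} (h : NatTrans.IsMonoidal θ) :
    IsMonoidalFamily fun A => θ.app A := ⟨h.unit, h.tensor⟩

theorem existsUnique_natIso (hF : TakesArcsTo F e es) (hG : TakesArcsTo G e es) :
    ∃! θ : F ≅ G, NatTrans.IsMonoidal θ.hom ∧ (∃ h, θ.hom.app (X dL dR) = eqToHom h) ∧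
      (∃ h, θ.hom.app (Xs dL dR) = eqToHom h) := by
  obtain ⟨eX, eXs, θ, hθ⟩ := exists_natIso hF hG
  have hm := isMonoidalFamily_wordIso F G (letterIso eX eXs)
  refine ⟨θ, ⟨⟨?_, fun A B => ?_⟩, ⟨eX, ?_⟩, ⟨eXs, ?_⟩⟩, ?_⟩
  · rw [hθ]; exact hm.unit
  · rw [hθ, hθ, hθ]; exact hm.tensor A B
  · rw [hθ]; exact wordIso_letter F G (letterIso eX eXs) true
  · rw [hθ]; exact wordIso_letter F G (letterIso eX eXs) false
  · rintro θ' ⟨hm', ⟨_, h1⟩, ⟨_, h2⟩⟩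
    ext A
    rw [hθ]
    refine app_eq_wordIso F G (letterIso eX eXs) (isMonoidalFamily_app hm') (fun a => ?_) A.word
    cases a
    · exact h2
    · exact h1

theorem eq_of_isStrictFunctor (sF : IsStrictFunctor F) (sG : IsStrictFunctor G)
    (hF : TakesArcsTo F e es) (hG : TakesArcsTo G e es) : F = G := by
  obtain ⟨eX, eXs, θ, hθ⟩ := exists_natIso hF hG
  have strict : ∀ A, IsEqToHom (θ.hom.app A) := fun A => by
    rw [hθ]
    refine wordIso_isEqToHom F G _ sF sG (fun a => ?_) A.word
    cases a
    · exact ⟨eXs, rfl⟩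
    · exact ⟨eX, rfl⟩
  choose h h' using strict
  -- With components that are transports along equalities of objects, naturality is the equality of
  -- the two functors on morphisms.
  refine CategoryTheory.Functor.ext h fun A B f => ?_
  have := θ.hom.naturality f
  rw [h', h'] at this
  rw [← reassoc_of% this]
  simp

end

end comparison

end

end OrientedKauffman

open CategoryTheory MonoidalCategory OrientedKauffman in
theorem lemma2p1 (dL dR : ℂ) (hL : dL ≠ 0) (hR : dR ≠ 0)
    {T : Type*} [Category* T] [Preadditive T] [Linear ℂ T] [MonoidalCategory T]
    [MonoidalPreadditive T] [MonoidalLinear ℂ T] :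
    -- the images of the basic arcs are rigidity pairings with loop values `dL` and `dR`, and the
    -- images of the basic copairings are the copairings determined by them
    (∀ (F : KauffmanCat dL dR ⥤ T) [F.Additive] [F.Linear ℂ] [F.Monoidal],
      IsRigidityPairing (mapPairing F (KauffmanCat.epsX dL dR))
        (mapCopairing F (KauffmanCat.delX dL dR)) ∧
      IsRigidityPairing (mapPairing F (KauffmanCat.epsXs dL dR))
        (mapCopairing F (KauffmanCat.delXs dL dR)) ∧
      mapCopairing F (KauffmanCat.delXs dL dR) ≫ mapPairing F (KauffmanCat.epsX dL dR) =
        dL • 𝟙 (𝟙_ T) ∧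
      mapCopairing F (KauffmanCat.delX dL dR) ≫ mapPairing F (KauffmanCat.epsXs dL dR) =
        dR • 𝟙 (𝟙_ T) ∧
      (∀ d, IsRigidityPairing (mapPairing F (KauffmanCat.epsX dL dR)) d →
        d = mapCopairing F (KauffmanCat.delX dL dR)) ∧
      (∀ d, IsRigidityPairing (mapPairing F (KauffmanCat.epsXs dL dR)) d →
        d = mapCopairing F (KauffmanCat.delXs dL dR))) ∧
    -- a strict monoidal functor is determined by the images of the basic pairings
    (∀ (F G : KauffmanCat dL dR ⥤ T) [F.Additive] [F.Linear ℂ] [F.Monoidal]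
      [G.Additive] [G.Linear ℂ] [G.Monoidal],
      IsStrictFunctor F → IsStrictFunctor G →
      ∀ (Y Ys : T) (e : Y ⊗ Ys ⟶ 𝟙_ T) (es : Ys ⊗ Y ⟶ 𝟙_ T),
        TakesArcsTo F e es → TakesArcsTo G e es → F = G) ∧
    -- a monoidal functor is determined by them up to a unique monoidal isomorphism
    (∀ (F G : KauffmanCat dL dR ⥤ T) [F.Additive] [F.Linear ℂ] [F.Monoidal]
      [G.Additive] [G.Linear ℂ] [G.Monoidal]
      (Y Ys : T) (e : Y ⊗ Ys ⟶ 𝟙_ T) (es : Ys ⊗ Y ⟶ 𝟙_ T),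
        TakesArcsTo F e es → TakesArcsTo G e es →
        ∃! θ : F ≅ G, NatTrans.IsMonoidal θ.hom ∧
          (∃ h, θ.hom.app (KauffmanCat.X dL dR) = eqToHom h) ∧
          (∃ h, θ.hom.app (KauffmanCat.Xs dL dR) = eqToHom h)) ∧
    -- rigidity pairings with loop values `dL` and `dR` extend to a monoidal functor, which is strict
    -- if `T` is strict
    (∀ (Y Ys : T) (e : Y ⊗ Ys ⟶ 𝟙_ T) (es : Ys ⊗ Y ⟶ 𝟙_ T)
      (d : 𝟙_ T ⟶ Ys ⊗ Y) (ds : 𝟙_ T ⟶ Y ⊗ Ys),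
      IsRigidityPairing e d → IsRigidityPairing es ds →
      ds ≫ e = dL • 𝟙 (𝟙_ T) → d ≫ es = dR • 𝟙 (𝟙_ T) →
      ∃ (F : KauffmanCat dL dR ⥤ T) (_ : F.Additive) (_ : F.Linear ℂ) (_ : F.Monoidal),
        TakesArcsTo F e es ∧ (IsStrictMonoidal T → IsStrictFunctor F)) := by
  refine ⟨fun F _ _ _ => ?_, fun F G _ _ _ _ _ _ sF sG Y Ys e es hF hG =>
    eq_of_isStrictFunctor sF sG hF hG, fun F G _ _ _ _ _ _ Y Ys e es hF hG =>
    existsUnique_natIso hF hG, fun Y Ys e es d ds => exists_functor hL hR e es d ds⟩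
  have hX := (rigid_epsX dL dR).map F
  have hXs := (rigid_epsXs dL dR).map F
  have lX : KauffmanCat.delXs dL dR ≫ KauffmanCat.epsX dL dR = dL • 𝟙 _ :=
    KauffmanCat.arc_loop (b := true) (b' := false) (by decide)
  have lXs : KauffmanCat.delX dL dR ≫ KauffmanCat.epsXs dL dR = dR • 𝟙 _ :=
    KauffmanCat.arc_loop (b := false) (b' := true) (by decide)
  refine ⟨hX, hXs, ?_, ?_, fun d hd => hd.copairing_unique hX, fun d hd => hd.copairing_unique hXs⟩
  · rw [mapCopairing_comp_mapPairing, lX]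
    simp
  · rw [mapCopairing_comp_mapPairing, lXs]
    simp
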